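/- Let $0<\beta\le 1$ and let $u_0:\mathbb R^2\to\mathbb R^2$ be a vector field with $\lambda u_0(\lambda x)=u_0(x)$ for all $\lambda>0$ and $x\neq0$, with $A:=\|u_0\|_{C^{0,\beta}(S^1)}=\sup_{S^1}|u_0|+[u_0]_{C^{0,\beta}(S^1)}<\infty$, and divergence-free on $\mathbb R^2$ in the sense of distributions. Put $$v_0(y)=(e^{\Delta}u_0)(y)=\int_{\mathbb R^2}\frac1{4\pi}e^{-|y-z|^2/4}u_0(z)\,dz .$$ Let $X$ be the space of divergence-free fields $v\in C^1(\mathbb R^2;\mathbb R^2)$ for which $(1+|y|^2)v$ and $(1+|y|^2)\nabla v$ are bounded, and let $(v_{\mathrm{re}},q)\in X\times L^2(\mathbb R^2)$ solve, in the sense of distributions on $\mathbb R^2$, $$-\Delta v_{\mathrm{re}}-\tfrac12 v_{\mathrm{re}}-\tfrac12\,y\cdot\nabla v_{\mathrm{re}}+v_0\cdot\nabla v_{\mathrm{re}}+v_{\mathrm{re}}\cdot\nabla v_0+v_{\mathrm{re}}\cdot\nabla v_{\mathrm{re}}+\nabla q=-v_0\cdot\nabla v_0 .$$ Then $\sqrt{1+|y|^2}\,v_{\mathrm{re}}\in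 H^1(\mathbb R^2)$ and $$\big\|\sqrt{1+|y|^2}\,v_{\mathrm{re}}\big\|_{H^1(\mathbb R^2)}\le C(A,\beta),$$ where the constant $C(A,\beta)$ depends only on $A$ and $\beta$. -/

import Mathlib

open MeasureTheory
open scoped ENNReal NNReal ContDiff

noncomputable section

namespace SelfSimilarNS

/-- The Euclidean plane. -/
abbrev Plane : Type := EuclideanSpace ℝ (Fin 2)

/-- The standard basis vectors of the plane. -/
def e (i : Fin 2) : Plane := EuclideanSpace.single i 1

/-- The (classical) divergence `∂₁ v₁ + ∂₂ v₂` of a differentiable vector field. -/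
def divergence (v : Plane → Plane) (y : Plane) : ℝ :=
  ∑ i, (fderiv ℝ v y (e i)) i

/-- Smooth compactly supported functions on the plane. -/
def IsTest {F : Type*} [NormedAddCommGroup F] [NormedSpace ℝ F] (φ : Plane → F) : Prop :=
  ContDiff ℝ ∞ φ ∧ HasCompactSupport φ

/-! ### Initial data -/

/-- Invariance under `u ↦ l u(l ·)` away from the origin; the value at the origin is irrelevant. -/
def IsSelfSimilar (u₀ : Plane → Plane) : Prop :=
  ∀ l : ℝ, 0 < l → ∀ x : Plane, x ≠ 0 → l • u₀ (l • x) = u₀ x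

/-- `div u₀ = 0` in the sense of distributions on the whole plane. -/
def IsWeaklyDivFree (u₀ : Plane → Plane) : Prop :=
  ∀ φ : Plane → ℝ, IsTest φ → ∫ x, fderiv ℝ φ x (u₀ x) = 0

/-- The norm of `C^{0,β}(S¹)`: sup norm plus Hölder seminorm of the restriction to the unit circle
(possibly infinite). -/
def circleHolderNorm (β : ℝ≥0) (u₀ : Plane → Plane) : ℝ≥0∞ :=
  (⨆ x : Metric.sphere (0 : Plane) 1, ‖u₀ x‖ₑ) +
    eHolderNorm β (fun x : Metric.sphere (0 : Plane) 1 => u₀ x)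

/-- The heat evolution `(e^{tΔ} u₀)(x) = ∫ (4πt)⁻¹ exp(-|x-z|²/(4t)) u₀(z) dz` in the plane. -/
def heatEvolution (t : ℝ) (u₀ : Plane → Plane) (x : Plane) : Plane :=
  ∫ z, (1 / (4 * Real.pi * t) * Real.exp (-‖x - z‖ ^ 2 / (4 * t))) • u₀ z

/-! ### The class `X` and the perturbed Leray system -/

/-- The space `X` of divergence-free `C¹` fields `v` such that
`(1 + |y|²) v` and `(1 + |y|²) ∇v` are bounded. -/
def MemX (v : Plane → Plane) : Prop :=
  ContDiff ℝ 1 v ∧ (∀ y, divergence v y = 0) ∧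
    ∃ M : ℝ, ∀ y, (1 + ‖y‖ ^ 2) * ‖v y‖ ≤ M ∧ (1 + ‖y‖ ^ 2) * ‖fderiv ℝ v y‖ ≤ M

/-- `(v, q)` solves
`-Δv - v/2 - (y·∇)v/2 + (v₀·∇)v + (v·∇)v₀ + (v·∇)v + ∇q = -(v₀·∇)v₀`
in the sense of distributions on the plane (for `v` and `v₀` of class `C¹` and `q` locally
integrable). Here `(a·∇)b` at `y` is `fderiv ℝ b y (a y)`. -/
def IsPerturbedLeraySolution (v₀ v : Plane → Plane) (q : Plane → ℝ) : Prop :=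
  ∀ φ : Plane → Plane, IsTest φ →
    ∫ y, ((∑ i, inner ℝ (fderiv ℝ v y (e i)) (fderiv ℝ φ y (e i)))
        - (1 / 2 : ℝ) * inner ℝ (v y) (φ y)
        - (1 / 2 : ℝ) * inner ℝ (fderiv ℝ v y y) (φ y)
        + inner ℝ (fderiv ℝ v y (v₀ y)) (φ y)
        + inner ℝ (fderiv ℝ v₀ y (v y)) (φ y)
        + inner ℝ (fderiv ℝ v y (v y)) (φ y)
        - q y * divergence φ y)
      = - ∫ y, inner ℝ (fderiv ℝ v₀ y (v₀ y)) (φ y)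

/-! ### The Sobolev space `H¹` -/

/-- `G 0, G 1` are the weak partial derivatives of the vector field `f`. -/
def IsWeakGradient (f : Plane → Plane) (G : Fin 2 → Plane → Plane) : Prop :=
  LocallyIntegrable f ∧ ∀ i, LocallyIntegrable (G i) ∧
    ∀ φ : Plane → ℝ, IsTest φ →
      ∫ y, (fderiv ℝ φ y (e i)) • f y = - ∫ y, φ y • G i y

/-- `f ∈ H¹(ℝ²)`: `f` and its weak partial derivatives are square integrable. -/
def MemH1 (f : Plane → Plane) : Prop :=
  MemLp f 2 ∧ ∃ G, IsWeakGradient f G ∧ ∀ i, MemLp (G i) 2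

/-- The norm `(‖f‖² + ‖∂₁f‖² + ‖∂₂f‖²)^{1/2}` of `H¹(ℝ²)`, with `L²` norms on the right. The weak
gradient is unique up to null sets, so the infimum only selects it (and is `∞` if there is none). -/
def eH1Norm (f : Plane → Plane) : ℝ≥0∞ :=
  ⨅ (G : Fin 2 → Plane → Plane) (_ : IsWeakGradient f G),
    (eLpNorm f 2 volume ^ 2 + ∑ i, eLpNorm (G i) 2 volume ^ 2) ^ (1 / 2 : ℝ)

/-- The field `y ↦ √(1 + |y|²) v(y)`. -/
def weightedField (v : Plane → Plane) (y : Plane) : Plane :=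
  Real.sqrt (1 + ‖y‖ ^ 2) • v y

end SelfSimilarNS

end

/-!
The estimate is a chain of energy identities; compactness and regularity theory are not needed.
Write `v` for `v_re`, `V = v₀ + v`, `w = 1 + |y|²`.

*The background profile.* Since the data are self-similar, `s v₀(s y)` is the convolution of the data
with a rescaled heat kernel, and differentiation at `s = 1` gives `v₀ + y · ∇v₀ = -2 Δv₀`
(`conv_gauss_profile`). Both `v₀` and `∇v₀` are `O(1 / |y|)`, and Hölder continuity on the circle
improves the gradient to `O(|y|^(-1-β))` (`norm_conv_dgauss_le`), so that `∇v₀ ∈ L²`. These facts,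
with one constant `c = c(A, β)`, are recorded in `IsProfile`; nothing else about the data is used.

*The Dirichlet energy.* Testing the system with `v` gives
`∫ |∇v|² + ∫ (V · ∇v₀) · v = 0`: in the plane the term `-v/2 - (y · ∇v)/2` contributes nothing.
Testing it with `v₀` and using the profile equation gives
`2 ∫ ∇v : ∇v₀ = ∫ (V · ∇v₀) · v`. In the sum the indefinite production term cancels, whence
`∫ |∇v|² ≤ 4c` without smallness (`integral_gradSq_le`). With Ladyzhenskaya's inequality
`‖v‖₄⁴ ≤ C ‖v‖₂² ‖∇v‖₂²` this gives `‖v‖₄² ≤ τ ‖v‖₂` with `τ` depending on `c` only.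

*The pressure.* Gradients of test functions turn the system into `-Δq = ∂ᵢ∂ⱼ(VᵢVⱼ)`. As the Hessian
and the Laplacian of a test function have the same `L²` norm, `∫ q Δη ≤ ‖V‖₄² ‖Δη‖₂`; Laplacians of
test functions are dense in `L²` by Weyl's and Liouville's theorems (`topologicalClosure_lapTest`),
and so `‖q‖₂ ≤ ‖V‖₄²` (`integral_pressure_sq_le`).

*The weighted estimate.* Testing with `ψ v`, `ψ = w^s`, `1/2 ≤ s < 1`, is legitimate for `v ∈ X`. The
dilation term now produces the damping `¼ ∫ (y · ∇ψ) |v|² ≥ ¼ ∫ (ψ - 1) |v|²`, and since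
`|∇ψ| ≤ 2 √ψ` and `√ψ |v₀| ≤ c`, all other terms are at most linear in
`K = ‖√ψ v‖₂` (`weighted_pointwise_le`). What remains is `‖v‖₂`, which is interpolated between `K` with
a small factor and `‖v‖₄ ≤ (τ ‖v‖₂)^{1/2}` (`integral_norm_sq_le_interpolate`). The resulting bound for
`∫ ψ (|∇v|² + |v|²)` depends on `c` only (`exists_weighted_bound`), and Fatou's lemma allows `s → 1`
(`exists_critical_bound`).
-/

noncomputable section

namespace SelfSimilarNS

open Filter Topology
open scoped Convolution

/-! ### Partial derivatives and the divergence theorem -/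


/-- The partial derivative `∂ᵢ f`. -/
def pd {F : Type*} [NormedAddCommGroup F] [NormedSpace ℝ F] (i : Fin 2) (f : Plane → F)
    (y : Plane) : F :=
  fderiv ℝ f y (e i)

lemma sum_apply_smul_e (h : Plane) : ∑ i, h i • e i = h := by
  ext j
  fin_cases j <;> simp [e]

lemma fderiv_apply_eq_sum {F : Type*} [NormedAddCommGroup F] [NormedSpace ℝ F] (f : Plane → F)
    (y h : Plane) : fderiv ℝ f y h = ∑ i, h i • pd i f y := by
  conv_lhs => rw [← sum_apply_smul_e h]
  simp [pd]

lemma norm_e (i : Fin 2) : ‖e i‖ = 1 := by simp [e]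

lemma norm_pd_le {F : Type*} [NormedAddCommGroup F] [NormedSpace ℝ F] (i : Fin 2) (f : Plane → F)
    (y : Plane) : ‖pd i f y‖ ≤ ‖fderiv ℝ f y‖ := by
  simpa [norm_e, pd] using (fderiv ℝ f y).le_opNorm (e i)

lemma continuous_pd {F : Type*} [NormedAddCommGroup F] [NormedSpace ℝ F] {f : Plane → F}
    (hf : ContDiff ℝ 1 f) (i : Fin 2) : Continuous (pd i f) :=
  (hf.continuous_fderiv one_ne_zero).clm_apply continuous_const

lemma contDiff_pd {F : Type*} [NormedAddCommGroup F] [NormedSpace ℝ F] {f : Plane → F}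
    {n m : WithTop ℕ∞} (hf : ContDiff ℝ n f) (hm : m + 1 ≤ n) (i : Fin 2) :
    ContDiff ℝ m (pd i f) :=
  (hf.fderiv_right hm).clm_apply contDiff_const

lemma hasCompactSupport_pd {F : Type*} [NormedAddCommGroup F] [NormedSpace ℝ F] {f : Plane → F}
    (hf : HasCompactSupport f) (i : Fin 2) : HasCompactSupport (pd i f) :=
  hf.fderiv_apply (𝕜 := ℝ) (e i)

lemma pd_apply {f : Plane → Plane} (y : Plane) (hf : DifferentiableAt ℝ f y) (i j : Fin 2) :
    pd i (fun z => f z j) y = pd i f y j := by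
  have := ((EuclideanSpace.proj j : Plane →L[ℝ] ℝ).hasFDerivAt.comp y
    hf.hasFDerivAt).fderiv
  unfold pd
  change fderiv ℝ (⇑(EuclideanSpace.proj j : Plane →L[ℝ] ℝ) ∘ f) y (e i) = _
  rw [this]
  rfl

lemma integral_pd_eq_zero {g : Plane → ℝ} (hg : ContDiff ℝ 1 g) (hc : HasCompactSupport g)
    (i : Fin 2) : ∫ y, pd i g y = 0 := by
  have h1 : Integrable (pd i g) :=
    (continuous_pd hg i).integrable_of_hasCompactSupport (hasCompactSupport_pd hc i)
  have h2 : Integrable g := hg.continuous.integrable_of_hasCompactSupport hc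
  have h := integral_mul_fderiv_eq_neg_fderiv_mul_of_integrable (μ := (volume : Measure Plane))
    (f := fun _ : Plane => (1 : ℝ)) (g := g) (v := e i) (by simp)
    (by simp only [one_mul]; exact h1) (by simpa only [one_mul] using h2)
    (fun _ _ => by fun_prop) (fun x _ => hg.differentiable one_ne_zero x)
  simpa [pd] using h

/-- The divergence theorem for the compactly supported field `g a`. -/
lemma integral_fderiv_add_mul_divergence {g : Plane → ℝ} {a : Plane → Plane}
    (hg : ContDiff ℝ 1 g) (hc : HasCompactSupport g) (ha : ContDiff ℝ 1 a) :
    ∫ y, (fderiv ℝ g y (a y) + g y * divergence a y) = 0 := by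
  have hai : ∀ i : Fin 2, ContDiff ℝ 1 (fun y => a y i) := fun i => by fun_prop
  have hga : ∀ i : Fin 2, ContDiff ℝ 1 (fun y => g y * a y i) := fun i => hg.mul (hai i)
  have hcs : ∀ i : Fin 2, HasCompactSupport (fun y => g y * a y i) := fun i => hc.mul_right
  have key : ∀ y, fderiv ℝ g y (a y) + g y * divergence a y
      = ∑ i, pd i (fun y => g y * a y i) y := by
    intro y
    have hgd := hg.differentiable one_ne_zero y
    have had := ha.differentiable one_ne_zero y
    have : ∀ i, pd i (fun y => g y * a y i) y = a y i * pd i g y + g y * pd i a y i := by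
      intro i
      rw [← pd_apply y had]
      unfold pd
      rw [fderiv_fun_mul hgd ((hai i).differentiable one_ne_zero y)]
      simp; ring
    simp_rw [this]
    rw [fderiv_apply_eq_sum, Finset.sum_add_distrib, divergence, Finset.mul_sum]
    rfl
  simp_rw [key]
  rw [integral_finsetSum _ fun i _ => (continuous_pd (hga i) i).integrable_of_hasCompactSupport
      (hasCompactSupport_pd (hcs i) i)]
  exact Finset.sum_eq_zero fun i _ => integral_pd_eq_zero (hga i) (hcs i) i

/-- Integration by parts along a divergence-free field. -/
lemma integral_fderiv_eq_zero {g : Plane → ℝ} {a : Plane → Plane}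
    (hg : ContDiff ℝ 1 g) (hc : HasCompactSupport g) (ha : ContDiff ℝ 1 a)
    (hd : ∀ y, divergence a y = 0) : ∫ y, fderiv ℝ g y (a y) = 0 := by
  simpa [hd] using integral_fderiv_add_mul_divergence hg hc ha

lemma divergence_id (y : Plane) : divergence (fun y => y) y = 2 := by
  simp [divergence, e]

/-! ### Cutoffs -/

/-- A smooth cutoff equal to `1` on the unit ball and supported in the ball of radius `2`. -/
def bump : ContDiffBump (0 : Plane) := ⟨1, 2, one_pos, one_lt_two⟩

/-- The dilated cutoffs `y ↦ bump (y / (n + 1))`. -/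
def chi (n : ℕ) (y : Plane) : ℝ := bump ((n + 1 : ℝ)⁻¹ • y)

lemma contDiff_chi (n : ℕ) {m : ℕ∞} : ContDiff ℝ m (chi n) :=
  bump.contDiff.comp (contDiff_const_smul _)

lemma chi_nonneg (n : ℕ) (y : Plane) : 0 ≤ chi n y := bump.nonneg

lemma chi_le_one (n : ℕ) (y : Plane) : chi n y ≤ 1 := bump.le_one

lemma hasCompactSupport_chi (n : ℕ) : HasCompactSupport (chi n) := by
  have h : ((n : ℝ) + 1)⁻¹ ≠ 0 := by positivity
  exact bump.hasCompactSupport.comp_homeomorph (Homeomorph.smulOfNeZero _ h)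

lemma chi_eventually_eq_one (y : Plane) : ∀ᶠ n in atTop, chi n =ᶠ[𝓝 y] fun _ => 1 := by
  obtain ⟨N, hN⟩ := exists_nat_gt ‖y‖
  filter_upwards [eventually_ge_atTop N] with n hn
  have hn' : (N : ℝ) ≤ n := by exact_mod_cast hn
  have : Metric.ball (0 : Plane) (n + 1) ∈ 𝓝 y :=
    Metric.isOpen_ball.mem_nhds (by simp; linarith)
  filter_upwards [this] with z hz
  apply bump.one_of_mem_closedBall
  rw [mem_closedBall_zero_iff] 
  rw [mem_ball_zero_iff] at hz
  have h0 : (0 : ℝ) < n + 1 := by positivity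
  rw [norm_smul, norm_inv, Real.norm_of_nonneg h0.le, inv_mul_le_iff₀ h0]
  change ‖z‖ ≤ (n + 1) * 1
  linarith

lemma tendsto_chi (y : Plane) : Tendsto (fun n => chi n y) atTop (𝓝 1) :=
  tendsto_const_nhds.congr' ((chi_eventually_eq_one y).mono fun _ h => h.self_of_nhds.symm)

lemma fderiv_chi_eventually (y : Plane) : ∀ᶠ n in atTop, fderiv ℝ (chi n) y = 0 :=
  (chi_eventually_eq_one y).mono fun _ h => by rw [h.fderiv_eq]; simp

/-- The scale-invariant bound `|∇χ| = O(1 / (1 + |y|))`, uniformly over the cutoffs. -/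
lemma exists_fderiv_chi_le : ∃ C : ℝ, 0 ≤ C ∧ ∀ n y, (1 + ‖y‖) * ‖fderiv ℝ (chi n) y‖ ≤ C := by
  have hb : ContDiff ℝ 1 (bump : Plane → ℝ) := bump.contDiff
  obtain ⟨C, hC⟩ := (hb.continuous_fderiv one_ne_zero).bounded_above_of_compact_support
    (bump.hasCompactSupport.fderiv (𝕜 := ℝ))
  refine ⟨3 * C, by linarith [(norm_nonneg _).trans (hC 0)], fun n y => ?_⟩
  set l : ℝ := ((n : ℝ) + 1)⁻¹ with hl
  have h0 : (0 : ℝ) < n + 1 := by positivity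
  have hl0 : 0 < l := by positivity
  have hl1 : l ≤ 1 := inv_le_one_of_one_le₀ (by linarith [n.cast_nonneg (α := ℝ)])
  have hd : fderiv ℝ (chi n) y = l • fderiv ℝ (bump : Plane → ℝ) (l • y) := by
    have := fderiv_comp_smul (𝕜 := ℝ) (f := (bump : Plane → ℝ)) l (x := y)
    simpa [chi] using! this
  rw [hd, norm_smul, Real.norm_of_nonneg hl0.le]
  by_cases h : l • y ∈ Metric.closedBall (0 : Plane) 2
  · rw [mem_closedBall_zero_iff, norm_smul, Real.norm_of_nonneg hl0.le] at h
    have := hC (l • y)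
    calc (1 + ‖y‖) * (l * ‖fderiv ℝ (bump : Plane → ℝ) (l • y)‖)
        = (l + l * ‖y‖) * ‖fderiv ℝ (bump : Plane → ℝ) (l • y)‖ := by ring
      _ ≤ 3 * C := by gcongr; linarith
  · have : fderiv ℝ (bump : Plane → ℝ) (l • y) = 0 := by
      by_contra hne
      have := support_fderiv_subset ℝ (f := (bump : Plane → ℝ)) hne
      rw [bump.tsupport_eq] at this
      exact h this
    rw [this]
    simp only [norm_zero, mul_zero]
    linarith [(norm_nonneg _).trans (hC 0)]

lemma norm_chi_le (n : ℕ) (y : Plane) : ‖chi n y‖ ≤ 1 := by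
  rw [Real.norm_of_nonneg (chi_nonneg n y)]; exact chi_le_one n y

lemma tendsto_integral_chi_mul {h : Plane → ℝ} (hh : Integrable h) :
    Tendsto (fun n => ∫ y, chi n y * h y) atTop (𝓝 (∫ y, h y)) := by
  apply tendsto_integral_of_dominated_convergence (fun y => ‖h y‖)
  · intro n
    exact (contDiff_chi n (m := 0)).continuous.aestronglyMeasurable.mul hh.1
  · exact hh.norm
  · intro n
    filter_upwards with y
    rw [norm_mul]
    exact mul_le_of_le_one_left (norm_nonneg _) (norm_chi_le n y)
  · filter_upwards with y
    simpa using (tendsto_chi y).mul_const (h y)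

lemma aestronglyMeasurable_fderiv_chi (n : ℕ) {F : Plane → Plane}
    (hF : AEStronglyMeasurable F) : AEStronglyMeasurable (fun y => fderiv ℝ (chi n) y (F y)) :=
  isBoundedBilinearMap_apply.continuous.comp_aestronglyMeasurable₂
    ((contDiff_chi n (m := 1)).continuous_fderiv one_ne_zero).aestronglyMeasurable hF

lemma integrable_fderiv_chi (n : ℕ) {F : Plane → Plane} {h : Plane → ℝ} (hh : Integrable h)
    (hF : AEStronglyMeasurable F) (hFh : ∀ y, ‖F y‖ ≤ (1 + ‖y‖) * h y) :
    Integrable (fun y => fderiv ℝ (chi n) y (F y)) := by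
  obtain ⟨C, -, hC⟩ := exists_fderiv_chi_le
  refine (hh.const_mul C).mono' (aestronglyMeasurable_fderiv_chi n hF) ?_
  filter_upwards with y
  have h0 : 0 ≤ h y := by
    have := (norm_nonneg _).trans (hFh y)
    exact nonneg_of_mul_nonneg_right this (by positivity)
  calc ‖fderiv ℝ (chi n) y (F y)‖ ≤ ‖fderiv ℝ (chi n) y‖ * ‖F y‖ := ContinuousLinearMap.le_opNorm _ _
    _ ≤ ‖fderiv ℝ (chi n) y‖ * ((1 + ‖y‖) * h y) := by gcongr; exact hFh y
    _ = ((1 + ‖y‖) * ‖fderiv ℝ (chi n) y‖) * h y := by ring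
    _ ≤ C * h y := by gcongr; exact hC n y

lemma tendsto_integral_fderiv_chi {F : Plane → Plane} {h : Plane → ℝ} (hh : Integrable h)
    (hF : AEStronglyMeasurable F) (hFh : ∀ y, ‖F y‖ ≤ (1 + ‖y‖) * h y) :
    Tendsto (fun n => ∫ y, fderiv ℝ (chi n) y (F y)) atTop (𝓝 0) := by
  obtain ⟨C, -, hC⟩ := exists_fderiv_chi_le
  rw [← integral_zero Plane ℝ]
  apply tendsto_integral_of_dominated_convergence (fun y => C * h y)
  · exact fun n => aestronglyMeasurable_fderiv_chi n hF
  · exact hh.const_mul C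
  · intro n
    filter_upwards with y
    have h0 : 0 ≤ h y := by
      have := (norm_nonneg _).trans (hFh y)
      exact nonneg_of_mul_nonneg_right this (by positivity)
    calc ‖fderiv ℝ (chi n) y (F y)‖ ≤ ‖fderiv ℝ (chi n) y‖ * ‖F y‖ :=
          ContinuousLinearMap.le_opNorm _ _
      _ ≤ ‖fderiv ℝ (chi n) y‖ * ((1 + ‖y‖) * h y) := by gcongr; exact hFh y
      _ = ((1 + ‖y‖) * ‖fderiv ℝ (chi n) y‖) * h y := by ring
      _ ≤ C * h y := by gcongr; exact hC n y
  · filter_upwards with y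
    apply tendsto_const_nhds.congr'
    filter_upwards [fderiv_chi_eventually y] with n hn
    simp [hn]

/-- Removal of the cutoff: an identity that holds with all cutoffs `chi n` persists in the limit,
and the terms in which the cutoff is differentiated disappear. -/
lemma integral_eq_zero_of_cutoff {A : Plane → ℝ} {F : Plane → Plane} {h : Plane → ℝ}
    (hA : Integrable A) (hh : Integrable h)
    (hF : AEStronglyMeasurable F) (hFh : ∀ y, ‖F y‖ ≤ (1 + ‖y‖) * h y)
    (H : ∀ n, ∫ y, (chi n y * A y + fderiv ℝ (chi n) y (F y)) = 0) : ∫ y, A y = 0 := by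
  have h1 := (tendsto_integral_chi_mul hA).add (tendsto_integral_fderiv_chi hh hF hFh)
  have h2 : ∀ n, (∫ y, chi n y * A y) + ∫ y, fderiv ℝ (chi n) y (F y) = 0 := by
    intro n
    rw [← integral_add _ (integrable_fderiv_chi n hh hF hFh), H n]
    refine hA.norm.mono' ((contDiff_chi n (m := 0)).continuous.aestronglyMeasurable.mul hA.1) ?_
    filter_upwards with y
    rw [norm_mul]
    exact mul_le_of_le_one_left (norm_nonneg _) (norm_chi_le n y)
  simp_rw [h2, add_zero] at h1
  exact tendsto_nhds_unique h1 tendsto_const_nhds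

/-! ### Integral inequalities -/

lemma integral_mul_sq_le {α : Type*} [MeasurableSpace α] {μ : Measure α} {f g : α → ℝ}
    (hf : MemLp f 2 μ) (hg : MemLp g 2 μ) :
    (∫ x, f x * g x ∂μ) ^ 2 ≤ (∫ x, f x ^ 2 ∂μ) * ∫ x, g x ^ 2 ∂μ := by
  have hfi := hf.integrable_sq
  have hgi := hg.integrable_sq
  have hfg : Integrable (fun x => f x * g x) μ := hf.integrable_mul hg
  have key : ∀ t : ℝ, 0 ≤ (∫ x, g x ^ 2 ∂μ) * (t * t) + (2 * ∫ x, f x * g x ∂μ) * t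
      + ∫ x, f x ^ 2 ∂μ := by
    intro t
    have : 0 ≤ ∫ x, (f x + t * g x) ^ 2 ∂μ := integral_nonneg fun x => sq_nonneg _
    have h2 : ∫ x, (f x + t * g x) ^ 2 ∂μ = ∫ x, (f x ^ 2 + 2 * t * (f x * g x)
        + t * t * g x ^ 2) ∂μ := by congr 1; ext x; ring
    rw [h2, integral_add (by fun_prop) (by fun_prop), integral_add hfi (by fun_prop),
      integral_const_mul, integral_const_mul] at this
    linarith
  have := discrim_le_zero key
  rw [discrim] at this
  nlinarith

lemma integral_mul_le_sqrt {α : Type*} [MeasurableSpace α] {μ : Measure α} {f g : α → ℝ}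
    (hf : MemLp f 2 μ) (hg : MemLp g 2 μ) :
    ∫ x, f x * g x ∂μ ≤ √(∫ x, f x ^ 2 ∂μ) * √(∫ x, g x ^ 2 ∂μ) := by
  rw [← Real.sqrt_mul (integral_nonneg fun x => sq_nonneg _)]
  exact Real.le_sqrt_of_sq_le (integral_mul_sq_le hf hg)

lemma integrable_one_add_norm_rpow {p : ℝ} (hp : 2 < p) :
    Integrable (fun y : Plane => (1 + ‖y‖) ^ (-p)) :=
  integrable_one_add_norm (by simpa using hp)

/-! ### Convolution of decaying kernels with fields of size `1 / |z|` -/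

lemma integrable_inv_one_add_norm_pow {m : ℕ} (hm : 2 < m) :
    Integrable (fun y : Plane => ((1 + ‖y‖) ^ m)⁻¹) := by
  have := integrable_one_add_norm_rpow (p := m) (by exact_mod_cast hm)
  refine this.congr (ae_of_all _ fun y => ?_)
  simp only
  rw [Real.rpow_neg (by positivity), Real.rpow_natCast]

lemma integrable_indicator_inv_norm :
    Integrable ((Metric.ball (0 : Plane) 1).indicator fun z => ‖z‖⁻¹) := by
  have h := (integrable_fun_norm_addHaar (E := Plane) (volume : Measure Plane)
    (f := (Set.Iio (1 : ℝ)).indicator fun r => r⁻¹)).2 ?_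
  · refine h.congr (ae_of_all _ fun z => ?_)
    by_cases hz : ‖z‖ < 1 <;> simp [Set.indicator, hz]
  · have : IntegrableOn ((Set.Iio (1 : ℝ)).indicator fun _ => (1 : ℝ)) (Set.Ioi 0) := by
      rw [IntegrableOn, integrable_indicator_iff measurableSet_Iio, IntegrableOn,
        Measure.restrict_restrict measurableSet_Iio]
      rw [integrable_const_iff]
      right
      rw [isFiniteMeasure_restrict, Set.Iio_inter_Ioi]
      simp
    refine this.congr_fun (fun r hr => ?_) measurableSet_Ioi
    have hr : 0 < r := hr
    by_cases h1 : r < 1 <;> simp [Set.indicator, h1, hr.ne']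

/-- For `|z| < 1` the factor `|z|⁻¹` is kept, and otherwise it is absorbed; `1 + |y|` is split by the
triangle inequality, at the cost of one power of the decay of the kernel. -/
lemma potential_le (y z : Plane) :
    (1 + ‖y‖) * (((1 + ‖y - z‖) ^ 4)⁻¹ * ‖z‖⁻¹) ≤
      (Metric.ball (0 : Plane) 1).indicator (fun z => ‖z‖⁻¹) z + 2 * ((1 + ‖y - z‖) ^ 3)⁻¹ := by
  set a := 1 + ‖y - z‖ with ha
  have ha1 : 1 ≤ a := by simp [ha]
  have h34 : (a ^ 4)⁻¹ ≤ (a ^ 3)⁻¹ := by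
    gcongr
    norm_num
  have h3 : (a ^ 3)⁻¹ ≤ 1 := inv_le_one_of_one_le₀ (one_le_pow₀ ha1)
  have hind : (a ^ 3)⁻¹ * ‖z‖⁻¹ ≤
      (Metric.ball (0 : Plane) 1).indicator (fun z => ‖z‖⁻¹) z + (a ^ 3)⁻¹ := by
    have h30 : 0 ≤ (a ^ 3)⁻¹ := by positivity
    by_cases hz : ‖z‖ < 1
    · simp only [Set.indicator, mem_ball_zero_iff, hz, if_true]
      nlinarith [inv_nonneg.2 (norm_nonneg z)]
    · simp only [Set.indicator, mem_ball_zero_iff, hz, if_false]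
      have : ‖z‖⁻¹ ≤ 1 := inv_le_one_of_one_le₀ (not_lt.1 hz)
      nlinarith
  rcases eq_or_ne z 0 with rfl | hz
  · simp only [norm_zero, inv_zero, mul_zero]
    simp only [Set.indicator, norm_zero, inv_zero, ite_self, zero_add]
    positivity
  have hz' : 0 < ‖z‖ := norm_pos_iff.2 hz
  have hy : 1 + ‖y‖ ≤ a + ‖z‖ := by
    have := norm_add_le (y - z) z
    rw [sub_add_cancel] at this
    rw [ha]; linarith
  calc (1 + ‖y‖) * ((a ^ 4)⁻¹ * ‖z‖⁻¹) ≤ (a + ‖z‖) * ((a ^ 4)⁻¹ * ‖z‖⁻¹) := by gcongr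
    _ = (a ^ 3)⁻¹ * ‖z‖⁻¹ + (a ^ 4)⁻¹ := by field_simp
    _ ≤ _ := by linarith

lemma integrable_potential_majorant (y : Plane) :
    Integrable fun z : Plane => (Metric.ball (0 : Plane) 1).indicator (fun z => ‖z‖⁻¹) z
      + 2 * ((1 + ‖y - z‖) ^ 3)⁻¹ :=
  integrable_indicator_inv_norm.add
    (((integrable_inv_one_add_norm_pow (m := 3) (by norm_num)).comp_sub_left y).const_mul 2)

lemma integrable_potential (y : Plane) :
    Integrable fun z : Plane => ((1 + ‖y - z‖) ^ 4)⁻¹ * ‖z‖⁻¹ := by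
  refine (integrable_potential_majorant y).mono' (by fun_prop) (ae_of_all _ fun z => ?_)
  refine le_trans ?_ (potential_le y z)
  rw [Real.norm_of_nonneg (by positivity)]
  exact le_mul_of_one_le_left (by positivity) (by linarith [norm_nonneg y])

/-- The constant in the decay estimate `integral_potential_le`. -/
def potentialConst : ℝ := ∫ z : Plane, ((Metric.ball (0 : Plane) 1).indicator (fun z => ‖z‖⁻¹) z
      + 2 * ((1 + ‖z‖) ^ 3)⁻¹)

lemma potentialConst_nonneg : 0 ≤ potentialConst := by
  apply integral_nonneg
  intro z
  exact add_nonneg (Set.indicator_nonneg (fun _ _ => by positivity) _) (by positivity)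

/-- Convolution with a kernel of decay `|x|⁻⁴` preserves the decay `|z|⁻¹`. -/
lemma integral_potential_le (y : Plane) :
    (1 + ‖y‖) * ∫ z : Plane, ((1 + ‖y - z‖) ^ 4)⁻¹ * ‖z‖⁻¹ ≤ potentialConst := by
  rw [← integral_const_mul]
  refine (integral_mono ((integrable_potential y).const_mul _) (integrable_potential_majorant y)
    (potential_le y)).trans (le_of_eq ?_)
  have h3 := (integrable_inv_one_add_norm_pow (m := 3) (by norm_num)).const_mul 2
  rw [potentialConst, integral_add integrable_indicator_inv_norm h3,
    integral_add integrable_indicator_inv_norm (h3.comp_sub_left y)]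
  congr 1
  exact integral_sub_left_eq_self (fun z : Plane => 2 * ((1 + ‖z‖) ^ 3)⁻¹) volume y

/-- The convolution `∫ k(y - z) u(z) dz` of a scalar kernel with a vector field. -/
def conv (k : Plane → ℝ) (u : Plane → Plane) (y : Plane) : Plane := ∫ z, k (y - z) • u z

lemma ae_ne_zero : ∀ᵐ z : Plane, z ≠ 0 := by
  simp [ae_iff]

section
variable {k : Plane → ℝ} {u : Plane → Plane} {A B : ℝ}

lemma norm_kernel_smul_le (hk : ∀ x, |k x| ≤ B * ((1 + ‖x‖) ^ 4)⁻¹)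
    (hu : ∀ z, z ≠ 0 → ‖u z‖ ≤ A * ‖z‖⁻¹) (y : Plane) :
    ∀ᵐ z, ‖k (y - z) • u z‖ ≤ A * B * (((1 + ‖y - z‖) ^ 4)⁻¹ * ‖z‖⁻¹) := by
  filter_upwards [ae_ne_zero] with z hz
  rw [norm_smul]
  have h1 := hk (y - z)
  have h2 := hu z hz
  calc ‖k (y - z)‖ * ‖u z‖ ≤ (B * ((1 + ‖y - z‖) ^ 4)⁻¹) * (A * ‖z‖⁻¹) :=
        mul_le_mul h1 h2 (norm_nonneg _) ((abs_nonneg _).trans h1)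
    _ = _ := by ring

lemma integrable_kernel_smul (hkc : Continuous k) (hk : ∀ x, |k x| ≤ B * ((1 + ‖x‖) ^ 4)⁻¹)
    (hum : AEStronglyMeasurable u) (hu : ∀ z, z ≠ 0 → ‖u z‖ ≤ A * ‖z‖⁻¹) (y : Plane) :
    Integrable fun z => k (y - z) • u z :=
  ((integrable_potential y).const_mul (A * B)).mono'
    ((hkc.comp (by fun_prop : Continuous fun z : Plane => y - z)).aestronglyMeasurable.smul hum)
    (norm_kernel_smul_le hk hu y)

lemma norm_conv_le (hA : 0 ≤ A) (hB : 0 ≤ B) (hk : ∀ x, |k x| ≤ B * ((1 + ‖x‖) ^ 4)⁻¹)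
    (hu : ∀ z, z ≠ 0 → ‖u z‖ ≤ A * ‖z‖⁻¹) (y : Plane) :
    (1 + ‖y‖) * ‖conv k u y‖ ≤ A * B * potentialConst := by
  have h := norm_integral_le_of_norm_le ((integrable_potential y).const_mul (A * B))
    (norm_kernel_smul_le hk hu y)
  rw [integral_const_mul] at h
  calc (1 + ‖y‖) * ‖conv k u y‖
      ≤ (1 + ‖y‖) * (A * B * ∫ z : Plane, ((1 + ‖y - z‖) ^ 4)⁻¹ * ‖z‖⁻¹) := by
        gcongr; exact h
    _ = A * B * ((1 + ‖y‖) * ∫ z : Plane, ((1 + ‖y - z‖) ^ 4)⁻¹ * ‖z‖⁻¹) := by ring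
    _ ≤ _ := by gcongr; exact integral_potential_le y

/-- Translates of the decay weight are comparable, locally uniformly in the translation. -/
lemma inv_one_add_norm_sub_le {y y₀ : Plane} (hy : y ∈ Metric.ball y₀ 1) (z : Plane) :
    ((1 + ‖y - z‖) ^ 4)⁻¹ ≤ 16 * ((1 + ‖y₀ - z‖) ^ 4)⁻¹ := by
  have h1 : ‖y₀ - z‖ ≤ ‖y - z‖ + 1 := by
    have := norm_add_le (y₀ - y) (y - z)
    rw [sub_add_sub_cancel] at this
    have h2 : ‖y₀ - y‖ < 1 := by rw [← dist_eq_norm, dist_comm]; exact hy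
    linarith
  have h3 : (1 + ‖y₀ - z‖) ^ 4 ≤ 16 * (1 + ‖y - z‖) ^ 4 := by
    calc (1 + ‖y₀ - z‖) ^ 4 ≤ (2 * (1 + ‖y - z‖)) ^ 4 := by
          gcongr; linarith [norm_nonneg (y - z)]
      _ = _ := by ring
  rw [inv_le_comm₀ (by positivity) (by positivity), mul_inv, inv_inv]
  linarith

/-- The derivative may be put on the kernel; the data are merely measurable and singular at the
origin. -/
lemma contDiff_conv_and_fderiv (hkc : ContDiff ℝ 1 k)
    (hk : ∀ x, |k x| ≤ B * ((1 + ‖x‖) ^ 4)⁻¹)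
    (hk' : ∀ x, ‖fderiv ℝ k x‖ ≤ B * ((1 + ‖x‖) ^ 4)⁻¹)
    (hum : AEStronglyMeasurable u) (hu : ∀ z, z ≠ 0 → ‖u z‖ ≤ A * ‖z‖⁻¹) :
    ContDiff ℝ 1 (conv k u) ∧
      ∀ y, HasFDerivAt (conv k u) (∫ z, (fderiv ℝ k (y - z)).smulRight (u z)) y := by
  have hkd := hkc.continuous_fderiv one_ne_zero
  have hmeas : ∀ y, AEStronglyMeasurable fun z => (fderiv ℝ k (y - z)).smulRight (u z) := by
    intro y
    have : Continuous fun p : (Plane →L[ℝ] ℝ) × Plane => p.1.smulRight p.2 :=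
      ((ContinuousLinearMap.smulRightL ℝ Plane Plane).isBoundedBilinearMap).continuous
    exact this.comp_aestronglyMeasurable₂
      (hkd.comp (by fun_prop : Continuous fun z : Plane => y - z)).aestronglyMeasurable hum
  have hbound : ∀ y₀ : Plane, ∀ᵐ z, ∀ y ∈ Metric.ball y₀ 1,
      ‖(fderiv ℝ k (y - z)).smulRight (u z)‖ ≤
        16 * (A * B) * (((1 + ‖y₀ - z‖) ^ 4)⁻¹ * ‖z‖⁻¹) := by
    intro y₀
    filter_upwards [ae_ne_zero] with z hz y hy
    rw [ContinuousLinearMap.norm_smulRight_apply]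
    have hB : 0 ≤ B := by
      have := (norm_nonneg _).trans (hk' 0)
      simpa using this
    have h2 := hu z hz
    calc ‖fderiv ℝ k (y - z)‖ * ‖u z‖
        ≤ (B * (16 * ((1 + ‖y₀ - z‖) ^ 4)⁻¹)) * (A * ‖z‖⁻¹) := by
          refine mul_le_mul ((hk' _).trans ?_) h2 (norm_nonneg _) (by positivity)
          gcongr
          exact inv_one_add_norm_sub_le hy z
      _ = _ := by ring
  have hder : ∀ y, HasFDerivAt (conv k u) (∫ z, (fderiv ℝ k (y - z)).smulRight (u z)) y := by
    intro y₀
    refine hasFDerivAt_integral_of_dominated_of_fderiv_le (μ := volume)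
      (F := fun y z => k (y - z) • u z) (s := Metric.ball y₀ 1)
      (bound := fun z => 16 * (A * B) * (((1 + ‖y₀ - z‖) ^ 4)⁻¹ * ‖z‖⁻¹))
      (Metric.ball_mem_nhds _ one_pos) ?_ ?_ (hmeas y₀) (hbound y₀)
      ((integrable_potential y₀).const_mul _) ?_
    · exact .of_forall fun y => (integrable_kernel_smul hkc.continuous hk hum hu y).1
    · exact integrable_kernel_smul hkc.continuous hk hum hu y₀
    · refine ae_of_all _ fun z y _ => ?_
      have h1 : HasFDerivAt (fun y => k (y - z)) (fderiv ℝ k (y - z)) y :=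
        (hkc.differentiable one_ne_zero (y - z)).hasFDerivAt.comp y
          ((hasFDerivAt_id y).sub_const z)
      exact h1.smul_const (u z)
  refine ⟨contDiff_one_iff_fderiv.2 ⟨fun y => (hder y).differentiableAt, ?_⟩, hder⟩
  have : fderiv ℝ (conv k u) = fun y => ∫ z, (fderiv ℝ k (y - z)).smulRight (u z) :=
    funext fun y => (hder y).fderiv
  rw [this, continuous_iff_continuousAt]
  intro y₀
  refine continuousAt_of_dominated
    (bound := fun z => 16 * (A * B) * (((1 + ‖y₀ - z‖) ^ 4)⁻¹ * ‖z‖⁻¹))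
    (.of_forall hmeas) ?_ ((integrable_potential y₀).const_mul _) ?_
  · filter_upwards [Metric.ball_mem_nhds y₀ one_pos] with y hy
    filter_upwards [hbound y₀] with z hz using hz y hy
  · refine ae_of_all _ fun z => Continuous.continuousAt ?_
    have : Continuous fun T : (Plane →L[ℝ] ℝ) => T.smulRight (u z) :=
      ((ContinuousLinearMap.smulRightL ℝ Plane Plane).flip (u z)).continuous
    exact this.comp (hkd.comp (by fun_prop))

lemma contDiff_conv (hkc : ContDiff ℝ 1 k) (hk : ∀ x, |k x| ≤ B * ((1 + ‖x‖) ^ 4)⁻¹)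
    (hk' : ∀ x, ‖fderiv ℝ k x‖ ≤ B * ((1 + ‖x‖) ^ 4)⁻¹)
    (hum : AEStronglyMeasurable u) (hu : ∀ z, z ≠ 0 → ‖u z‖ ≤ A * ‖z‖⁻¹) :
    ContDiff ℝ 1 (conv k u) :=
  (contDiff_conv_and_fderiv hkc hk hk' hum hu).1

lemma fderiv_conv_apply (hkc : ContDiff ℝ 1 k) (hk : ∀ x, |k x| ≤ B * ((1 + ‖x‖) ^ 4)⁻¹)
    (hk' : ∀ x, ‖fderiv ℝ k x‖ ≤ B * ((1 + ‖x‖) ^ 4)⁻¹)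
    (hum : AEStronglyMeasurable u) (hu : ∀ z, z ≠ 0 → ‖u z‖ ≤ A * ‖z‖⁻¹) (y h : Plane) :
    fderiv ℝ (conv k u) y h = ∫ z, fderiv ℝ k (y - z) h • u z := by
  rw [((contDiff_conv_and_fderiv hkc hk hk' hum hu).2 y).fderiv,
    ContinuousLinearMap.integral_apply]
  · rfl
  · have hkd := hkc.continuous_fderiv one_ne_zero
    refine ((integrable_potential y).const_mul (A * B)).mono' ?_ ?_
    · have : Continuous fun p : (Plane →L[ℝ] ℝ) × Plane => p.1.smulRight p.2 :=
        ((ContinuousLinearMap.smulRightL ℝ Plane Plane).isBoundedBilinearMap).continuous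
      exact this.comp_aestronglyMeasurable₂
        (hkd.comp (by fun_prop : Continuous fun z : Plane => y - z)).aestronglyMeasurable hum
    · filter_upwards [ae_ne_zero] with z hz
      rw [ContinuousLinearMap.norm_smulRight_apply]
      calc ‖fderiv ℝ k (y - z)‖ * ‖u z‖ ≤ (B * ((1 + ‖y - z‖) ^ 4)⁻¹) * (A * ‖z‖⁻¹) :=
            mul_le_mul (hk' _) (hu z hz) (norm_nonneg _) ((norm_nonneg _).trans (hk' _))
        _ = _ := by ring

lemma pd_conv (hkc : ContDiff ℝ 1 k) (hk : ∀ x, |k x| ≤ B * ((1 + ‖x‖) ^ 4)⁻¹)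
    (hk' : ∀ x, ‖fderiv ℝ k x‖ ≤ B * ((1 + ‖x‖) ^ 4)⁻¹)
    (hum : AEStronglyMeasurable u) (hu : ∀ z, z ≠ 0 → ‖u z‖ ≤ A * ‖z‖⁻¹) (i : Fin 2) :
    pd i (conv k u) = conv (pd i k) u :=
  funext fun y => fderiv_conv_apply hkc hk hk' hum hu y (e i)

end

/-! ### The Gaussian kernel -/

/-- The heat kernel at time one. -/
def gauss (x : Plane) : ℝ := 1 / (4 * Real.pi) * Real.exp (-‖x‖ ^ 2 / 4)

/-- The partial derivative `∂ᵢ` of the heat kernel at time one. -/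
def dgauss (i : Fin 2) (x : Plane) : ℝ := -(x i) / 2 * gauss x

lemma heatEvolution_one (u : Plane → Plane) : heatEvolution 1 u = conv gauss u := by
  funext y
  simp [heatEvolution, conv, gauss]

lemma gauss_nonneg (x : Plane) : 0 ≤ gauss x := by unfold gauss; positivity

/-- The Gaussian is below `(1 + |x|)⁻⁸`; the constant is crude. -/
lemma gauss_le (x : Plane) : gauss x ≤ 2 ^ 20 * ((1 + ‖x‖) ^ 8)⁻¹ := by
  set r := ‖x‖ with hr
  have hr0 : 0 ≤ r := norm_nonneg x
  have h1 : (1 + r) ^ 8 ≤ 2 ^ 20 * Real.exp (r ^ 2 / 4) := by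
    have h2 : (1 + r) ^ 2 ≤ 2 * (1 + r ^ 2) := by nlinarith [sq_nonneg (1 - r)]
    have h3 : (1 + r ^ 2 / 16) ^ 4 ≤ Real.exp (r ^ 2 / 4) := by
      have := Real.add_one_le_exp (r ^ 2 / 16)
      calc (1 + r ^ 2 / 16) ^ 4 ≤ (Real.exp (r ^ 2 / 16)) ^ 4 := by gcongr; linarith
        _ = Real.exp (r ^ 2 / 4) := by rw [← Real.exp_nat_mul]; congr 1; push_cast; ring
    calc (1 + r) ^ 8 = ((1 + r) ^ 2) ^ 4 := by ring
      _ ≤ (2 * (16 * (1 + r ^ 2 / 16))) ^ 4 := by gcongr; nlinarith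
      _ = 2 ^ 20 * (1 + r ^ 2 / 16) ^ 4 := by ring
      _ ≤ _ := by gcongr
  have hpi : 1 / (4 * Real.pi) ≤ 1 := by
    rw [div_le_one (by positivity)]; nlinarith [Real.pi_gt_three]
  unfold gauss
  rw [← hr, ← div_eq_mul_inv, le_div_iff₀ (by positivity), neg_div, Real.exp_neg]
  calc 1 / (4 * Real.pi) * (Real.exp (r ^ 2 / 4))⁻¹ * (1 + r) ^ 8
      ≤ 1 * (Real.exp (r ^ 2 / 4))⁻¹ * (2 ^ 20 * Real.exp (r ^ 2 / 4)) := by gcongr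
    _ = 2 ^ 20 := by field_simp

/-- A polynomial of degree at most three times the Gaussian decays like `|x|⁻⁵`. -/
lemma mul_gauss_le (x : Plane) {t c : ℝ} (ht : t ≤ c * (1 + ‖x‖) ^ 3) (hc : 0 ≤ c) :
    t * gauss x ≤ c * 2 ^ 20 * ((1 + ‖x‖) ^ 5)⁻¹ := by
  have h1 : 0 < 1 + ‖x‖ := by positivity
  calc t * gauss x ≤ (c * (1 + ‖x‖) ^ 3) * (2 ^ 20 * ((1 + ‖x‖) ^ 8)⁻¹) :=
        mul_le_mul ht (gauss_le x) (gauss_nonneg x) (by positivity)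
    _ = _ := by field_simp

lemma mul_gauss_le' (x : Plane) {t c : ℝ} (ht : t ≤ c * (1 + ‖x‖) ^ 3) (hc : 0 ≤ c) :
    t * gauss x ≤ c * 2 ^ 20 * ((1 + ‖x‖) ^ 4)⁻¹ := by
  refine (mul_gauss_le x ht hc).trans ?_
  gcongr
  · linarith [norm_nonneg x]
  · norm_num

lemma hasFDerivAt_gauss (x : Plane) :
    HasFDerivAt gauss (-(gauss x / 2) • (innerSL ℝ x : Plane →L[ℝ] ℝ)) x := by
  have h1 : HasFDerivAt (fun x : Plane => ‖x‖ ^ 2) (2 • (innerSL ℝ x : Plane →L[ℝ] ℝ)) x :=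
    (hasStrictFDerivAt_norm_sq x).hasFDerivAt
  have h2 := ((h1.const_mul (-1 / 4 : ℝ)).exp).const_mul (1 / (4 * Real.pi))
  convert! h2 using 1
  · funext z; simp only [gauss]; congr 2; ring
  · ext h
    simp only [gauss, _root_.smul_apply, smul_eq_mul, nsmul_eq_mul, Nat.cast_ofNat]
    rw [show -‖x‖ ^ 2 / 4 = -1 / 4 * ‖x‖ ^ 2 by ring]
    simp
    ring

lemma fderiv_gauss_apply (x h : Plane) : fderiv ℝ gauss x h = -(gauss x / 2) * inner ℝ x h := by
  rw [(hasFDerivAt_gauss x).fderiv]; simp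

lemma contDiff_gauss {n : ℕ∞} : ContDiff ℝ n gauss := by
  unfold gauss
  exact contDiff_const.mul (((contDiff_norm_sq ℝ).neg.div_const 4).exp)

lemma inner_e (x : Plane) (i : Fin 2) : inner ℝ x (e i) = x i := by
  simp [e, EuclideanSpace.inner_single_right]

lemma pd_gauss (i : Fin 2) : pd i gauss = dgauss i := by
  funext x
  rw [pd, fderiv_gauss_apply, inner_e, dgauss]; ring

lemma abs_apply_le (x : Plane) (i : Fin 2) : |x i| ≤ ‖x‖ := by
  simpa using PiLp.norm_apply_le x i

lemma norm_le_one_add_pow (x : Plane) {m : ℕ} (hm : m ≤ 3) : ‖x‖ ^ m ≤ (1 + ‖x‖) ^ 3 :=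
  (pow_le_pow_left₀ (norm_nonneg x) (by linarith) m).trans
    (pow_le_pow_right₀ (by linarith [norm_nonneg x]) hm)

lemma abs_gauss_le (x : Plane) : |gauss x| ≤ 2 ^ 20 * ((1 + ‖x‖) ^ 4)⁻¹ := by
  rw [abs_of_nonneg (gauss_nonneg x)]
  simpa using mul_gauss_le' x (t := 1) (c := 1)
    (by simpa using norm_le_one_add_pow x (m := 0) (by norm_num)) one_pos.le

lemma norm_fderiv_gauss_le (x : Plane) : ‖fderiv ℝ gauss x‖ ≤ 2 ^ 20 * ((1 + ‖x‖) ^ 4)⁻¹ := by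
  rw [(hasFDerivAt_gauss x).fderiv, norm_smul, innerSL_apply_norm, norm_neg,
    Real.norm_of_nonneg (by have := gauss_nonneg x; positivity)]
  have := mul_gauss_le' x (t := ‖x‖) (c := 1)
    (by simpa using norm_le_one_add_pow x (m := 1) (by norm_num)) one_pos.le
  have h2 := mul_nonneg (norm_nonneg x) (gauss_nonneg x)
  linarith

lemma abs_dgauss_le (i : Fin 2) (x : Plane) : |dgauss i x| ≤ 2 ^ 20 * ((1 + ‖x‖) ^ 5)⁻¹ := by
  rw [dgauss, abs_mul, abs_of_nonneg (gauss_nonneg x), abs_div, abs_neg]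
  have := mul_gauss_le x (t := |x i| / |2|) (c := 1) (by
    have h1 := norm_le_one_add_pow x (m := 1) (by norm_num)
    have h2 := abs_apply_le x i
    rw [abs_two]
    linarith [abs_nonneg (x i)]) one_pos.le
  simpa using this

lemma abs_dgauss_le' (i : Fin 2) (x : Plane) : |dgauss i x| ≤ 2 ^ 20 * ((1 + ‖x‖) ^ 4)⁻¹ := by
  refine (abs_dgauss_le i x).trans ?_
  gcongr
  · linarith [norm_nonneg x]
  · norm_num

lemma contDiff_dgauss (i : Fin 2) {n : ℕ∞} : ContDiff ℝ n (dgauss i) := by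
  unfold dgauss
  have : ContDiff ℝ n fun x : Plane => x i := by fun_prop
  exact (this.neg.div_const 2).mul contDiff_gauss

lemma fderiv_dgauss_apply (i : Fin 2) (x h : Plane) :
    fderiv ℝ (dgauss i) x h = (-(h i) / 2 + x i * inner ℝ x h / 4) * gauss x := by
  have h1 : HasFDerivAt (fun x : Plane => x i) (EuclideanSpace.proj i : Plane →L[ℝ] ℝ) x :=
    (EuclideanSpace.proj i : Plane →L[ℝ] ℝ).hasFDerivAt
  have h2 : HasFDerivAt (fun x : Plane => (-1 / 2) * (x i)) _ x := h1.const_mul (-1 / 2 : ℝ)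
  have h3 := h2.mul (hasFDerivAt_gauss x)
  have h4 : dgauss i = (fun x : Plane => (-1 / 2) * (x i)) * gauss := by
    funext z; simp only [dgauss, Pi.mul_apply]; ring
  rw [h4, h3.fderiv]
  simp
  ring

lemma norm_fderiv_dgauss_le (i : Fin 2) (x : Plane) :
    ‖fderiv ℝ (dgauss i) x‖ ≤ 2 ^ 20 * ((1 + ‖x‖) ^ 4)⁻¹ := by
  refine ContinuousLinearMap.opNorm_le_bound _ (by positivity) fun h => ?_
  have h0 := mul_gauss_le' x (t := 1 / 2 + ‖x‖ ^ 2 / 4) (c := 1) (by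
    have h1 := norm_le_one_add_pow x (m := 0) (by norm_num)
    have h2 := norm_le_one_add_pow x (m := 2) (by norm_num)
    rw [pow_zero] at h1
    linarith) one_pos.le
  rw [one_mul] at h0
  rw [fderiv_dgauss_apply, norm_mul, Real.norm_of_nonneg (gauss_nonneg x)]
  have h1 : ‖-(h i) / 2 + x i * inner ℝ x h / 4‖ ≤ (1 / 2 + ‖x‖ ^ 2 / 4) * ‖h‖ := by
    refine (norm_add_le _ _).trans ?_
    rw [norm_div, norm_div, norm_neg, norm_mul]
    have a1 := abs_apply_le h i
    have a2 := abs_apply_le x i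
    have a3 := abs_real_inner_le_norm x h
    simp only [Real.norm_eq_abs, abs_two, abs_of_pos (show (0 : ℝ) < 4 by norm_num)]
    have := mul_le_mul a2 a3 (abs_nonneg _) (norm_nonneg _)
    nlinarith
  calc _ ≤ (1 / 2 + ‖x‖ ^ 2 / 4) * ‖h‖ * gauss x := by gcongr; exact gauss_nonneg x
    _ = (1 / 2 + ‖x‖ ^ 2 / 4) * gauss x * ‖h‖ := by ring
    _ ≤ _ := by gcongr

/-- The profile equation `Δ Γ + x · ∇Γ / 2 + Γ = 0` of the heat kernel at time one. -/
lemma gauss_profile (x : Plane) :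
    2 * gauss x + fderiv ℝ gauss x x = -2 * ∑ i, pd i (dgauss i) x := by
  have hn : inner ℝ x x = x 0 * x 0 + x 1 * x 1 := by
    rw [real_inner_self_eq_norm_sq, EuclideanSpace.real_norm_sq_eq, Fin.sum_univ_two]; ring
  simp only [pd, fderiv_dgauss_apply, fderiv_gauss_apply, Fin.sum_univ_two, inner_e, hn]
  simp [e]
  ring

lemma integral_dgauss (i : Fin 2) : ∫ x, dgauss i x = 0 := by
  have h := integral_neg_eq_self (dgauss i) (volume : Measure Plane)
  have h2 : ∀ x, dgauss i (-x) = -dgauss i x := by intro x; simp [dgauss, gauss]; ring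
  simp_rw [h2, integral_neg] at h
  linarith

/-! ### Self-similar data -/

lemma IsSelfSimilar.eq_inv_norm_smul {u : Plane → Plane} (hu : IsSelfSimilar u) {z : Plane}
    (hz : z ≠ 0) : u z = ‖z‖⁻¹ • u (‖z‖⁻¹ • z) :=
  (hu ‖z‖⁻¹ (inv_pos.2 (norm_pos_iff.2 hz)) z hz).symm

lemma inv_norm_smul_mem_sphere {z : Plane} (hz : z ≠ 0) :
    ‖z‖⁻¹ • z ∈ Metric.sphere (0 : Plane) 1 := by
  simp [norm_smul, hz]

/-- A real-valued form of the bound on the Hölder norm over the circle. -/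
structure CircleHolderBound (β : ℝ≥0) (A : ℝ) (u : Plane → Plane) : Prop where
  norm_le : ∀ x ∈ Metric.sphere (0 : Plane) 1, ‖u x‖ ≤ A
  holder : ∀ x ∈ Metric.sphere (0 : Plane) 1, ∀ y ∈ Metric.sphere (0 : Plane) 1,
    ‖u x - u y‖ ≤ A * ‖x - y‖ ^ (β : ℝ)

lemma circleHolderBound_of_norm_eq {β A : ℝ≥0} {u : Plane → Plane}
    (h : circleHolderNorm β u = A) : CircleHolderBound β A u := by
  have h1 : (⨆ x : Metric.sphere (0 : Plane) 1, ‖u x‖ₑ) ≤ A := by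
    rw [← h, circleHolderNorm]; exact le_self_add
  have h2 : eHolderNorm β (fun x : Metric.sphere (0 : Plane) 1 => u x) ≤ A := by
    rw [← h, circleHolderNorm]; exact le_add_self
  refine ⟨fun x hx => ?_, fun x hx y hy => ?_⟩
  · have : ‖u x‖ₑ ≤ A := (le_iSup (fun x : Metric.sphere (0 : Plane) 1 => ‖u x‖ₑ) ⟨x, hx⟩).trans h1
    rw [← ofReal_norm, ENNReal.ofReal_le_iff_le_toReal ENNReal.coe_ne_top] at this
    exact this
  · have hm : MemHolder β (fun x : Metric.sphere (0 : Plane) 1 => u x) := by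
      rw [← eHolderNorm_ne_top]
      exact (h2.trans_lt ENNReal.coe_lt_top).ne
    have h3 : nnHolderNorm β (fun x : Metric.sphere (0 : Plane) 1 => u x) ≤ A := by
      rw [← ENNReal.coe_le_coe, hm.coe_nnHolderNorm_eq_eHolderNorm]; exact h2
    have h4 := hm.holderWith.dist_le ⟨x, hx⟩ ⟨y, hy⟩
    rw [dist_eq_norm, Subtype.dist_eq, dist_eq_norm] at h4
    refine h4.trans ?_
    gcongr

section
variable {β : ℝ≥0} {A : ℝ} {u : Plane → Plane}

lemma CircleHolderBound.nonneg (h : CircleHolderBound β A u) : 0 ≤ A :=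
  (norm_nonneg _).trans (h.norm_le (e 0) (by simp [norm_e]))

lemma norm_le_of_selfSimilar (hs : IsSelfSimilar u) (h : CircleHolderBound β A u) (z : Plane)
    (hz : z ≠ 0) : ‖u z‖ ≤ A * ‖z‖⁻¹ := by
  rw [hs.eq_inv_norm_smul hz, norm_smul, norm_inv, norm_norm, mul_comm]
  gcongr
  exact h.norm_le _ (inv_norm_smul_mem_sphere hz)

/-- Self-similar data that are Hölder continuous on the circle are continuous off the origin. -/
lemma aestronglyMeasurable_of_selfSimilar (hβ : 0 < β) (hs : IsSelfSimilar u)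
    (h : CircleHolderBound β A u) : AEStronglyMeasurable u := by
  have hc : ContinuousOn u (Metric.sphere (0 : Plane) 1) := by
    intro x hx
    rw [ContinuousWithinAt, tendsto_iff_norm_sub_tendsto_zero]
    refine tendsto_of_tendsto_of_tendsto_of_le_of_le' tendsto_const_nhds
      (h := fun y => A * ‖y - x‖ ^ (β : ℝ)) ?_ (.of_forall fun _ => norm_nonneg _)
      (eventually_nhdsWithin_of_forall fun y hy => h.holder y hy x hx)
    have : Continuous fun y : Plane => A * ‖y - x‖ ^ (β : ℝ) :=
      continuous_const.mul ((continuous_id.sub continuous_const).norm.rpow_const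
        fun _ => Or.inr β.coe_nonneg)
    have h2 := this.tendsto x
    simp only [sub_self, norm_zero] at h2
    rw [Real.zero_rpow (by exact_mod_cast hβ.ne'), mul_zero] at h2
    exact h2.mono_left nhdsWithin_le_nhds
  have hinv : ContinuousOn (fun z : Plane => ‖z‖⁻¹) {0}ᶜ :=
    continuousOn_id.norm.inv₀ fun z hz => norm_ne_zero_iff.2 hz
  have hc2 : ContinuousOn u {0}ᶜ := by
    have h3 : ContinuousOn (fun z : Plane => ‖z‖⁻¹ • u (‖z‖⁻¹ • z)) {0}ᶜ :=
      hinv.smul (hc.comp (hinv.smul continuousOn_id) fun z hz => inv_norm_smul_mem_sphere hz)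
    exact h3.congr fun z hz => hs.eq_inv_norm_smul hz
  have := hc2.aestronglyMeasurable (μ := (volume : Measure Plane)) (measurableSet_singleton 0).compl
  rwa [restrict_compl_singleton] at this

lemma norm_inv_smul_sub_le {y z : Plane} (hy : y ≠ 0) (hz : z ≠ 0) :
    ‖‖z‖⁻¹ • z - ‖y‖⁻¹ • y‖ ≤ 2 * ‖y - z‖ * ‖y‖⁻¹ := by
  have hy' : 0 < ‖y‖ := norm_pos_iff.2 hy
  have hz' : 0 < ‖z‖ := norm_pos_iff.2 hz
  have h1 : ‖z‖⁻¹ • z - ‖y‖⁻¹ • y = ‖y‖⁻¹ • ((‖y‖ - ‖z‖) • (‖z‖⁻¹ • z) + (z - y)) := by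
    have h2 : ‖y‖⁻¹ * ((‖y‖ - ‖z‖) * ‖z‖⁻¹) = ‖z‖⁻¹ - ‖y‖⁻¹ := by field_simp
    rw [smul_add, smul_smul, smul_smul, smul_sub, mul_assoc, h2, sub_smul]
    abel
  rw [h1, norm_smul, norm_inv, norm_norm, mul_comm]
  gcongr
  refine (norm_add_le _ _).trans ?_
  rw [norm_smul, norm_smul, norm_inv, norm_norm, inv_mul_cancel₀ hz'.ne', mul_one,
    norm_sub_rev z y, Real.norm_eq_abs]
  linarith [abs_norm_sub_norm_le y z]

/-- The modulus of continuity of a field of degree `-1` with Hölder values on the circle. -/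
lemma norm_sub_le_of_selfSimilar (hβ1 : β ≤ 1) (hs : IsSelfSimilar u)
    (h : CircleHolderBound β A u) {y z : Plane} (hy : y ≠ 0) (hz : z ≠ 0) :
    ‖u z - u y‖ ≤ A * (‖y - z‖ * ‖z‖⁻¹ * ‖y‖⁻¹)
      + 2 * A * (‖y‖⁻¹ * ‖y‖⁻¹ ^ (β : ℝ) * (1 + ‖y - z‖)) := by
  have hy' : 0 < ‖y‖ := norm_pos_iff.2 hy
  have hz' : 0 < ‖z‖ := norm_pos_iff.2 hz
  have hA := h.nonneg
  set a := ‖z‖⁻¹ • z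
  set b := ‖y‖⁻¹ • y
  have h1 : u z - u y = (‖z‖⁻¹ - ‖y‖⁻¹) • u a + ‖y‖⁻¹ • (u a - u b) := by
    rw [hs.eq_inv_norm_smul hz, hs.eq_inv_norm_smul hy, sub_smul, smul_sub]; abel
  rw [h1]
  refine (norm_add_le _ _).trans (add_le_add ?_ ?_)
  · rw [norm_smul, mul_comm]
    have h2 : ‖‖z‖⁻¹ - ‖y‖⁻¹‖ ≤ ‖y - z‖ * ‖z‖⁻¹ * ‖y‖⁻¹ := by
      have : ‖z‖⁻¹ - ‖y‖⁻¹ = (‖y‖ - ‖z‖) * (‖z‖⁻¹ * ‖y‖⁻¹) := by field_simp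
      rw [this, norm_mul, Real.norm_eq_abs, Real.norm_of_nonneg (by positivity), mul_assoc]
      gcongr
      exact abs_norm_sub_norm_le y z
    exact mul_le_mul (h.norm_le a (inv_norm_smul_mem_sphere hz)) h2 (norm_nonneg _) hA
  · rw [norm_smul, norm_inv, norm_norm]
    have h3 := h.holder a (inv_norm_smul_mem_sphere hz) b (inv_norm_smul_mem_sphere hy)
    have h4 : ‖a - b‖ ^ (β : ℝ) ≤ 2 * ‖y‖⁻¹ ^ (β : ℝ) * (1 + ‖y - z‖) := by
      have hβ1' : (β : ℝ) ≤ 1 := by exact_mod_cast hβ1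
      have hβ0 : (0 : ℝ) ≤ β := β.coe_nonneg
      calc ‖a - b‖ ^ (β : ℝ) ≤ (2 * (1 + ‖y - z‖) * ‖y‖⁻¹) ^ (β : ℝ) := by
            gcongr
            refine (norm_inv_smul_sub_le hy hz).trans ?_
            gcongr
            linarith
        _ = (2 * (1 + ‖y - z‖)) ^ (β : ℝ) * ‖y‖⁻¹ ^ (β : ℝ) := by
            rw [Real.mul_rpow (by positivity) (by positivity)]
        _ ≤ (2 * (1 + ‖y - z‖)) ^ (1 : ℝ) * ‖y‖⁻¹ ^ (β : ℝ) := by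
            gcongr
            linarith [norm_nonneg (y - z)]
        _ = _ := by rw [Real.rpow_one]; ring
    calc ‖y‖⁻¹ * ‖u a - u b‖ ≤ ‖y‖⁻¹ * (A * (2 * ‖y‖⁻¹ ^ (β : ℝ) * (1 + ‖y - z‖))) := by
          gcongr
          exact h3.trans (by gcongr)
      _ = _ := by ring

/-! ### The heat evolution of self-similar data at time one -/

lemma pd_conv_gauss (hum : AEStronglyMeasurable u) (hu : ∀ z, z ≠ 0 → ‖u z‖ ≤ A * ‖z‖⁻¹)
    (i : Fin 2) : pd i (conv gauss u) = conv (dgauss i) u := by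
  rw [pd_conv contDiff_gauss abs_gauss_le norm_fderiv_gauss_le hum hu, pd_gauss]

/-- Cancellation in the gradient of the heat evolution: the kernel `∂ᵢΓ` has mean zero, so only
the oscillation of the data enters. -/
lemma norm_conv_dgauss_le (hβ : 0 < β) (hβ1 : β ≤ 1) (hs : IsSelfSimilar u)
    (h : CircleHolderBound β A u) (i : Fin 2) {y : Plane} (hy : 1 ≤ ‖y‖) :
    ‖conv (dgauss i) u y‖ ≤ 2 ^ 20 * A * (potentialConst +
      2 * ∫ x : Plane, ((1 + ‖x‖) ^ 4)⁻¹) * (‖y‖⁻¹ * ‖y‖⁻¹ ^ (β : ℝ)) := by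
  have hum := aestronglyMeasurable_of_selfSimilar hβ hs h
  have hu := norm_le_of_selfSimilar hs h
  have hA := h.nonneg
  have hy0 : y ≠ 0 := by rintro rfl; simp at hy; linarith
  have hy' : 0 < ‖y‖ := by linarith
  have hi4 := integrable_inv_one_add_norm_pow (m := 4) (by norm_num)
  have hdi : Integrable (dgauss i) := by
    refine (hi4.const_mul (2 ^ 20)).mono'
      (contDiff_dgauss i (n := 0)).continuous.aestronglyMeasurable (ae_of_all _ fun x => ?_)
    exact abs_dgauss_le' i x
  have hd0 : ∫ z, dgauss i (y - z) = 0 := by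
    rw [integral_sub_left_eq_self (dgauss i) volume y, integral_dgauss]
  -- subtraction of `u y`, as the kernel has mean zero
  have hrep : conv (dgauss i) u y = ∫ z, dgauss i (y - z) • (u z - u y) := by
    simp_rw [smul_sub]
    rw [integral_sub (integrable_kernel_smul (contDiff_dgauss i (n := 0)).continuous
      (abs_dgauss_le' i) hum hu y) ((hdi.comp_sub_left y).smul_const _), integral_smul_const, hd0,
      zero_smul, sub_zero, conv]
  set t := ‖y‖⁻¹ * ‖y‖⁻¹ ^ (β : ℝ) with ht
  have ht0 : 0 ≤ t := by positivity
  have hbd : ∀ᵐ z, ‖dgauss i (y - z) • (u z - u y)‖ ≤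
      2 ^ 20 * A * ‖y‖⁻¹ * (((1 + ‖y - z‖) ^ 4)⁻¹ * ‖z‖⁻¹)
        + 2 ^ 20 * (2 * A) * t * ((1 + ‖y - z‖) ^ 4)⁻¹ := by
    filter_upwards [ae_ne_zero] with z hz
    have hz' : 0 < ‖z‖ := norm_pos_iff.2 hz
    rw [norm_smul]
    set r := ‖y - z‖ with hr
    have hr0 : 0 ≤ r := norm_nonneg _
    calc ‖dgauss i (y - z)‖ * ‖u z - u y‖
        ≤ (2 ^ 20 * ((1 + r) ^ 5)⁻¹) *
          (A * (r * ‖z‖⁻¹ * ‖y‖⁻¹) + 2 * A * (t * (1 + r))) := by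
          exact mul_le_mul (abs_dgauss_le i _) (norm_sub_le_of_selfSimilar hβ1 hs h hy0 hz)
            (norm_nonneg _) (by positivity)
      _ ≤ (2 ^ 20 * ((1 + r) ^ 5)⁻¹) *
          (A * ((1 + r) * ‖z‖⁻¹ * ‖y‖⁻¹) + 2 * A * (t * (1 + r))) := by
          gcongr; linarith
      _ = _ := by
          field_simp
  rw [hrep]
  refine (norm_integral_le_of_norm_le (((integrable_potential y).const_mul _).add
    ((hi4.comp_sub_left y).const_mul _)) hbd).trans ?_
  simp only [Pi.add_apply]
  rw [integral_add ((integrable_potential y).const_mul _)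
    ((hi4.comp_sub_left y).const_mul _), integral_const_mul, integral_const_mul,
    integral_sub_left_eq_self (fun x : Plane => ((1 + ‖x‖) ^ 4)⁻¹) volume y]
  have h1 : ‖y‖⁻¹ * ∫ z : Plane, ((1 + ‖y - z‖) ^ 4)⁻¹ * ‖z‖⁻¹ ≤ t * potentialConst := by
    have h2 := integral_potential_le y
    have hI : 0 ≤ ∫ z : Plane, ((1 + ‖y - z‖) ^ 4)⁻¹ * ‖z‖⁻¹ :=
      integral_nonneg fun z => by positivity
    have h3 : ‖y‖⁻¹ ≤ ‖y‖⁻¹ ^ (β : ℝ) := by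
      have := Real.rpow_le_rpow_of_exponent_ge (inv_pos.2 hy') (inv_le_one_of_one_le₀ hy)
        (show (β : ℝ) ≤ 1 by exact_mod_cast hβ1)
      rwa [Real.rpow_one] at this
    have h4 : ∫ z : Plane, ((1 + ‖y - z‖) ^ 4)⁻¹ * ‖z‖⁻¹ ≤ ‖y‖⁻¹ * potentialConst := by
      rw [inv_mul_eq_div, le_div_iff₀ hy']
      nlinarith
    calc _ ≤ ‖y‖⁻¹ * (‖y‖⁻¹ * potentialConst) := by gcongr
      _ ≤ ‖y‖⁻¹ * (‖y‖⁻¹ ^ (β : ℝ) * potentialConst) := by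
        have := potentialConst_nonneg
        gcongr
      _ = _ := by rw [ht]; ring
  have : 0 ≤ 2 ^ 20 * A := by positivity
  nlinarith [mul_le_mul_of_nonneg_left h1 this]

lemma norm_fderiv_le_sum_pd (f : Plane → Plane) (y : Plane) :
    ‖fderiv ℝ f y‖ ≤ ∑ i, ‖pd i f y‖ := by
  refine ContinuousLinearMap.opNorm_le_bound _ (by positivity) fun h => ?_
  rw [fderiv_apply_eq_sum, Finset.sum_mul]
  refine (norm_sum_le _ _).trans (Finset.sum_le_sum fun i _ => ?_)
  rw [norm_smul, mul_comm]
  gcongr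
  exact abs_apply_le h i

/-- The self-similarity of the data turns into a scaling of the heat kernel. -/
lemma smul_conv_gauss_smul (hs : IsSelfSimilar u) {s : ℝ} (hs0 : 0 < s) (y : Plane) :
    s • conv gauss u (s • y) = ∫ z, (s ^ 2 * gauss (s • (y - z))) • u z := by
  have h := Measure.integral_comp_smul (volume : Measure Plane)
    (fun z => gauss (s • y - z) • u z) s
  simp only [finrank_euclideanSpace, Fintype.card_fin] at h
  rw [abs_of_nonneg (by positivity)] at h
  have h2 : conv gauss u (s • y) = s ^ 2 • ∫ z, gauss (s • y - s • z) • u (s • z) := by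
    rw [h, smul_smul, mul_inv_cancel₀ (by positivity), one_smul, conv]
  rw [h2, smul_smul, ← integral_smul]
  apply integral_congr_ae
  filter_upwards [ae_ne_zero] with z hz
  rw [← hs s hs0 z hz, smul_sub, smul_smul, smul_smul]
  congr 1
  ring

lemma gauss_smul_le {s : ℝ} (hs : 1 / 2 ≤ s) (x : Plane) :
    gauss (s • x) ≤ 2 ^ 28 * ((1 + ‖x‖) ^ 8)⁻¹ := by
  refine (gauss_le _).trans ?_
  rw [norm_smul, Real.norm_of_nonneg (by linarith)]
  have h1 : (1 + ‖x‖) ^ 8 ≤ 2 ^ 8 * (1 + s * ‖x‖) ^ 8 := by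
    rw [← mul_pow]
    gcongr
    nlinarith [norm_nonneg x]
  have h0 : 0 ≤ s * ‖x‖ := by have := norm_nonneg x; positivity
  rw [← div_eq_mul_inv, ← div_eq_mul_inv, div_le_div_iff₀ (by positivity) (by positivity)]
  nlinarith

/-- The profile equation of the heat evolution, `Δv₀ + v₀ / 2 + y · ∇v₀ / 2 = 0`. -/
lemma conv_gauss_profile (hum : AEStronglyMeasurable u)
    (hs : IsSelfSimilar u) (hu : ∀ z, z ≠ 0 → ‖u z‖ ≤ A * ‖z‖⁻¹) (y : Plane) :
    conv gauss u y + fderiv ℝ (conv gauss u) y y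
      = (-2 : ℝ) • ∑ i, pd i (pd i (conv gauss u)) y := by
  have hA : 0 ≤ A := by
    have := (norm_nonneg _).trans (hu (e 0) (by rw [← norm_ne_zero_iff, norm_e]; norm_num))
    simpa [norm_e] using this
  have hc : ContDiff ℝ 1 (conv gauss u) :=
    contDiff_conv contDiff_gauss abs_gauss_le norm_fderiv_gauss_le hum hu
  -- the derivative of `s • v₀ (s • y)` at `s = 1`, computed directly
  have hl : HasDerivAt (fun s : ℝ => s • conv gauss u (s • y))
      (conv gauss u y + fderiv ℝ (conv gauss u) y y) 1 := by
    have h1 : HasDerivAt (fun s : ℝ => s • y) y 1 := by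
      simpa using (hasDerivAt_id (1 : ℝ)).smul_const y
    have h2 : HasFDerivAt (conv gauss u) (fderiv ℝ (conv gauss u) y) ((1 : ℝ) • y) := by
      rw [one_smul]; exact (hc.differentiable one_ne_zero y).hasFDerivAt
    have h3 := (hasDerivAt_id (1 : ℝ)).smul (h2.comp_hasDerivAt (1 : ℝ) h1)
    simp only [id, one_smul, Function.comp_apply] at h3
    rw [add_comm]
    exact h3
  -- and through the scaled kernel
  have hr : HasDerivAt (fun s : ℝ => ∫ z, (s ^ 2 * gauss (s • (y - z))) • u z)
      (∫ z, (2 * gauss (y - z) + fderiv ℝ gauss (y - z) (y - z)) • u z) 1 := by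
    have hd : ∀ (x : Plane) (s : ℝ), HasDerivAt (fun s : ℝ => s ^ 2 * gauss (s • x))
        (2 * s * gauss (s • x) + s ^ 2 * fderiv ℝ gauss (s • x) x) s := by
      intro x s
      have h1 : HasDerivAt (fun s : ℝ => s • x) x s := by
        simpa using (hasDerivAt_id s).smul_const x
      have h2 := ((hasFDerivAt_gauss (s • x)).comp_hasDerivAt s h1)
      have h3 := ((hasDerivAt_pow 2 s).mul h2)
      rw [(hasFDerivAt_gauss (s • x)).fderiv]
      convert! h3 using 1
      simp
    have := (hasDerivAt_integral_of_dominated_loc_of_deriv_le (μ := volume) (𝕜 := ℝ)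
      (F := fun s z => (s ^ 2 * gauss (s • (y - z))) • u z)
      (F' := fun s z => (2 * s * gauss (s • (y - z)) +
        s ^ 2 * fderiv ℝ gauss (s • (y - z)) (y - z)) • u z)
      (x₀ := 1) (s := Metric.ball 1 (1 / 2))
      (bound := fun z => 8 * 2 ^ 28 * A * (((1 + ‖y - z‖) ^ 4)⁻¹ * ‖z‖⁻¹))
      (Metric.ball_mem_nhds _ (by norm_num)) ?_ ?_ ?_ ?_
      ((integrable_potential y).const_mul _) ?_).2
    · simpa using this
    · refine .of_forall fun s => ?_
      have : Continuous fun z : Plane => s ^ 2 * gauss (s • (y - z)) :=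
        continuous_const.mul ((contDiff_gauss (n := 0)).continuous.comp (by fun_prop))
      exact this.aestronglyMeasurable.smul hum
    · simpa using integrable_kernel_smul (contDiff_gauss (n := 0)).continuous abs_gauss_le hum hu y
    · have : Continuous fun z : Plane => 2 * gauss (y - z) + fderiv ℝ gauss (y - z) (y - z) := by
        simp_rw [fderiv_gauss_apply]
        have h1 := (contDiff_gauss (n := 0)).continuous.comp
          (by fun_prop : Continuous fun z : Plane => y - z)
        simp only [Function.comp_def] at h1
        fun_prop
      simpa using! this.aestronglyMeasurable.smul hum
    · filter_upwards [ae_ne_zero] with z hz s hs1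
      rw [Metric.mem_ball, Real.dist_eq, abs_lt] at hs1
      set x := y - z
      set r := ‖x‖ with hr
      have hr0 : 0 ≤ r := norm_nonneg x
      have hg := gauss_smul_le (s := s) (by linarith) x
      have hg0 := gauss_nonneg (s • x)
      have hs0 : 0 ≤ s := by linarith
      rw [norm_smul, fderiv_gauss_apply, inner_smul_left, real_inner_self_eq_norm_sq]
      have h1 : ‖2 * s * gauss (s • x) + s ^ 2 * (-(gauss (s • x) / 2) *
          ((starRingEnd ℝ) s * ‖x‖ ^ 2))‖ ≤ 8 * 2 ^ 28 * ((1 + r) ^ 4)⁻¹ := by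
        have e1 : 2 * s * gauss (s • x) + s ^ 2 * (-(gauss (s • x) / 2) *
          ((starRingEnd ℝ) s * ‖x‖ ^ 2)) = (2 * s - s ^ 3 * r ^ 2 / 2) * gauss (s • x) := by
          simp only [conj_trivial, hr]; ring
        rw [e1, norm_mul, Real.norm_of_nonneg hg0]
        have h2 : ‖2 * s - s ^ 3 * r ^ 2 / 2‖ ≤ 8 * (1 + r) ^ 4 := by
          have h3 : s ^ 3 ≤ 8 := by
            calc s ^ 3 ≤ 2 ^ 3 := by gcongr; linarith
              _ = 8 := by norm_num
          have h4 : r ^ 2 ≤ (1 + r) ^ 4 := by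
            calc r ^ 2 ≤ (1 + r) ^ 2 := by gcongr; linarith
              _ ≤ (1 + r) ^ 4 := pow_le_pow_right₀ (by linarith) (by norm_num)
          have h5 : 1 ≤ (1 + r) ^ 4 := one_le_pow₀ (by linarith)
          have h6 : s ^ 3 * r ^ 2 ≤ 8 * (1 + r) ^ 4 := mul_le_mul h3 h4 (by positivity) (by norm_num)
          have h7 : 0 ≤ s ^ 3 * r ^ 2 := by positivity
          rw [Real.norm_eq_abs, abs_le]
          constructor <;> linarith
        calc _ ≤ (8 * (1 + r) ^ 4) * (2 ^ 28 * ((1 + r) ^ 8)⁻¹) := by gcongr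
          _ = _ := by field_simp
      calc _ ≤ (8 * 2 ^ 28 * ((1 + r) ^ 4)⁻¹) * (A * ‖z‖⁻¹) :=
            mul_le_mul h1 (hu z hz) (norm_nonneg _) (by positivity)
        _ = _ := by ring
    · exact ae_of_all _ fun z s _ => (hd (y - z) s).smul_const (u z)
  have heq : (fun s : ℝ => s • conv gauss u (s • y)) =ᶠ[𝓝 1]
      fun s : ℝ => ∫ z, (s ^ 2 * gauss (s • (y - z))) • u z := by
    filter_upwards [lt_mem_nhds one_pos] with s hs0 using smul_conv_gauss_smul hs hs0 y
  rw [hl.unique (hr.congr_of_eventuallyEq heq)]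
  simp_rw [gauss_profile]
  have hp : ∀ i, pd i (pd i (conv gauss u)) y = ∫ z, pd i (dgauss i) (y - z) • u z := by
    intro i
    rw [pd_conv_gauss hum hu, pd_conv (contDiff_dgauss i) (abs_dgauss_le' i)
      (norm_fderiv_dgauss_le i) hum hu]
    rfl
  have hint : ∀ i, Integrable fun z => pd i (dgauss i) (y - z) • u z := by
    intro i
    exact integrable_kernel_smul (continuous_pd (contDiff_dgauss i (n := 1)) i)
      (fun x => (norm_pd_le i _ x).trans (norm_fderiv_dgauss_le i x)) hum hu y
  simp_rw [hp]
  rw [← integral_finsetSum _ fun i _ => hint i, ← integral_smul]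
  congr 1
  funext z
  rw [← Finset.sum_smul, smul_smul]

end

/-! ### The background profile -/

/-- The squared Hilbert–Schmidt norm `|∇v|²` of the gradient. -/
def gradSq (v : Plane → Plane) (y : Plane) : ℝ := ∑ i, ‖pd i v y‖ ^ 2

lemma gradSq_nonneg (v : Plane → Plane) (y : Plane) : 0 ≤ gradSq v y :=
  Finset.sum_nonneg fun _ _ => sq_nonneg _

lemma continuous_gradSq {v : Plane → Plane} (hv : ContDiff ℝ 1 v) : Continuous (gradSq v) :=
  continuous_finsetSum _ fun i _ => (continuous_pd hv i).norm.pow 2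

lemma norm_fderiv_apply_sq_le (v : Plane → Plane) (y h : Plane) :
    ‖fderiv ℝ v y h‖ ^ 2 ≤ gradSq v y * ‖h‖ ^ 2 := by
  rw [fderiv_apply_eq_sum, gradSq, EuclideanSpace.real_norm_sq_eq h, Fin.sum_univ_two,
    Fin.sum_univ_two, Fin.sum_univ_two]
  have h1 := norm_add_le (h 0 • pd 0 v y) (h 1 • pd 1 v y)
  rw [norm_smul, norm_smul, Real.norm_eq_abs, Real.norm_eq_abs] at h1
  have h2 := pow_le_pow_left₀ (norm_nonneg _) h1 2
  refine h2.trans ?_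
  rw [← sq_abs (h 0), ← sq_abs (h 1)]
  nlinarith [sq_nonneg (|h 0| * ‖pd 1 v y‖ - |h 1| * ‖pd 0 v y‖)]

/-- The properties of the heat evolution `v₀` of the data at time one on which the energy estimates
rest; all quantitative information is carried by the constant `c`. -/
structure IsProfile (v₀ : Plane → Plane) (c : ℝ) : Prop where
  contDiff : ContDiff ℝ 1 v₀
  contDiff_pd : ∀ i, ContDiff ℝ 1 (pd i v₀)
  div_eq_zero : ∀ y, divergence v₀ y = 0
  decay : ∀ y, (1 + ‖y‖) * ‖v₀ y‖ ≤ c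
  fderiv_decay : ∀ y, (1 + ‖y‖) * ‖fderiv ℝ v₀ y‖ ≤ c
  profile_eq : ∀ y, v₀ y + fderiv ℝ v₀ y y = (-2 : ℝ) • ∑ i, pd i (pd i v₀) y
  integrable_gradSq : Integrable (gradSq v₀)
  integral_gradSq_le : ∫ y, gradSq v₀ y ≤ c

section
variable {β : ℝ≥0} {A : ℝ} {u : Plane → Plane}

/-- The translated heat kernel is an admissible test function for the weak divergence of the data, by
removal of a cutoff. -/
lemma divergence_conv_gauss (hw : IsWeaklyDivFree u) (hum : AEStronglyMeasurable u)
    (hu : ∀ z, z ≠ 0 → ‖u z‖ ≤ A * ‖z‖⁻¹) (y : Plane) : divergence (conv gauss u) y = 0 := by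
  set G : Plane → ℝ := fun z => gauss (y - z) with hG
  have hGc : ContDiff ℝ ∞ G := contDiff_gauss.comp (contDiff_const.sub contDiff_id)
  have hGd : ∀ z h, fderiv ℝ G z h = - ∑ i, h i * dgauss i (y - z) := by
    intro z h
    have h1 : HasFDerivAt G _ z := (hasFDerivAt_gauss (y - z)).comp z
      ((hasFDerivAt_const y z).sub (hasFDerivAt_id z))
    rw [h1.fderiv]
    simp [PiLp.inner_apply, dgauss]
    ring
  have hint : ∀ i, Integrable fun z => dgauss i (y - z) • u z := fun i =>
    integrable_kernel_smul (contDiff_dgauss i (n := 0)).continuous (abs_dgauss_le' i) hum hu y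
  have hinti : ∀ i, Integrable fun z => u z i * dgauss i (y - z) := by
    intro i
    have := (EuclideanSpace.proj i : Plane →L[ℝ] ℝ).integrable_comp (hint i)
    refine this.congr (ae_of_all _ fun z => ?_)
    simp [mul_comm]
  have hF : Integrable fun z => G z • u z :=
    integrable_kernel_smul (contDiff_gauss (n := 0)).continuous abs_gauss_le hum hu y
  have hA : Integrable fun z => fderiv ℝ G z (u z) := by
    simp_rw [hGd]
    exact (integrable_finsetSum _ fun i _ => hinti i).neg
  have h0 : ∫ z, fderiv ℝ G z (u z) = 0 := by
    refine integral_eq_zero_of_cutoff hA hF.norm hF.1 (fun z => ?_) fun n => ?_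
    · exact le_mul_of_one_le_left (norm_nonneg _) (by linarith [norm_nonneg z])
    · rw [← hw (fun z => chi n z * G z)
        ⟨(contDiff_chi n (m := ⊤)).mul hGc, (hasCompactSupport_chi n).mul_right⟩]
      congr 1
      funext z
      have h1 := (contDiff_chi n (m := 1)).differentiable one_ne_zero z
      have h2 := hGc.differentiable (by simp) z
      rw [fderiv_fun_mul h1 h2]
      simp
  have h1 : divergence (conv gauss u) y = ∑ i, ∫ z, u z i * dgauss i (y - z) := by
    unfold divergence
    refine Finset.sum_congr rfl fun i _ => ?_
    have h2 : fderiv ℝ (conv gauss u) y (e i) = conv (dgauss i) u y :=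
      congrFun (pd_conv_gauss hum hu i) y
    rw [h2, conv]
    have := (EuclideanSpace.proj i : Plane →L[ℝ] ℝ).integral_comp_comm (hint i)
    refine Eq.trans ?_ (Eq.trans this.symm ?_)
    · rfl
    · congr 1
      funext z
      simp [mul_comm]
  rw [h1, ← integral_finsetSum _ fun i _ => hinti i]
  simp_rw [hGd, integral_neg] at h0
  linarith

/-- The exponent exceeds `2`, the dimension, because `β > 0`: the gradient is square integrable. For
`|y| < 1` the decay holds trivially. -/
lemma gradSq_conv_gauss_le (hβ : 0 < β) (hβ1 : β ≤ 1) (hs : IsSelfSimilar u)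
    (h : CircleHolderBound β A u) (y : Plane) :
    gradSq (conv gauss u) y ≤ 2 * (4 * (2 ^ 20 * A * (potentialConst +
      2 * ∫ x : Plane, ((1 + ‖x‖) ^ 4)⁻¹))) ^ 2 * (1 + ‖y‖) ^ (-(2 + 2 * (β : ℝ))) := by
  have hum := aestronglyMeasurable_of_selfSimilar hβ hs h
  have hu := norm_le_of_selfSimilar hs h
  have hA := h.nonneg
  have hβ1' : (β : ℝ) ≤ 1 := by exact_mod_cast hβ1
  have hβ0 : (0 : ℝ) ≤ β := β.coe_nonneg
  set I := ∫ x : Plane, ((1 + ‖x‖) ^ 4)⁻¹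
  have hI : 0 ≤ I := integral_nonneg fun x => by positivity
  have hp := potentialConst_nonneg
  set K := 2 ^ 20 * A * (potentialConst + 2 * I) with hK
  have hK0 : 0 ≤ K := by positivity
  clear_value K
  have key : ∀ i, ‖pd i (conv gauss u) y‖ ≤ 4 * K * (1 + ‖y‖) ^ (-(1 + (β : ℝ))) := by
    intro i
    rw [pd_conv_gauss hum hu]
    rcases le_or_gt 1 ‖y‖ with hy | hy
    · have h0 := norm_conv_dgauss_le hβ hβ1 hs h i hy
      rw [← hK] at h0
      refine h0.trans ?_
      rw [mul_comm 4 K, mul_assoc]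
      refine mul_le_mul_of_nonneg_left ?_ hK0
      have hy' : 0 < ‖y‖ := by linarith
      have h1 : ‖y‖⁻¹ ≤ 2 * (1 + ‖y‖)⁻¹ := by
        rw [← div_eq_mul_inv, inv_eq_one_div, div_le_div_iff₀ hy' (by positivity)]; linarith
      calc ‖y‖⁻¹ * ‖y‖⁻¹ ^ (β : ℝ) = ‖y‖⁻¹ ^ (1 + (β : ℝ)) := by
            rw [Real.rpow_add (by positivity), Real.rpow_one]
        _ ≤ (2 * (1 + ‖y‖)⁻¹) ^ (1 + (β : ℝ)) := by gcongr
        _ = 2 ^ (1 + (β : ℝ)) * (1 + ‖y‖) ^ (-(1 + (β : ℝ))) := by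
            rw [Real.mul_rpow (by positivity) (by positivity), Real.rpow_neg (by positivity),
              Real.inv_rpow (by positivity)]
        _ ≤ 2 ^ (2 : ℝ) * (1 + ‖y‖) ^ (-(1 + (β : ℝ))) := by
            gcongr
            · norm_num
            · linarith
        _ = _ := by norm_num
    · have h1 := norm_conv_le (y := y) hA (by positivity) (abs_dgauss_le' i) hu
      have h2 : ‖conv (dgauss i) u y‖ ≤ K := by
        have h3 : ‖conv (dgauss i) u y‖ ≤ (1 + ‖y‖) * ‖conv (dgauss i) u y‖ :=
          le_mul_of_one_le_left (norm_nonneg _) (by linarith [norm_nonneg y])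
        have h4 : 0 ≤ 2 ^ 20 * A * (2 * I) := by positivity
        rw [hK]; nlinarith
      have h5 : (1 / 4 : ℝ) ≤ (1 + ‖y‖) ^ (-(1 + (β : ℝ))) := by
        calc (1 / 4 : ℝ) = 2 ^ (-2 : ℝ) := by
              rw [Real.rpow_neg (by norm_num)]; norm_num
          _ ≤ 2 ^ (-(1 + (β : ℝ))) := by
              apply Real.rpow_le_rpow_of_exponent_le <;> linarith
          _ ≤ _ := by
              apply Real.rpow_le_rpow_of_nonpos (by positivity) <;> linarith
      nlinarith
  have hx : ((1 + ‖y‖) ^ (-(1 + (β : ℝ)))) ^ 2 = (1 + ‖y‖) ^ (-(2 + 2 * (β : ℝ))) := by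
    rw [← Real.rpow_natCast, ← Real.rpow_mul (by positivity)]
    congr 1; push_cast; ring
  unfold gradSq
  calc ∑ i, ‖pd i (conv gauss u) y‖ ^ 2
      ≤ ∑ i : Fin 2, (4 * K * (1 + ‖y‖) ^ (-(1 + (β : ℝ)))) ^ 2 :=
        Finset.sum_le_sum fun i _ => pow_le_pow_left₀ (norm_nonneg _) (key i) 2
    _ = _ := by rw [Fin.sum_univ_two, mul_pow, hx]; ring

end

/-- The heat evolution of self-similar data satisfies `IsProfile` with a constant depending only on
the Hölder exponent and on the bound for the data. -/
lemma exists_isProfile {β : ℝ≥0} (hβ : 0 < β) (hβ1 : β ≤ 1) (A : ℝ) :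
    ∃ c : ℝ, 0 ≤ c ∧ ∀ u : Plane → Plane, IsSelfSimilar u → IsWeaklyDivFree u →
      CircleHolderBound β A u → IsProfile (heatEvolution 1 u) c := by
  set L : ℝ := 2 * (4 * (2 ^ 20 * A * (potentialConst +
      2 * ∫ x : Plane, ((1 + ‖x‖) ^ 4)⁻¹))) ^ 2
  set I : ℝ := ∫ y : Plane, (1 + ‖y‖) ^ (-(2 + 2 * (β : ℝ)))
  have hβ' : (0 : ℝ) < β := by exact_mod_cast hβ
  have hI : Integrable fun y : Plane => (1 + ‖y‖) ^ (-(2 + 2 * (β : ℝ))) :=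
    integrable_one_add_norm_rpow (by linarith)
  have hI0 : 0 ≤ I := integral_nonneg fun y => by positivity
  have hL0 : 0 ≤ L := by positivity
  refine ⟨2 * (|A| * 2 ^ 20 * potentialConst) + L * I, ?_, fun u hs hw h => ?_⟩
  · have := potentialConst_nonneg
    positivity
  have hum := aestronglyMeasurable_of_selfSimilar hβ hs h
  have hu := norm_le_of_selfSimilar hs h
  have hA := h.nonneg
  have hp := potentialConst_nonneg
  rw [heatEvolution_one, abs_of_nonneg hA]
  have hc1 : ContDiff ℝ 1 (conv gauss u) :=
    contDiff_conv contDiff_gauss abs_gauss_le norm_fderiv_gauss_le hum hu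
  have hgi : Integrable (gradSq (conv gauss u)) := by
    refine (hI.const_mul L).mono' (continuous_gradSq hc1).aestronglyMeasurable
      (ae_of_all _ fun y => ?_)
    rw [Real.norm_of_nonneg (gradSq_nonneg _ _)]
    exact gradSq_conv_gauss_le hβ hβ1 hs h y
  have hLI : 0 ≤ L * I := by positivity
  have hAp : 0 ≤ A * 2 ^ 20 * potentialConst := by positivity
  constructor
  · exact hc1
  · intro i
    rw [pd_conv_gauss hum hu]
    exact contDiff_conv (contDiff_dgauss i) (abs_dgauss_le' i) (norm_fderiv_dgauss_le i) hum hu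
  · exact divergence_conv_gauss hw hum hu
  · intro y
    have := norm_conv_le (y := y) hA (by positivity) abs_gauss_le hu
    linarith
  · intro y
    have h1 : ∀ i, (1 + ‖y‖) * ‖pd i (conv gauss u) y‖ ≤ A * 2 ^ 20 * potentialConst := by
      intro i
      rw [pd_conv_gauss hum hu]
      exact norm_conv_le hA (by positivity) (abs_dgauss_le' i) hu y
    have h2 := norm_fderiv_le_sum_pd (conv gauss u) y
    rw [Fin.sum_univ_two] at h2
    have h3 := mul_le_mul_of_nonneg_left h2 (show 0 ≤ 1 + ‖y‖ by positivity)
    have := h1 0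
    have := h1 1
    linarith
  · exact conv_gauss_profile hum hs hu
  · exact hgi
  · have : ∫ y, gradSq (conv gauss u) y ≤ L * I := by
      rw [← integral_const_mul]
      exact integral_mono hgi (hI.const_mul L) (gradSq_conv_gauss_le hβ hβ1 hs h)
    linarith

/-! ### Test fields of class `C¹` -/

/-- Mollification bumps of radius `1 / (n + 1)`. -/
def mollBump (n : ℕ) : ContDiffBump (0 : Plane) :=
  ⟨1 / (2 * (n + 1)), 1 / (n + 1), by positivity, by
    rw [div_lt_div_iff₀ (by positivity) (by positivity)]
    linarith [n.cast_nonneg (α := ℝ)]⟩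

/-- Mollification of a field at scale `1 / (n + 1)`. -/
def mollify (n : ℕ) (φ : Plane → Plane) : Plane → Plane :=
  (mollBump n).normed volume ⋆[ContinuousLinearMap.lsmul ℝ ℝ, volume] φ

lemma tendsto_mollBump_rOut : Tendsto (fun n => (mollBump n).rOut) atTop (𝓝 0) :=
  tendsto_one_div_add_atTop_nhds_zero_nat

lemma tendsto_mollify {φ : Plane → Plane} (h : Continuous φ) (y : Plane) :
    Tendsto (fun n => mollify n φ y) atTop (𝓝 (φ y)) :=
  ContDiffBump.convolution_tendsto_right_of_continuous tendsto_mollBump_rOut h y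

lemma norm_mollify_le {φ : Plane → Plane} (h : Continuous φ) {M : ℝ} (hM : ∀ y, ‖φ y‖ ≤ M)
    (n : ℕ) (y : Plane) : ‖mollify n φ y‖ ≤ 3 * M := by
  have h1 : dist (mollify n φ y) (φ y) ≤ 2 * M := by
    refine ContDiffBump.dist_normed_convolution_le h.aestronglyMeasurable fun x _ => ?_
    rw [dist_eq_norm]
    refine (norm_sub_le _ _).trans ?_
    linarith [hM x, hM y]
  rw [dist_eq_norm] at h1
  have h2 := norm_add_le (mollify n φ y - φ y) (φ y)
  rw [sub_add_cancel] at h2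
  linarith [hM y]

lemma mollify_eq_zero {φ : Plane → Plane} {R : ℝ} (hR : ∀ y, R < ‖y‖ → φ y = 0) (n : ℕ) (y : Plane)
    (hy : R + 1 < ‖y‖) : mollify n φ y = 0 := by
  by_contra hne
  have h1 := support_convolution_subset (L := ContinuousLinearMap.lsmul ℝ ℝ) (μ := volume)
    (f := (mollBump n).normed volume) (g := φ) hne
  obtain ⟨a, ha, b, hb, rfl⟩ := Set.mem_add.1 h1
  rw [(mollBump n).support_normed_eq, mem_ball_zero_iff] at ha
  have hb' : ‖b‖ ≤ R := by
    by_contra! h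
    exact hb (hR b h)
  have ha' : (mollBump n).rOut ≤ 1 := by
    change 1 / ((n : ℝ) + 1) ≤ 1
    rw [div_le_one (by positivity)]
    linarith [n.cast_nonneg (α := ℝ)]
  have := norm_add_le a b
  linarith

lemma isTest_mollify {φ : Plane → Plane} (h : Continuous φ) (hc : HasCompactSupport φ) (n : ℕ) :
    IsTest (mollify n φ) :=
  ⟨(mollBump n).hasCompactSupport_normed.contDiff_convolution_left _
      (mollBump n).contDiff_normed h.locallyIntegrable,
    (mollBump n).hasCompactSupport_normed.convolution _ hc⟩

lemma pd_mollify {φ : Plane → Plane} (h : ContDiff ℝ 1 φ) (hc : HasCompactSupport φ) (n : ℕ)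
    (i : Fin 2) : pd i (mollify n φ) = mollify n (pd i φ) := by
  funext y
  have hn : LocallyIntegrable ((mollBump n).normed volume) :=
    (mollBump n).continuous_normed.locallyIntegrable
  have h1 := hc.hasFDerivAt_convolution_right (μ := volume) (ContinuousLinearMap.lsmul ℝ ℝ)
    hn h y
  rw [pd, mollify, h1.fderiv, convolution_precompR_apply _ hn (hc.fderiv (𝕜 := ℝ))
    (h.continuous_fderiv one_ne_zero)]
  rfl

lemma exists_forall_lt_norm_eq_zero {F : Type*} [NormedAddCommGroup F] {φ : Plane → F}
    (hc : HasCompactSupport φ) : ∃ R, ∀ y, R < ‖y‖ → φ y = 0 := by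
  obtain ⟨R, hR⟩ := hc.isCompact.isBounded.subset_closedBall 0
  refine ⟨R, fun y hy => ?_⟩
  by_contra hne
  have := hR (subset_tsupport _ hne)
  rw [mem_closedBall_zero_iff] at this
  linarith

/-- A weak identity against smooth test fields extends to test fields of class `C¹`. -/
lemma weak_identity_of_contDiff {w : Fin 2 → Plane → Plane} {b : Plane → Plane} {q : Plane → ℝ}
    (hw : ∀ i, Continuous (w i)) (hb : Continuous b) (hq : LocallyIntegrable q)
    (H : ∀ φ : Plane → Plane, IsTest φ →
      ∫ y, ((∑ i, inner ℝ (w i y) (pd i φ y)) + inner ℝ (b y) (φ y) - q y * divergence φ y) = 0)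
    {φ : Plane → Plane} (h : ContDiff ℝ 1 φ) (hc : HasCompactSupport φ) :
    ∫ y, ((∑ i, inner ℝ (w i y) (pd i φ y)) + inner ℝ (b y) (φ y) - q y * divergence φ y) = 0 := by
  obtain ⟨R, hR⟩ := exists_forall_lt_norm_eq_zero hc
  have hR' : ∀ i y, R < ‖y‖ → pd i φ y = 0 := by
    intro i y hy
    have : φ =ᶠ[𝓝 y] fun _ => 0 := by
      filter_upwards [(isOpen_lt continuous_const continuous_norm).mem_nhds hy] with z hz
        using hR z hz
    rw [pd, this.fderiv_eq]; simp
  obtain ⟨M₀, hM₀⟩ := h.continuous.bounded_above_of_compact_support hc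
  obtain ⟨M₁, hM₁⟩ := (h.continuous_fderiv one_ne_zero).bounded_above_of_compact_support
    (hc.fderiv (𝕜 := ℝ))
  set M := max M₀ M₁
  have hM : ∀ y, ‖φ y‖ ≤ M := fun y => (hM₀ y).trans (le_max_left _ _)
  have hM' : ∀ i y, ‖pd i φ y‖ ≤ M := fun i y =>
    (norm_pd_le i φ y).trans ((hM₁ y).trans (le_max_right _ _))
  have hM0 : 0 ≤ M := (norm_nonneg _).trans (hM 0)
  set B : Plane → ℝ := (Metric.closedBall (0 : Plane) (R + 1)).indicator fun y =>
    3 * M * ((∑ i, ‖w i y‖) + ‖b y‖ + 2 * ‖q y‖) with hB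
  have hBi : Integrable B := by
    rw [integrable_indicator_iff measurableSet_closedBall]
    have hK := isCompact_closedBall (0 : Plane) (R + 1)
    refine Integrable.const_mul ?_ _
    have h1 : IntegrableOn (fun y => (∑ i, ‖w i y‖) + ‖b y‖) (Metric.closedBall 0 (R + 1)) :=
      ((continuous_finsetSum _ fun i _ => (hw i).norm).add hb.norm).continuousOn.integrableOn_compact
        hK
    exact h1.add ((hq.integrableOn_isCompact hK).norm.const_mul 2)
  have hpm := pd_mollify h hc
  have hdiv : ∀ ψ : Plane → Plane, divergence ψ = fun y => ∑ i, pd i ψ y i := fun ψ => rfl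
  have hlim : Tendsto (fun n => ∫ y, ((∑ i, inner ℝ (w i y) (pd i (mollify n φ) y))
      + inner ℝ (b y) (mollify n φ y) - q y * divergence (mollify n φ) y)) atTop
      (𝓝 (∫ y, ((∑ i, inner ℝ (w i y) (pd i φ y)) + inner ℝ (b y) (φ y)
        - q y * divergence φ y))) := by
    refine tendsto_integral_of_dominated_convergence B (fun n => ?_) hBi (fun n => ?_) ?_
    · have ht := isTest_mollify h.continuous hc n
      have hpc : ∀ i, Continuous (pd i (mollify n φ)) := fun i =>
        continuous_pd (ht.1.of_le (by exact_mod_cast le_top)) i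
      refine (Continuous.aestronglyMeasurable ?_).sub (hq.aestronglyMeasurable.mul
        (Continuous.aestronglyMeasurable ?_))
      · exact (continuous_finsetSum _ fun i _ => (hw i).inner (hpc i)).add (hb.inner ht.1.continuous)
      · rw [hdiv]
        exact continuous_finsetSum _ fun i _ => (EuclideanSpace.proj i : Plane →L[ℝ] ℝ).continuous.comp (hpc i)
    · refine ae_of_all _ fun y => ?_
      by_cases hy : y ∈ Metric.closedBall (0 : Plane) (R + 1)
      · rw [hB, Set.indicator_of_mem hy, hdiv]
        have h1 : ∀ i, ‖pd i (mollify n φ) y‖ ≤ 3 * M := fun i => by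
          rw [hpm n i]; exact norm_mollify_le (continuous_pd h i) (hM' i) n y
        have h2 := norm_mollify_le h.continuous hM n y
        have h3 : ‖∑ i, inner ℝ (w i y) (pd i (mollify n φ) y)‖ ≤ 3 * M * ∑ i, ‖w i y‖ := by
          rw [Finset.mul_sum]
          refine (norm_sum_le _ _).trans (Finset.sum_le_sum fun i _ => ?_)
          refine (norm_inner_le_norm _ _).trans ?_
          rw [mul_comm]
          gcongr
          exact h1 i
        have h4 : ‖inner ℝ (b y) (mollify n φ y)‖ ≤ 3 * M * ‖b y‖ := by
          refine (norm_inner_le_norm _ _).trans ?_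
          rw [mul_comm]
          gcongr
        have h5 : ‖q y * ∑ i, pd i (mollify n φ) y i‖ ≤ 3 * M * (2 * ‖q y‖) := by
          rw [norm_mul]
          have : ‖∑ i, pd i (mollify n φ) y i‖ ≤ 2 * (3 * M) := by
            rw [Fin.sum_univ_two]
            refine (norm_add_le _ _).trans ?_
            have := (abs_apply_le (pd 0 (mollify n φ) y) 0).trans (h1 0)
            have := (abs_apply_le (pd 1 (mollify n φ) y) 1).trans (h1 1)
            simp only [Real.norm_eq_abs]
            linarith
          nlinarith [norm_nonneg (q y)]
        refine (norm_sub_le _ _).trans ((add_le_add_left (norm_add_le _ _) _).trans ?_)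
        linarith
      · rw [hB, Set.indicator_of_notMem hy, hdiv]
        have hy' : R + 1 < ‖y‖ := by
          rw [mem_closedBall_zero_iff] at hy; exact not_le.1 hy
        simp only [hpm, mollify_eq_zero hR n y hy', fun i => mollify_eq_zero (hR' i) n y hy']
        simp
    · refine ae_of_all _ fun y => ?_
      have h1 : ∀ i, Tendsto (fun n => pd i (mollify n φ) y) atTop (𝓝 (pd i φ y)) := fun i => by
        simp_rw [hpm]; exact tendsto_mollify (continuous_pd h i) y
      simp only [hdiv]
      refine (Tendsto.add (tendsto_finsetSum _ fun i _ => tendsto_const_nhds.inner (h1 i))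
        (tendsto_const_nhds.inner (tendsto_mollify h.continuous y))).sub
        (tendsto_const_nhds.mul (tendsto_finsetSum _ fun i _ => ?_))
      exact ((EuclideanSpace.proj i : Plane →L[ℝ] ℝ).continuous.tendsto _).comp (h1 i)
  refine tendsto_nhds_unique hlim (tendsto_const_nhds.congr fun n => ?_)
  exact (H _ (isTest_mollify h.continuous hc n)).symm

lemma continuous_divergence {φ : Plane → Plane} (h : ContDiff ℝ 1 φ) :
    Continuous (divergence φ) :=
  continuous_finsetSum _ fun i _ =>
    (EuclideanSpace.proj i : Plane →L[ℝ] ℝ).continuous.comp (continuous_pd h i)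

lemma fderiv_eq_zero_of_notMem_tsupport {F : Type*} [NormedAddCommGroup F] [NormedSpace ℝ F]
    {φ : Plane → F} {y : Plane} (hy : y ∉ tsupport φ) : fderiv ℝ φ y = 0 := by
  by_contra hne
  exact hy (support_fderiv_subset ℝ hne)

lemma integrable_mul_divergence {φ : Plane → Plane} (h : ContDiff ℝ 1 φ) (hc : HasCompactSupport φ)
    {q : Plane → ℝ} (hq : MemLp q 2) : Integrable fun y => q y * divergence φ y := by
  have hd : MemLp (divergence φ) 2 := by
    refine (continuous_divergence h).memLp_of_hasCompactSupport ?_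
    refine HasCompactSupport.intro hc.isCompact fun y hy => ?_
    simp [divergence, fderiv_eq_zero_of_notMem_tsupport hy]
  exact hq.integrable_mul hd

/-- The lower-order and nonlinear terms of the perturbed Leray system, in nondivergence form. -/
def leraySource (v₀ v : Plane → Plane) (y : Plane) : Plane :=
  -(1 / 2 : ℝ) • v y - (1 / 2 : ℝ) • fderiv ℝ v y y + fderiv ℝ v y (v₀ y + v y)
    + fderiv ℝ v₀ y (v₀ y + v y)

lemma continuous_leraySource {v₀ v : Plane → Plane} (h₀ : ContDiff ℝ 1 v₀) (h : ContDiff ℝ 1 v) :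
    Continuous (leraySource v₀ v) := by
  have h1 := h₀.continuous
  have h2 := h.continuous
  have h3 := h₀.continuous_fderiv one_ne_zero
  have h4 := h.continuous_fderiv one_ne_zero
  unfold leraySource
  fun_prop

/-- The perturbed Leray system may be tested with compactly supported fields of class `C¹`. -/
lemma IsPerturbedLeraySolution.weak_identity {v₀ v : Plane → Plane} {q : Plane → ℝ}
    (hs : IsPerturbedLeraySolution v₀ v q) (h₀ : ContDiff ℝ 1 v₀) (h : ContDiff ℝ 1 v)
    (hq : MemLp q 2) {φ : Plane → Plane} (hφ : ContDiff ℝ 1 φ) (hc : HasCompactSupport φ) :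
    ∫ y, ((∑ i, inner ℝ (pd i v y) (pd i φ y)) + inner ℝ (leraySource v₀ v y) (φ y)
      - q y * divergence φ y) = 0 := by
  have hql : LocallyIntegrable q := hq.locallyIntegrable (by norm_num)
  refine weak_identity_of_contDiff (continuous_pd h) (continuous_leraySource h₀ h) hql
    (fun φ hφ => ?_) hφ hc
  have hφ1 : ContDiff ℝ 1 φ := hφ.1.of_le (by exact_mod_cast le_top)
  have e1 := hs φ hφ
  have c1 := h₀.continuous
  have c2 := h.continuous
  have c3 := h₀.continuous_fderiv one_ne_zero
  have c4 := h.continuous_fderiv one_ne_zero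
  have c5 := hφ1.continuous
  have c6 := hφ1.continuous_fderiv one_ne_zero
  have hi2 : Integrable fun y => inner ℝ (fderiv ℝ v₀ y (v₀ y)) (φ y) := by
    refine Continuous.integrable_of_hasCompactSupport (by fun_prop)
      (HasCompactSupport.intro hφ.2.isCompact fun y hy => ?_)
    simp [image_eq_zero_of_notMem_tsupport hy]
  have hi1 : Integrable fun y => (∑ i, inner ℝ (pd i v y) (pd i φ y))
      + inner ℝ (leraySource v₀ v y) (φ y) - q y * divergence φ y := by
    have hw := continuous_pd h
    have hwφ := continuous_pd hφ1
    have hb := continuous_leraySource h₀ h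
    refine Integrable.sub (Continuous.integrable_of_hasCompactSupport (by fun_prop)
      (HasCompactSupport.intro hφ.2.isCompact fun y hy => ?_)) (integrable_mul_divergence hφ1 hφ.2 hq)
    simp [pd, image_eq_zero_of_notMem_tsupport hy, fderiv_eq_zero_of_notMem_tsupport hy]
  have e2 := integral_sub hi1 hi2
  have e3 : ∀ y, ((∑ i, inner ℝ (pd i v y) (pd i φ y)) + inner ℝ (leraySource v₀ v y) (φ y)
      - q y * divergence φ y) - inner ℝ (fderiv ℝ v₀ y (v₀ y)) (φ y)
      = ((∑ i, inner ℝ (fderiv ℝ v y (e i)) (fderiv ℝ φ y (e i)))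
        - (1 / 2 : ℝ) * inner ℝ (v y) (φ y)
        - (1 / 2 : ℝ) * inner ℝ (fderiv ℝ v y y) (φ y)
        + inner ℝ (fderiv ℝ v y (v₀ y)) (φ y)
        + inner ℝ (fderiv ℝ v₀ y (v y)) (φ y)
        + inner ℝ (fderiv ℝ v y (v y)) (φ y)
        - q y * divergence φ y) := by
    intro y
    simp only [leraySource, pd, inner_add_left, inner_sub_left, inner_smul_left, map_add,
      conj_trivial]
    ring
  simp_rw [e3] at e2
  linarith

/-! ### Energy identities with compactly supported weights -/

lemma fderiv_smul_field {θ : Plane → ℝ} {v : Plane → Plane} (hθ : ContDiff ℝ 1 θ)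
    (hv : ContDiff ℝ 1 v) (y h : Plane) :
    fderiv ℝ (fun y => θ y • v y) y h = θ y • fderiv ℝ v y h + fderiv ℝ θ y h • v y := by
  rw [fderiv_fun_smul (hθ.differentiable one_ne_zero y) (hv.differentiable one_ne_zero y)]
  simp

lemma fderiv_mul_inner {θ : Plane → ℝ} {v w : Plane → Plane} (hθ : ContDiff ℝ 1 θ)
    (hv : ContDiff ℝ 1 v) (hw : ContDiff ℝ 1 w) (y h : Plane) :
    fderiv ℝ (fun y => θ y * inner ℝ (v y) (w y)) y h =
      θ y * (inner ℝ (fderiv ℝ v y h) (w y) + inner ℝ (fderiv ℝ w y h) (v y))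
        + fderiv ℝ θ y h * inner ℝ (v y) (w y) := by
  have hvd := hv.differentiable one_ne_zero y
  have hwd := hw.differentiable one_ne_zero y
  rw [fderiv_fun_mul (hθ.differentiable one_ne_zero y) (hvd.inner ℝ hwd)]
  simp only [_root_.add_apply, _root_.smul_apply, smul_eq_mul, fderiv_inner_apply ℝ hvd hwd]
  rw [real_inner_comm (v y) (fderiv ℝ w y h)]
  ring

lemma inner_self_sq (x : Plane) : inner ℝ x x = ‖x‖ ^ 2 := real_inner_self_eq_norm_sq x

lemma divergence_smul {θ : Plane → ℝ} {v : Plane → Plane} (hθ : ContDiff ℝ 1 θ)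
    (hv : ContDiff ℝ 1 v) (hd : ∀ y, divergence v y = 0) (y : Plane) :
    divergence (fun y => θ y • v y) y = fderiv ℝ θ y (v y) := by
  have h := hd y
  unfold divergence at h ⊢
  simp_rw [fderiv_smul_field hθ hv]
  rw [fderiv_apply_eq_sum θ y (v y)]
  simp only [PiLp.add_apply, PiLp.smul_apply, smul_eq_mul, Finset.sum_add_distrib, pd]
  rw [← Finset.mul_sum, h, mul_zero, zero_add]
  exact Finset.sum_congr rfl fun i _ => mul_comm _ _

lemma divergence_add {a b : Plane → Plane} (ha : ContDiff ℝ 1 a) (hb : ContDiff ℝ 1 b)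
    (h1 : ∀ y, divergence a y = 0) (h2 : ∀ y, divergence b y = 0) (y : Plane) :
    divergence (fun y => a y + b y) y = 0 := by
  have e1 := h1 y
  have e2 := h2 y
  unfold divergence at *
  rw [fderiv_fun_add (ha.differentiable one_ne_zero y) (hb.differentiable one_ne_zero y)]
  simp only [_root_.add_apply, PiLp.add_apply, Finset.sum_add_distrib]
  rw [e1, e2, add_zero]

lemma divergence_const (x y : Plane) : divergence (fun _ => x) y = 0 := by
  simp [divergence]

/-- The energy flux: the field paired with the gradient of the weight in the local energy
identity. -/
def energyFlux (v₀ v : Plane → Plane) (q : Plane → ℝ) (y : Plane) : Plane :=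
  (∑ i, (inner ℝ (pd i v y) (v y) : ℝ) • e i) + (‖v y‖ ^ 2 / 4) • y
    - (‖v y‖ ^ 2 / 2) • (v₀ y + v y) - q y • v y

/-- The energy density: dissipation plus the production by the background profile. -/
def energyDensity (v₀ v : Plane → Plane) (y : Plane) : ℝ :=
  gradSq v y + inner ℝ (fderiv ℝ v₀ y (v₀ y + v y)) (v y)

/-- Continuous expressions that vanish where `θ` and `∇θ` do are integrable if `θ` has compact
support. -/
lemma integrable_of_tsupport {E F : Type*} [NormedAddCommGroup E] [NormedAddCommGroup F]
    [NormedSpace ℝ F] {f : Plane → E} {θ : Plane → F} (hf : Continuous f)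
    (hc : HasCompactSupport θ) (h : ∀ y, θ y = 0 → fderiv ℝ θ y = 0 → f y = 0) : Integrable f :=
  hf.integrable_of_hasCompactSupport (HasCompactSupport.intro hc.isCompact fun y hy =>
    h y (image_eq_zero_of_notMem_tsupport hy) (fderiv_eq_zero_of_notMem_tsupport hy))

lemma integral_add_mul_eq_zero {f g : Plane → ℝ} (hf : Integrable f ∧ ∫ y, f y = 0)
    (hg : Integrable g ∧ ∫ y, g y = 0) (a : ℝ) :
    Integrable (fun y => f y + a * g y) ∧ ∫ y, (f y + a * g y) = 0 := by
  refine ⟨hf.1.add (hg.1.const_mul a), ?_⟩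
  rw [integral_add hf.1 (hg.1.const_mul a), integral_const_mul, hf.2, hg.2]
  simp

section
variable {v₀ v : Plane → Plane} {q : Plane → ℝ} {c : ℝ}

/-- The local energy identity. The term `-v/2 - (y · ∇v)/2` contributes only through the gradient
of the weight, because the dilation field has divergence `2` in the plane. -/
lemma local_energy_identity (hs : IsPerturbedLeraySolution v₀ v q) (h₀ : IsProfile v₀ c)
    (h : ContDiff ℝ 1 v) (hd : ∀ y, divergence v y = 0) (hq : MemLp q 2) {θ : Plane → ℝ}
    (hθ : ContDiff ℝ 1 θ) (hc : HasCompactSupport θ) :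
    ∫ y, (θ y * energyDensity v₀ v y + fderiv ℝ θ y (energyFlux v₀ v q y)) = 0 := by
  have c1 := h₀.contDiff.continuous
  have c2 := h.continuous
  have c3 := h₀.contDiff.continuous_fderiv one_ne_zero
  have c4 := h.continuous_fderiv one_ne_zero
  have c5 := hθ.continuous
  have c6 := hθ.continuous_fderiv one_ne_zero
  have cw := continuous_pd h
  have cb := continuous_leraySource h₀.contDiff h
  have hV : ContDiff ℝ 1 fun y => v₀ y + v y := h₀.contDiff.add h
  have hφ : ContDiff ℝ 1 fun y => θ y • v y := hθ.smul h
  have hφc : HasCompactSupport fun y => θ y • v y := hc.smul_right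
  have cφ := continuous_pd hφ
  have cφ0 := hφ.continuous
  have hg : ContDiff ℝ 1 fun y => θ y * inner ℝ (v y) (v y) := hθ.mul (h.inner ℝ h)
  have hgc : HasCompactSupport fun y => θ y * inner ℝ (v y) (v y) := hc.mul_right
  have cg := hg.continuous_fderiv one_ne_zero
  have cg0 := hg.continuous
  -- the system tested with `θ v`, and the fluxes of `θ |v|²` along the dilation field and along `v₀ + v`
  have e1 := hs.weak_identity h₀.contDiff h hq hφ hφc
  have e2 := integral_fderiv_add_mul_divergence hg hgc contDiff_id
  have e3 := integral_fderiv_eq_zero hg hgc hV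
    (divergence_add h₀.contDiff h h₀.div_eq_zero hd)
  have i1 : Integrable fun y => (∑ i, inner ℝ (pd i v y) (pd i (fun y => θ y • v y) y))
      + inner ℝ (leraySource v₀ v y) (θ y • v y)
      - q y * divergence (fun y => θ y • v y) y := by
    refine Integrable.sub (integrable_of_tsupport (by fun_prop) hc fun y h1 h2 => ?_)
      (integrable_mul_divergence hφ hφc hq)
    simp [pd, fderiv_smul_field hθ h, h1, h2]
  have i2 : Integrable fun y => fderiv ℝ (fun y => θ y * inner ℝ (v y) (v y)) y y
      + (θ y * inner ℝ (v y) (v y)) * 2 := by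
    refine integrable_of_tsupport (by fun_prop) hc fun y h1 h2 => ?_
    rw [fderiv_mul_inner hθ h h]
    simp [h1, h2]
  have i3 : Integrable fun y => fderiv ℝ (fun y => θ y * inner ℝ (v y) (v y)) y (v₀ y + v y) := by
    refine integrable_of_tsupport (by fun_prop) hc fun y h1 h2 => ?_
    rw [fderiv_mul_inner hθ h h]
    simp [h1, h2]
  have e2' : ∫ y, (fderiv ℝ (fun y => θ y * inner ℝ (v y) (v y)) y y
      + (θ y * inner ℝ (v y) (v y)) * 2) = 0 := by
    rw [← e2]
    congr 1
    funext y
    rw [show divergence id y = 2 from divergence_id y]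
    rfl
  have key : ∀ y, θ y * energyDensity v₀ v y + fderiv ℝ θ y (energyFlux v₀ v q y) =
      ((∑ i, inner ℝ (pd i v y) (pd i (fun y => θ y • v y) y))
      + inner ℝ (leraySource v₀ v y) (θ y • v y)
      - q y * divergence (fun y => θ y • v y) y) +
      (1 / 4) * (fderiv ℝ (fun y => θ y * inner ℝ (v y) (v y)) y y
      + (θ y * inner ℝ (v y) (v y)) * 2)
      + (-1 / 2) * fderiv ℝ (fun y => θ y * inner ℝ (v y) (v y)) y (v₀ y + v y) := by
    intro y
    simp only [fderiv_mul_inner hθ h h]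
    simp only [pd, fderiv_smul_field hθ h, divergence_smul hθ h hd,
      energyDensity, energyFlux, gradSq, leraySource, Fin.sum_univ_two, inner_add_left,
      inner_sub_left, inner_add_right, inner_smul_left, inner_smul_right, map_add, map_sub,
      map_smul, smul_eq_mul, inner_self_sq, conj_trivial]
    ring
  simp_rw [key]
  exact (integral_add_mul_eq_zero (integral_add_mul_eq_zero ⟨i1, e1⟩ ⟨i2, e2'⟩ _) ⟨i3, e3⟩ _).2

/-- The flux in the identity obtained by testing with the background profile. -/
def profileFlux (v₀ v : Plane → Plane) (q : Plane → ℝ) (y : Plane) : Plane :=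
  (∑ i, (inner ℝ (pd i v y) (v₀ y) + inner ℝ (pd i v₀ y) (v y) : ℝ) • e i)
    + ((inner ℝ (v y) (v₀ y) : ℝ) / 2) • y
    - ((inner ℝ (v y) (v₀ y) : ℝ) + ‖v₀ y‖ ^ 2 / 2) • (v₀ y + v y) - q y • v₀ y

/-- The density in the identity obtained by testing with the background profile. -/
def profileDensity (v₀ v : Plane → Plane) (y : Plane) : ℝ :=
  2 * (∑ i, inner ℝ (pd i v y) (pd i v₀ y)) - inner ℝ (fderiv ℝ v₀ y (v₀ y + v y)) (v y)

/-- Testing with the background profile. The profile equation turns the linear terms into a second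
copy of `∫ ∇v : ∇v₀`, and the quadratic term in `v` becomes the production term of the energy
identity. -/
lemma local_profile_identity (hs : IsPerturbedLeraySolution v₀ v q) (h₀ : IsProfile v₀ c)
    (h : ContDiff ℝ 1 v) (hd : ∀ y, divergence v y = 0) (hq : MemLp q 2) {θ : Plane → ℝ}
    (hθ : ContDiff ℝ 1 θ) (hc : HasCompactSupport θ) :
    ∫ y, (θ y * profileDensity v₀ v y + fderiv ℝ θ y (profileFlux v₀ v q y)) = 0 := by
  have k := h₀.contDiff
  have kp := h₀.contDiff_pd
  have c1 := k.continuous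
  have c2 := h.continuous
  have c3 := k.continuous_fderiv one_ne_zero
  have c4 := h.continuous_fderiv one_ne_zero
  have c5 := hθ.continuous
  have c6 := hθ.continuous_fderiv one_ne_zero
  have cw := continuous_pd h
  have cb := continuous_leraySource k h
  have hV : ContDiff ℝ 1 fun y => v₀ y + v y := k.add h
  have hdV := divergence_add k h h₀.div_eq_zero hd
  have hφ : ContDiff ℝ 1 fun y => θ y • v₀ y := hθ.smul k
  have hφc : HasCompactSupport fun y => θ y • v₀ y := hc.smul_right
  have cφ := continuous_pd hφ
  have cφ0 := hφ.continuous
  have hg : ContDiff ℝ 1 fun y => θ y * inner ℝ (v y) (v₀ y) := hθ.mul (h.inner ℝ k)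
  have hgc : HasCompactSupport fun y => θ y * inner ℝ (v y) (v₀ y) := hc.mul_right
  have cg := hg.continuous_fderiv one_ne_zero
  have cg0 := hg.continuous
  have hg' : ContDiff ℝ 1 fun y => θ y * inner ℝ (v₀ y) (v₀ y) := hθ.mul (k.inner ℝ k)
  have hgc' : HasCompactSupport fun y => θ y * inner ℝ (v₀ y) (v₀ y) := hc.mul_right
  have cg' := hg'.continuous_fderiv one_ne_zero
  have hgi : ∀ i, ContDiff ℝ 1 fun y => θ y * inner ℝ (v y) (pd i v₀ y) :=
    fun i => hθ.mul (h.inner ℝ (kp i))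
  have hgci : ∀ i, HasCompactSupport fun y => θ y * inner ℝ (v y) (pd i v₀ y) :=
    fun i => hc.mul_right
  have cgi := fun i => (hgi i).continuous_fderiv one_ne_zero
  -- the system tested with `θ v₀`, and the fluxes that move the derivatives onto `v₀`
  have e1 := hs.weak_identity k h hq hφ hφc
  have e2 := integral_fderiv_add_mul_divergence hg hgc contDiff_id
  have e3 := integral_fderiv_eq_zero hg hgc hV hdV
  have e4 := integral_fderiv_eq_zero hg' hgc' hV hdV
  have e5 := fun i => integral_fderiv_eq_zero (a := fun _ => e i) (hgi i) (hgci i)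
    contDiff_const (divergence_const _)
  have i1 : Integrable fun y => (∑ i, inner ℝ (pd i v y) (pd i (fun y => θ y • v₀ y) y))
      + inner ℝ (leraySource v₀ v y) (θ y • v₀ y)
      - q y * divergence (fun y => θ y • v₀ y) y := by
    refine Integrable.sub (integrable_of_tsupport (by fun_prop) hc fun y h1 h2 => ?_)
      (integrable_mul_divergence hφ hφc hq)
    simp [pd, fderiv_smul_field hθ k, h1, h2]
  have i2 : Integrable fun y => fderiv ℝ (fun y => θ y * inner ℝ (v y) (v₀ y)) y y
      + (θ y * inner ℝ (v y) (v₀ y)) * 2 := by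
    refine integrable_of_tsupport (by fun_prop) hc fun y h1 h2 => ?_
    simp [fderiv_mul_inner hθ h k, h1, h2]
  have i3 : Integrable fun y => fderiv ℝ (fun y => θ y * inner ℝ (v y) (v₀ y)) y (v₀ y + v y) := by
    refine integrable_of_tsupport (by fun_prop) hc fun y h1 h2 => ?_
    rw [fderiv_mul_inner hθ h k]
    simp [h1, h2]
  have i4 : Integrable fun y => fderiv ℝ (fun y => θ y * inner ℝ (v₀ y) (v₀ y)) y (v₀ y + v y) := by
    refine integrable_of_tsupport (by fun_prop) hc fun y h1 h2 => ?_
    rw [fderiv_mul_inner hθ k k]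
    simp [h1, h2]
  have i5 : ∀ i, Integrable fun y => fderiv ℝ (fun y => θ y * inner ℝ (v y) (pd i v₀ y)) y (e i) := by
    intro i
    have := cgi i
    refine integrable_of_tsupport (by fun_prop) hc fun y h1 h2 => ?_
    rw [fderiv_mul_inner hθ h (kp i)]
    simp [h1, h2]
  have e2' : ∫ y, (fderiv ℝ (fun y => θ y * inner ℝ (v y) (v₀ y)) y y
      + (θ y * inner ℝ (v y) (v₀ y)) * 2) = 0 := by
    rw [← e2]
    congr 1
    funext y
    rw [show divergence id y = 2 from divergence_id y]
    rfl
  have key : ∀ y, θ y * profileDensity v₀ v y + fderiv ℝ θ y (profileFlux v₀ v q y) =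
      ((∑ i, inner ℝ (pd i v y) (pd i (fun y => θ y • v₀ y) y))
      + inner ℝ (leraySource v₀ v y) (θ y • v₀ y)
      - q y * divergence (fun y => θ y • v₀ y) y) +
      (1 / 2) * (fderiv ℝ (fun y => θ y * inner ℝ (v y) (v₀ y)) y y
      + (θ y * inner ℝ (v y) (v₀ y)) * 2)
      + 1 * fderiv ℝ (fun y => θ y * inner ℝ (v y) (pd 0 v₀ y)) y (e 0)
      + 1 * fderiv ℝ (fun y => θ y * inner ℝ (v y) (pd 1 v₀ y)) y (e 1)
      + (-1) * fderiv ℝ (fun y => θ y * inner ℝ (v y) (v₀ y)) y (v₀ y + v y)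
      + (-1 / 2) * fderiv ℝ (fun y => θ y * inner ℝ (v₀ y) (v₀ y)) y (v₀ y + v y) := by
    intro y
    have hp := congrArg (fun w => (inner ℝ w (v y) : ℝ)) (h₀.profile_eq y)
    simp only [Fin.sum_univ_two, inner_add_left, inner_smul_left, conj_trivial] at hp
    simp only [pd] at hp
    simp only [fderiv_mul_inner hθ h k, fderiv_mul_inner hθ k k, fderiv_mul_inner hθ h (kp _)]
    simp only [pd, fderiv_smul_field hθ k, divergence_smul hθ k h₀.div_eq_zero,
      profileDensity, profileFlux, leraySource, Fin.sum_univ_two, inner_add_left,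
      inner_sub_left, inner_add_right, inner_smul_left, inner_smul_right, map_add, map_sub,
      map_smul, smul_eq_mul, inner_self_sq, conj_trivial]
    simp only [real_inner_comm (v y)] at hp ⊢
    linear_combination (-(θ y) / 2) * hp
  simp_rw [key]
  exact (integral_add_mul_eq_zero (integral_add_mul_eq_zero (integral_add_mul_eq_zero
    (integral_add_mul_eq_zero (integral_add_mul_eq_zero ⟨i1, e1⟩ ⟨i2, e2'⟩ _) ⟨i5 0, e5 0⟩ _)
    ⟨i5 1, e5 1⟩ _) ⟨i3, e3⟩ _) ⟨i4, e4⟩ _).2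

end

/-! ### Global energy identities -/

/-- The quantitative form of membership in the class `X`. -/
structure IsDecaying (v : Plane → Plane) (m : ℝ) : Prop where
  contDiff : ContDiff ℝ 1 v
  div_eq_zero : ∀ y, divergence v y = 0
  decay : ∀ y, ‖v y‖ ≤ m * ((1 + ‖y‖) ^ 2)⁻¹
  fderiv_decay : ∀ y, ‖fderiv ℝ v y‖ ≤ m * ((1 + ‖y‖) ^ 2)⁻¹

lemma MemX.exists_isDecaying {v : Plane → Plane} (h : MemX v) : ∃ m, IsDecaying v m := by
  obtain ⟨h1, h2, M, hM⟩ := h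
  have key : ∀ (y : Plane) (t : ℝ), 0 ≤ t → (1 + ‖y‖ ^ 2) * t ≤ M →
      t ≤ 2 * M * ((1 + ‖y‖) ^ 2)⁻¹ := by
    intro y t ht hle
    rw [← div_eq_mul_inv, le_div_iff₀ (by positivity)]
    nlinarith [sq_nonneg (1 - ‖y‖)]
  exact ⟨2 * M, h1, h2, fun y => key y _ (norm_nonneg _) (hM y).1,
    fun y => key y _ (norm_nonneg _) (hM y).2⟩

section
variable {v₀ v : Plane → Plane} {q : Plane → ℝ} {c m : ℝ}

lemma IsDecaying.nonneg (h : IsDecaying v m) : 0 ≤ m := by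
  have := (norm_nonneg _).trans (h.decay 0)
  simpa using this

lemma IsProfile.nonneg (h : IsProfile v₀ c) : 0 ≤ c := by
  have := h.decay 0
  simp only [norm_zero, add_zero, one_mul] at this
  exact (norm_nonneg _).trans this

lemma IsProfile.norm_le (h : IsProfile v₀ c) (y : Plane) : ‖v₀ y‖ ≤ c * (1 + ‖y‖)⁻¹ := by
  rw [← div_eq_mul_inv, le_div_iff₀ (by positivity), mul_comm]
  exact h.decay y

lemma IsProfile.norm_fderiv_le (h : IsProfile v₀ c) (y : Plane) :
    ‖fderiv ℝ v₀ y‖ ≤ c * (1 + ‖y‖)⁻¹ := by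
  rw [← div_eq_mul_inv, le_div_iff₀ (by positivity), mul_comm]
  exact h.fderiv_decay y

lemma norm_add_field_le (h₀ : IsProfile v₀ c) (h : IsDecaying v m) (y : Plane) :
    ‖v₀ y + v y‖ ≤ (c + m) * (1 + ‖y‖)⁻¹ := by
  refine (norm_add_le _ _).trans ?_
  rw [add_mul]
  refine add_le_add (h₀.norm_le y) ((h.decay y).trans ?_)
  have := h.nonneg
  gcongr
  exact le_self_pow₀ (by linarith [norm_nonneg y]) (by norm_num)

lemma abs_inner_pd_le (a b : Plane → Plane) (i : Fin 2) (y : Plane) :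
    |inner ℝ (pd i a y) (b y)| ≤ ‖fderiv ℝ a y‖ * ‖b y‖ :=
  (abs_real_inner_le_norm _ _).trans (by gcongr; exact norm_pd_le i a y)

lemma norm_sum_smul_e_le (t : Fin 2 → ℝ) : ‖∑ i, t i • e i‖ ≤ |t 0| + |t 1| := by
  rw [Fin.sum_univ_two]
  refine (norm_add_le _ _).trans ?_
  simp [norm_smul, norm_e]

lemma gradSq_le (v : Plane → Plane) (y : Plane) : gradSq v y ≤ 2 * ‖fderiv ℝ v y‖ ^ 2 := by
  unfold gradSq
  rw [Fin.sum_univ_two]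
  have := pow_le_pow_left₀ (norm_nonneg _) (norm_pd_le 0 v y) 2
  have := pow_le_pow_left₀ (norm_nonneg _) (norm_pd_le 1 v y) 2
  linarith

/-- The pressure is only square integrable, so that its term is kept apart. -/
lemma norm_energyFlux_le (h₀ : IsProfile v₀ c) (h : IsDecaying v m) (y : Plane) :
    ‖energyFlux v₀ v q y‖ ≤ (1 + ‖y‖) * ((3 * m ^ 2 + m ^ 2 * (c + m)) * ((1 + ‖y‖) ^ 4)⁻¹
      + m * |q y| * ((1 + ‖y‖) ^ 3)⁻¹) := by
  have hm := h.nonneg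
  have hc := h₀.nonneg
  have hv := h.decay y
  have hdv := h.fderiv_decay y
  have hV := norm_add_field_le h₀ h y
  set J := 1 + ‖y‖ with hJ
  have hJ1 : 1 ≤ J := by simp [hJ]
  have hJ0 : 0 < J := by linarith
  have hJi : J⁻¹ ≤ 1 := inv_le_one_of_one_le₀ hJ1
  have t1 : ∀ i, |inner ℝ (pd i v y) (v y)| ≤ m ^ 2 * (J ^ 4)⁻¹ := fun i => by
    refine (abs_inner_pd_le v v i y).trans ?_
    calc ‖fderiv ℝ v y‖ * ‖v y‖ ≤ (m * (J ^ 2)⁻¹) * (m * (J ^ 2)⁻¹) := by gcongr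
      _ = _ := by field_simp
  have t2 : ‖v y‖ ^ 2 ≤ m ^ 2 * (J ^ 4)⁻¹ := by
    calc ‖v y‖ ^ 2 ≤ (m * (J ^ 2)⁻¹) ^ 2 := by gcongr
      _ = _ := by field_simp
  have hP : 0 ≤ m ^ 2 * (J ^ 4)⁻¹ := by positivity
  set P := m ^ 2 * (J ^ 4)⁻¹
  have s1 : ‖∑ i, (inner ℝ (pd i v y) (v y) : ℝ) • e i‖ ≤ 2 * P :=
    (norm_sum_smul_e_le fun i => inner ℝ (pd i v y) (v y)).trans (by linarith [t1 0, t1 1])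
  have s2 : ‖(‖v y‖ ^ 2 / 4) • y‖ ≤ P * J := by
    rw [norm_smul, Real.norm_of_nonneg (by positivity)]
    have : ‖y‖ ≤ J := by simp [hJ]
    exact mul_le_mul (by linarith [sq_nonneg ‖v y‖]) this (norm_nonneg _) hP
  have s3 : ‖(‖v y‖ ^ 2 / 2) • (v₀ y + v y)‖ ≤ P * (c + m) := by
    rw [norm_smul, Real.norm_of_nonneg (by positivity)]
    exact mul_le_mul (by linarith) (hV.trans (mul_le_of_le_one_right (by linarith) hJi))
      (norm_nonneg _) hP
  have s4 : ‖q y • v y‖ ≤ |q y| * (m * (J ^ 2)⁻¹) := by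
    rw [norm_smul, Real.norm_eq_abs]; gcongr
  have e1 : J * (m * |q y| * (J ^ 3)⁻¹) = |q y| * (m * (J ^ 2)⁻¹) := by field_simp
  have e2 : (3 * m ^ 2 + m ^ 2 * (c + m)) * (J ^ 4)⁻¹ = 3 * P + P * (c + m) := by ring
  rw [mul_add, e1, e2]
  have s5 : 2 * P + P * J + P * (c + m) ≤ J * (3 * P + P * (c + m)) := by
    have : 0 ≤ P * (c + m) := by positivity
    nlinarith
  unfold energyFlux
  refine (norm_sub_le _ _).trans (add_le_add ?_ s4)
  refine ((norm_sub_le _ _).trans (add_le_add ((norm_add_le _ _).trans (add_le_add s1 s2)) s3)).trans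
    s5

lemma abs_energyDensity_le (h₀ : IsProfile v₀ c) (h : IsDecaying v m) (y : Plane) :
    |energyDensity v₀ v y| ≤ (2 * m ^ 2 + c * (c + m) * m) * ((1 + ‖y‖) ^ 4)⁻¹ := by
  have hm := h.nonneg
  have hc := h₀.nonneg
  have hv := h.decay y
  have hdv := h.fderiv_decay y
  have hd0 := h₀.norm_fderiv_le y
  have hV := norm_add_field_le h₀ h y
  set J := 1 + ‖y‖ with hJ
  have hJ0 : 0 < J := by positivity
  have hcm : 0 ≤ c + m := add_nonneg hc hm
  have h1 : gradSq v y ≤ 2 * m ^ 2 * (J ^ 4)⁻¹ := by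
    refine (gradSq_le v y).trans ?_
    calc 2 * ‖fderiv ℝ v y‖ ^ 2 ≤ 2 * (m * (J ^ 2)⁻¹) ^ 2 := by gcongr
      _ = _ := by field_simp
  have h2 : |inner ℝ (fderiv ℝ v₀ y (v₀ y + v y)) (v y)| ≤ c * (c + m) * m * (J ^ 4)⁻¹ := by
    refine (abs_real_inner_le_norm _ _).trans ?_
    calc ‖fderiv ℝ v₀ y (v₀ y + v y)‖ * ‖v y‖
        ≤ (‖fderiv ℝ v₀ y‖ * ‖v₀ y + v y‖) * ‖v y‖ := by
          gcongr; exact ContinuousLinearMap.le_opNorm _ _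
      _ ≤ ((c * J⁻¹) * ((c + m) * J⁻¹)) * (m * (J ^ 2)⁻¹) := by gcongr
      _ = _ := by field_simp
  unfold energyDensity
  refine (abs_add_le _ _).trans ?_
  rw [abs_of_nonneg (gradSq_nonneg v y), add_mul]
  exact add_le_add h1 h2

lemma memLp_two_one_add_norm_rpow {p : ℝ} (hp : 1 < p) :
    MemLp (fun y : Plane => (1 + ‖y‖) ^ (-p)) 2 := by
  have hc : Continuous fun y : Plane => (1 + ‖y‖) ^ (-p) :=
    (by fun_prop : Continuous fun y : Plane => 1 + ‖y‖).rpow_const fun y => Or.inl (by positivity)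
  rw [memLp_two_iff_integrable_sq hc.aestronglyMeasurable]
  refine (integrable_one_add_norm_rpow (p := 2 * p) (by linarith)).congr (ae_of_all _ fun y => ?_)
  simp only
  rw [← Real.rpow_natCast, ← Real.rpow_mul (by positivity)]
  congr 1
  push_cast
  ring

lemma rpow_mul_inv_pow {J : ℝ} (hJ : 0 < J) (s : ℝ) (k : ℕ) :
    J ^ s * (J ^ k)⁻¹ = J ^ (-(k - s)) := by
  rw [neg_sub, Real.rpow_sub hJ, Real.rpow_natCast, div_eq_mul_inv]

/-- Integrability of the majorant of flux terms for weights of growth `|y|^σ`. -/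
lemma integrable_flux_majorant (hq : MemLp q 2) (C d : ℝ) {σ : ℝ} {k l : ℕ} (h1 : σ + 2 < k)
    (h2 : σ + 1 < l) :
    Integrable fun y : Plane => (1 + ‖y‖) ^ σ * (C * ((1 + ‖y‖) ^ k)⁻¹
      + d * |q y| * ((1 + ‖y‖) ^ l)⁻¹) := by
  have i1 := (integrable_one_add_norm_rpow (p := k - σ) (by linarith)).const_mul C
  have i2 : Integrable fun y => |q y| * (1 + ‖y‖) ^ (-((l : ℝ) - σ)) :=
    hq.norm.integrable_mul (memLp_two_one_add_norm_rpow (p := l - σ) (by linarith))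
  refine (i1.add (i2.const_mul d)).congr (ae_of_all _ fun y => ?_)
  simp only [Pi.add_apply]
  rw [← rpow_mul_inv_pow (by positivity), ← rpow_mul_inv_pow (by positivity)]
  ring

lemma continuous_energyDensity (h₀ : ContDiff ℝ 1 v₀) (h : ContDiff ℝ 1 v) :
    Continuous (energyDensity v₀ v) := by
  have c1 := h₀.continuous
  have c2 := h.continuous
  have c3 := h₀.continuous_fderiv one_ne_zero
  exact (continuous_gradSq h).add ((c3.clm_apply (c1.add c2)).inner c2)

lemma aestronglyMeasurable_energyFlux (h₀ : ContDiff ℝ 1 v₀) (h : ContDiff ℝ 1 v)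
    (hq : AEStronglyMeasurable q) : AEStronglyMeasurable (energyFlux v₀ v q) := by
  have c1 := h₀.continuous
  have c2 := h.continuous
  have cw := continuous_pd h
  refine AEStronglyMeasurable.sub (Continuous.aestronglyMeasurable ?_)
    (hq.smul c2.aestronglyMeasurable)
  fun_prop

/-- The weighted energy identity for weights of growth `|y|^σ` with `σ < 2`. -/
lemma weighted_energy_identity (hs : IsPerturbedLeraySolution v₀ v q) (h₀ : IsProfile v₀ c)
    (h : IsDecaying v m) (hq : MemLp q 2) {ψ : Plane → ℝ} (hψ : ContDiff ℝ 1 ψ) {σ : ℝ}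
    (hσ : σ < 2) (hψ0 : ∀ y, |ψ y| ≤ (1 + ‖y‖) ^ σ)
    (hψ1 : ∀ y, (1 + ‖y‖) * ‖fderiv ℝ ψ y‖ ≤ 2 * (1 + ‖y‖) ^ σ) :
    Integrable (fun y => ψ y * energyDensity v₀ v y + fderiv ℝ ψ y (energyFlux v₀ v q y)) ∧
      ∫ y, (ψ y * energyDensity v₀ v y + fderiv ℝ ψ y (energyFlux v₀ v q y)) = 0 := by
  have hm := h.nonneg
  have hc := h₀.nonneg
  set C := 3 * m ^ 2 + m ^ 2 * (c + m)
  set D := 2 * m ^ 2 + c * (c + m) * m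
  set f : Plane → ℝ := fun y => (1 + ‖y‖) ^ σ * (C * ((1 + ‖y‖) ^ 4)⁻¹
      + m * |q y| * ((1 + ‖y‖) ^ 3)⁻¹) with hf
  have hfi : Integrable f := integrable_flux_majorant hq C m (by norm_num; linarith)
    (by norm_num; linarith)
  set g : Plane → ℝ := fun y => (1 + ‖y‖) ^ σ * (D * ((1 + ‖y‖) ^ 4)⁻¹
      + 0 * |q y| * ((1 + ‖y‖) ^ 3)⁻¹) with hg
  have hgi : Integrable g := integrable_flux_majorant hq D 0 (by norm_num; linarith)
    (by norm_num; linarith)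
  have hF := aestronglyMeasurable_energyFlux h₀.contDiff h.contDiff hq.1
  have cE := continuous_energyDensity h₀.contDiff h.contDiff
  have b1 : ∀ y, ‖fderiv ℝ ψ y (energyFlux v₀ v q y)‖ ≤ 2 * f y := by
    intro y
    have hfl := norm_energyFlux_le (q := q) h₀ h y
    calc _ ≤ ‖fderiv ℝ ψ y‖ * ‖energyFlux v₀ v q y‖ := ContinuousLinearMap.le_opNorm _ _
      _ ≤ ‖fderiv ℝ ψ y‖ * ((1 + ‖y‖) * (C * ((1 + ‖y‖) ^ 4)⁻¹
          + m * |q y| * ((1 + ‖y‖) ^ 3)⁻¹)) := by gcongr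
      _ = ((1 + ‖y‖) * ‖fderiv ℝ ψ y‖) * (C * ((1 + ‖y‖) ^ 4)⁻¹
          + m * |q y| * ((1 + ‖y‖) ^ 3)⁻¹) := by ring
      _ ≤ (2 * (1 + ‖y‖) ^ σ) * (C * ((1 + ‖y‖) ^ 4)⁻¹
          + m * |q y| * ((1 + ‖y‖) ^ 3)⁻¹) :=
          mul_le_mul_of_nonneg_right (hψ1 y) (by positivity)
      _ = _ := by rw [hf]; ring
  have b2 : ∀ y, ‖ψ y * energyDensity v₀ v y‖ ≤ g y := by
    intro y
    rw [norm_mul]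
    calc ‖ψ y‖ * ‖energyDensity v₀ v y‖ ≤ (1 + ‖y‖) ^ σ * (D * ((1 + ‖y‖) ^ 4)⁻¹) :=
          mul_le_mul (hψ0 y) (abs_energyDensity_le h₀ h y) (norm_nonneg _) (by positivity)
      _ = g y := by rw [hg]; ring
  have m1 : AEStronglyMeasurable fun y => fderiv ℝ ψ y (energyFlux v₀ v q y) :=
    isBoundedBilinearMap_apply.continuous.comp_aestronglyMeasurable₂
      (hψ.continuous_fderiv one_ne_zero).aestronglyMeasurable hF
  have i1 : Integrable fun y => fderiv ℝ ψ y (energyFlux v₀ v q y) :=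
    (hfi.const_mul 2).mono' m1 (ae_of_all _ b1)
  have i2 : Integrable fun y => ψ y * energyDensity v₀ v y :=
    hgi.mono' (hψ.continuous.mul cE).aestronglyMeasurable (ae_of_all _ b2)
  refine ⟨i2.add i1, ?_⟩
  refine integral_eq_zero_of_cutoff (i2.add i1) hfi
    (hψ.continuous.aestronglyMeasurable.smul hF) (fun y => ?_) fun n => ?_
  · rw [Pi.smul_apply', norm_smul]
    calc ‖ψ y‖ * ‖energyFlux v₀ v q y‖ ≤ (1 + ‖y‖) ^ σ * ((1 + ‖y‖) * (C * ((1 + ‖y‖) ^ 4)⁻¹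
          + m * |q y| * ((1 + ‖y‖) ^ 3)⁻¹)) :=
          mul_le_mul (hψ0 y) (norm_energyFlux_le h₀ h y) (norm_nonneg _) (by positivity)
      _ = _ := by rw [hf]; ring
  · have hχ : ContDiff ℝ 1 (chi n) := contDiff_chi n
    rw [← local_energy_identity hs h₀ h.contDiff h.div_eq_zero hq (hχ.mul hψ)
      ((hasCompactSupport_chi n).mul_right)]
    congr 1
    funext y
    rw [fderiv_fun_mul (hχ.differentiable one_ne_zero y) (hψ.differentiable one_ne_zero y)]
    simp
    ring

lemma integral_energyDensity (hs : IsPerturbedLeraySolution v₀ v q) (h₀ : IsProfile v₀ c)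
    (h : IsDecaying v m) (hq : MemLp q 2) : ∫ y, energyDensity v₀ v y = 0 := by
  have := (weighted_energy_identity hs h₀ h hq (ψ := fun _ => 1) (σ := 0) contDiff_const
    (by norm_num) (by simp) (by simp)).2
  simpa using this

lemma integral_profileDensity (hs : IsPerturbedLeraySolution v₀ v q) (h₀ : IsProfile v₀ c)
    (h : IsDecaying v m) (hq : MemLp q 2) :
    Integrable (profileDensity v₀ v) ∧ ∫ y, profileDensity v₀ v y = 0 := by
  have hm := h.nonneg
  have hc := h₀.nonneg
  have c1 := h₀.contDiff.continuous
  have c2 := h.contDiff.continuous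
  have c3 := h₀.contDiff.continuous_fderiv one_ne_zero
  have cw := continuous_pd h.contDiff
  have cw0 := continuous_pd h₀.contDiff
  set C := 4 * (m * c) + (m * c + c ^ 2) * (c + m) + m * c
  have hC : 0 ≤ C := by positivity
  have hfi : Integrable fun y : Plane => (1 + ‖y‖) ^ (0 : ℝ) * (C * ((1 + ‖y‖) ^ 3)⁻¹
      + c * |q y| * ((1 + ‖y‖) ^ 2)⁻¹) :=
    integrable_flux_majorant hq C c (by norm_num) (by norm_num)
  simp only [Real.rpow_zero, one_mul] at hfi
  have hb : ∀ y, ‖profileFlux v₀ v q y‖ ≤ (1 + ‖y‖) * (C * ((1 + ‖y‖) ^ 3)⁻¹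
      + c * |q y| * ((1 + ‖y‖) ^ 2)⁻¹) ∧ |profileDensity v₀ v y| ≤
      (4 * (m * c) + c * (c + m) * m) * ((1 + ‖y‖) ^ 3)⁻¹ := by
    intro y
    have hv := h.decay y
    have hdv := h.fderiv_decay y
    have hv0 := h₀.norm_le y
    have hd0 := h₀.norm_fderiv_le y
    have hV := norm_add_field_le h₀ h y
    set J := 1 + ‖y‖ with hJ
    have hJ1 : 1 ≤ J := by simp [hJ]
    have hJ0 : 0 < J := by linarith
    have hJi : J⁻¹ ≤ 1 := inv_le_one_of_one_le₀ hJ1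
    set Q := (J ^ 3)⁻¹ with hQ
    have hQ0 : 0 ≤ Q := by positivity
    have e0 : (m * (J ^ 2)⁻¹) * (c * J⁻¹) = m * c * Q := by rw [hQ]; field_simp
    have t1 : ∀ i, |inner ℝ (pd i v y) (v₀ y)| ≤ m * c * Q := fun i => by
      refine (abs_inner_pd_le v v₀ i y).trans ?_
      rw [← e0]; gcongr
    have t2 : ∀ i, |inner ℝ (pd i v₀ y) (v y)| ≤ m * c * Q := fun i => by
      refine (abs_inner_pd_le v₀ v i y).trans ?_
      rw [← e0, mul_comm]; gcongr
    have t3 : |inner ℝ (v y) (v₀ y)| ≤ m * c * Q := by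
      refine (abs_real_inner_le_norm _ _).trans ?_
      rw [← e0]; gcongr
    have t4 : ∀ i, |inner ℝ (pd i v y) (pd i v₀ y)| ≤ m * c * Q := fun i => by
      refine (abs_inner_pd_le v (pd i v₀) i y).trans ?_
      rw [← e0]; gcongr
      exact (norm_pd_le i v₀ y).trans hd0
    have hP : 0 ≤ m * c * Q := by positivity
    constructor
    · have s1 : ‖∑ i, (inner ℝ (pd i v y) (v₀ y) + inner ℝ (pd i v₀ y) (v y) : ℝ) • e i‖
          ≤ 4 * (m * c * Q) := by
        refine (norm_sum_smul_e_le fun i => inner ℝ (pd i v y) (v₀ y)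
          + inner ℝ (pd i v₀ y) (v y)).trans ?_
        have a0 := abs_add_le (inner ℝ (pd 0 v y) (v₀ y)) (inner ℝ (pd 0 v₀ y) (v y))
        have a1 := abs_add_le (inner ℝ (pd 1 v y) (v₀ y)) (inner ℝ (pd 1 v₀ y) (v y))
        linarith [t1 0, t1 1, t2 0, t2 1]
      have s2 : ‖((inner ℝ (v y) (v₀ y) : ℝ) / 2) • y‖ ≤ m * c * Q * J := by
        rw [norm_smul, Real.norm_eq_abs, abs_div, abs_two]
        have : ‖y‖ ≤ J := by simp [hJ]
        exact mul_le_mul (by linarith [abs_nonneg (inner ℝ (v y) (v₀ y))]) this (norm_nonneg _) hP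
      have s3 : ‖((inner ℝ (v y) (v₀ y) : ℝ) + ‖v₀ y‖ ^ 2 / 2) • (v₀ y + v y)‖
          ≤ (m * c + c ^ 2) * (c + m) * (J * Q) := by
        rw [norm_smul, Real.norm_eq_abs]
        have a1 : ‖v₀ y‖ ^ 2 ≤ c ^ 2 * (J ^ 2)⁻¹ := by
          calc ‖v₀ y‖ ^ 2 ≤ (c * J⁻¹) ^ 2 := by gcongr
            _ = _ := by field_simp
        have a2 : |(inner ℝ (v y) (v₀ y) : ℝ) + ‖v₀ y‖ ^ 2 / 2| ≤ (m * c + c ^ 2) * (J ^ 2)⁻¹ := by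
          refine (abs_add_le _ _).trans ?_
          rw [abs_of_nonneg (show 0 ≤ ‖v₀ y‖ ^ 2 / 2 by positivity), add_mul]
          have a3 : Q ≤ (J ^ 2)⁻¹ := by
            rw [hQ]; gcongr
            norm_num
          have a4 : m * c * Q ≤ m * c * (J ^ 2)⁻¹ := by gcongr
          have a5 : 0 ≤ c ^ 2 * (J ^ 2)⁻¹ := by positivity
          linarith
        calc _ ≤ ((m * c + c ^ 2) * (J ^ 2)⁻¹) * (c + m) :=
              mul_le_mul a2 (hV.trans (mul_le_of_le_one_right (by linarith) hJi))
                (norm_nonneg _) (by positivity)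
          _ = _ := by rw [hQ]; field_simp
      have s4 : ‖q y • v₀ y‖ ≤ J * (c * |q y| * (J ^ 2)⁻¹) := by
        rw [norm_smul, Real.norm_eq_abs]
        calc |q y| * ‖v₀ y‖ ≤ |q y| * (c * J⁻¹) := by gcongr
          _ = _ := by field_simp
      have s5 : 4 * (m * c * Q) ≤ 4 * (m * c) * (J * Q) := by nlinarith
      unfold profileFlux
      rw [mul_add]
      refine (norm_sub_le _ _).trans (add_le_add ?_ s4)
      refine ((norm_sub_le _ _).trans (add_le_add ((norm_add_le _ _).trans
        (add_le_add s1 s2)) s3)).trans ?_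
      have e3 : J * (C * Q) = 4 * (m * c) * (J * Q) + (m * c + c ^ 2) * (c + m) * (J * Q)
          + m * c * (J * Q) := by ring
      rw [e3]
      nlinarith
    · have h2 : |inner ℝ (fderiv ℝ v₀ y (v₀ y + v y)) (v y)| ≤ c * (c + m) * m * Q := by
        refine (abs_real_inner_le_norm _ _).trans ?_
        calc ‖fderiv ℝ v₀ y (v₀ y + v y)‖ * ‖v y‖
            ≤ (‖fderiv ℝ v₀ y‖ * ‖v₀ y + v y‖) * ‖v y‖ := by
              gcongr; exact ContinuousLinearMap.le_opNorm _ _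
          _ ≤ ((c * J⁻¹) * ((c + m) * 1)) * (m * (J ^ 2)⁻¹) := by
              gcongr
              exact hV.trans (by gcongr)
          _ = _ := by rw [hQ]; field_simp
      unfold profileDensity
      rw [Fin.sum_univ_two, add_mul]
      refine (abs_sub _ _).trans (add_le_add ?_ h2)
      rw [abs_mul, abs_two]
      have := abs_add_le (inner ℝ (pd 0 v y) (pd 0 v₀ y)) (inner ℝ (pd 1 v y) (pd 1 v₀ y))
      linarith [t4 0, t4 1]
  have cD : Continuous (profileDensity v₀ v) := by unfold profileDensity; fun_prop
  have hF : AEStronglyMeasurable (profileFlux v₀ v q) := by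
    refine AEStronglyMeasurable.sub (Continuous.aestronglyMeasurable ?_)
      (hq.1.smul c1.aestronglyMeasurable)
    fun_prop
  have hi : Integrable (profileDensity v₀ v) :=
    ((integrable_inv_one_add_norm_pow (m := 3) (by norm_num)).const_mul _).mono'
      cD.aestronglyMeasurable (ae_of_all _ fun y => (hb y).2)
  refine ⟨hi, integral_eq_zero_of_cutoff hi hfi hF (fun y => (hb y).1) fun n => ?_⟩
  exact local_profile_identity hs h₀ h.contDiff h.div_eq_zero hq (contDiff_chi n)
    (hasCompactSupport_chi n)

lemma IsDecaying.integrable_gradSq (h : IsDecaying v m) : Integrable (gradSq v) := by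
  refine ((integrable_inv_one_add_norm_pow (m := 4) (by norm_num)).const_mul (2 * m ^ 2)).mono'
    (continuous_gradSq h.contDiff).aestronglyMeasurable (ae_of_all _ fun y => ?_)
  rw [Real.norm_of_nonneg (gradSq_nonneg v y)]
  refine (gradSq_le v y).trans ?_
  have := h.nonneg
  calc 2 * ‖fderiv ℝ v y‖ ^ 2 ≤ 2 * (m * ((1 + ‖y‖) ^ 2)⁻¹) ^ 2 := by
        gcongr; exact h.fderiv_decay y
    _ = _ := by field_simp

/-- The Dirichlet energy of `v` is controlled by that of the background profile alone, without any
smallness: the sum of the two energy identities is `∫ |∇v|² = -2 ∫ ∇v : ∇v₀`. -/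
lemma integral_gradSq_le (hs : IsPerturbedLeraySolution v₀ v q) (h₀ : IsProfile v₀ c)
    (h : IsDecaying v m) (hq : MemLp q 2) : ∫ y, gradSq v y ≤ 4 * c := by
  have e1 := integral_energyDensity hs h₀ h hq
  obtain ⟨i2, e2⟩ := integral_profileDensity hs h₀ h hq
  have i1 : Integrable (energyDensity v₀ v) :=
    ((integrable_inv_one_add_norm_pow (m := 4) (by norm_num)).const_mul _).mono'
      (continuous_energyDensity h₀.contDiff h.contDiff).aestronglyMeasurable
      (ae_of_all _ fun y => abs_energyDensity_le h₀ h y)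
  have e3 : ∫ y, (energyDensity v₀ v y + profileDensity v₀ v y) = 0 := by
    rw [integral_add i1 i2, e1, e2, add_zero]
  have i4 := h.integrable_gradSq
  have i5 := h₀.integrable_gradSq
  have hle : ∀ y, (1 / 2) * gradSq v y - 2 * gradSq v₀ y
      ≤ energyDensity v₀ v y + profileDensity v₀ v y := by
    intro y
    have key : ∀ i, -(1 / 4) * ‖pd i v y‖ ^ 2 - ‖pd i v₀ y‖ ^ 2
        ≤ inner ℝ (pd i v y) (pd i v₀ y) := by
      intro i
      have h1 := neg_le_of_abs_le (abs_real_inner_le_norm (pd i v y) (pd i v₀ y))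
      nlinarith [sq_nonneg (‖pd i v y‖ / 2 - ‖pd i v₀ y‖)]
    have k0 := key 0
    have k1 := key 1
    simp only [energyDensity, profileDensity, gradSq, Fin.sum_univ_two]
    linarith
  have := integral_mono ((i4.const_mul _).sub (i5.const_mul _)) (i1.add i2) hle
  simp only [Pi.add_apply, Pi.sub_apply] at this
  rw [e3, integral_sub (i4.const_mul _) (i5.const_mul _), integral_const_mul,
    integral_const_mul] at this
  linarith [h₀.integral_gradSq_le]

end

/-! ### Ladyzhenskaya's inequality -/

/-- The constant in the Gagliardo–Nirenberg–Sobolev inequality `‖f‖₂ ≤ C ‖∇f‖₁` in the plane,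
squared. -/
def sobolevConst : ℝ := lintegralPowLePowLIntegralFDerivConst (volume : Measure Plane) 2

lemma sobolevConst_nonneg : 0 ≤ sobolevConst := NNReal.coe_nonneg _

/-- The Gagliardo–Nirenberg–Sobolev inequality `‖f‖₂² ≤ C ‖∇f‖₁²` in the plane. -/
lemma integral_sq_le_of_compact {f : Plane → ℝ} (hf : ContDiff ℝ 1 f) (hc : HasCompactSupport f) :
    ∫ y, f y ^ 2 ≤ sobolevConst * (∫ y, ‖fderiv ℝ f y‖) ^ 2 := by
  have hp : Real.HolderConjugate (Module.finrank ℝ Plane) 2 := by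
    rw [finrank_euclideanSpace, Fintype.card_fin]
    exact_mod_cast Real.HolderConjugate.two_two
  have h := lintegral_pow_le_pow_lintegral_fderiv (volume : Measure Plane) hf hc hp
  have hcf : Continuous (fderiv ℝ f) := hf.continuous_fderiv one_ne_zero
  have i1 : Integrable fun y => ‖fderiv ℝ f y‖ :=
    (hcf.integrable_of_hasCompactSupport (hc.fderiv (𝕜 := ℝ))).norm
  have i2 : Integrable fun y => f y ^ 2 := by
    refine (hf.continuous.pow 2).integrable_of_hasCompactSupport
      (HasCompactSupport.intro hc.isCompact fun y hy => ?_)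
    simp [image_eq_zero_of_notMem_tsupport hy]
  have e1 : ENNReal.ofReal (∫ y, f y ^ 2) = ∫⁻ y, ‖f y‖ₑ ^ (2 : ℝ) := by
    rw [ofReal_integral_eq_lintegral_ofReal i2 (ae_of_all _ fun y => sq_nonneg _)]
    congr 1
    funext y
    rw [← sq_abs, ENNReal.ofReal_pow (abs_nonneg _), ← Real.norm_eq_abs, ofReal_norm]
    norm_cast
  have e2 : ENNReal.ofReal (∫ y, ‖fderiv ℝ f y‖) = ∫⁻ y, ‖fderiv ℝ f y‖ₑ := by
    rw [ofReal_integral_eq_lintegral_ofReal i1 (ae_of_all _ fun y => norm_nonneg _)]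
    simp_rw [ofReal_norm]
  have hI : 0 ≤ ∫ y, ‖fderiv ℝ f y‖ := integral_nonneg fun y => norm_nonneg _
  rw [← e1, ← e2, ENNReal.ofReal_rpow_of_nonneg hI (by norm_num), ← ENNReal.ofReal_coe_nnreal,
    ← ENNReal.ofReal_mul (NNReal.coe_nonneg _),
    ENNReal.ofReal_le_ofReal_iff (by positivity)] at h
  simpa [sobolevConst] using h

lemma integral_sq_le {f : Plane → ℝ} (hf : ContDiff ℝ 1 f) (h1 : Integrable f)
    (h2 : Integrable fun y => f y ^ 2) (h3 : Integrable fun y => ‖fderiv ℝ f y‖) :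
    ∫ y, f y ^ 2 ≤ sobolevConst * (∫ y, ‖fderiv ℝ f y‖) ^ 2 := by
  obtain ⟨C, hC0, hC⟩ := exists_fderiv_chi_le
  have hχ : ∀ n, ContDiff ℝ 1 (chi n) := fun n => contDiff_chi n
  have hg : ∀ n, ContDiff ℝ 1 fun y => chi n y * f y := fun n => (hχ n).mul hf
  have hn := fun n => integral_sq_le_of_compact (hg n) ((hasCompactSupport_chi n).mul_right)
  have hev : ∀ y, ∀ᶠ n in atTop, (fun y => chi n y * f y) =ᶠ[𝓝 y] f := fun y => by
    filter_upwards [chi_eventually_eq_one y] with n hn'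
    filter_upwards [hn'] with z hz
    rw [hz, one_mul]
  have t1 : Tendsto (fun n => ∫ y, (chi n y * f y) ^ 2) atTop (𝓝 (∫ y, f y ^ 2)) := by
    refine tendsto_integral_of_dominated_convergence (fun y => f y ^ 2)
      (fun n => ((hg n).continuous.pow 2).aestronglyMeasurable) h2 (fun n => ae_of_all _ fun y => ?_)
      (ae_of_all _ fun y => ?_)
    · rw [Real.norm_of_nonneg (sq_nonneg _), mul_pow]
      exact mul_le_of_le_one_left (sq_nonneg _) (pow_le_one₀ (chi_nonneg n y) (chi_le_one n y))
    · refine tendsto_const_nhds.congr' ?_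
      filter_upwards [hev y] with n hn'
      exact congrArg (· ^ 2) hn'.self_of_nhds.symm
  have t2 : Tendsto (fun n => ∫ y, ‖fderiv ℝ (fun y => chi n y * f y) y‖) atTop
      (𝓝 (∫ y, ‖fderiv ℝ f y‖)) := by
    refine tendsto_integral_of_dominated_convergence (fun y => ‖fderiv ℝ f y‖ + C * ‖f y‖)
      (fun n => ((hg n).continuous_fderiv one_ne_zero).norm.aestronglyMeasurable)
      (h3.add (h1.norm.const_mul C)) (fun n => ae_of_all _ fun y => ?_) (ae_of_all _ fun y => ?_)
    · rw [norm_norm, fderiv_fun_mul ((hχ n).differentiable one_ne_zero y)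
        (hf.differentiable one_ne_zero y)]
      refine (norm_add_le _ _).trans ?_
      rw [norm_smul, norm_smul]
      refine add_le_add (mul_le_of_le_one_left (norm_nonneg _) (norm_chi_le n y)) ?_
      rw [mul_comm]
      refine mul_le_mul_of_nonneg_right ?_ (norm_nonneg _)
      exact (le_mul_of_one_le_left (norm_nonneg _) (by linarith [norm_nonneg y])).trans (hC n y)
    · refine tendsto_const_nhds.congr' ?_
      filter_upwards [hev y] with n hn'
      rw [hn'.fderiv_eq]
  exact le_of_tendsto_of_tendsto' t1 ((t2.pow 2).const_mul _) hn

lemma norm_fderiv_normSq_le {v : Plane → Plane} (hv : ContDiff ℝ 1 v) (y : Plane) :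
    ‖fderiv ℝ (fun y => ‖v y‖ ^ 2) y‖ ≤ 2 * (‖v y‖ * √(gradSq v y)) := by
  refine ContinuousLinearMap.opNorm_le_bound _ (by positivity) fun h => ?_
  have hd := hv.differentiable one_ne_zero y
  have e1 : (fun y => ‖v y‖ ^ 2) = fun y => (inner ℝ (v y) (v y) : ℝ) := by
    funext z; rw [real_inner_self_eq_norm_sq]
  rw [e1, fderiv_inner_apply ℝ hd hd, real_inner_comm (v y) (fderiv ℝ v y h), ← two_mul, norm_mul,
    Real.norm_two, mul_assoc]
  gcongr
  refine (norm_inner_le_norm _ _).trans ?_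
  rw [mul_assoc]
  gcongr
  have := Real.sqrt_le_sqrt (norm_fderiv_apply_sq_le v y h)
  rw [Real.sqrt_mul (gradSq_nonneg v y),
    Real.sqrt_sq (norm_nonneg _), Real.sqrt_sq (norm_nonneg _)] at this
  exact this

section
variable {v : Plane → Plane} {m : ℝ}

lemma IsDecaying.integrable_norm_pow (h : IsDecaying v m) {k : ℕ} (hk : 2 ≤ k) :
    Integrable fun y => ‖v y‖ ^ k := by
  refine ((integrable_inv_one_add_norm_pow (m := 2 * k) (by omega)).const_mul (m ^ k)).mono'
    (h.contDiff.continuous.norm.pow k).aestronglyMeasurable (ae_of_all _ fun y => ?_)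
  rw [Real.norm_of_nonneg (by positivity), pow_mul, ← inv_pow, ← mul_pow]
  exact pow_le_pow_left₀ (norm_nonneg _) (h.decay y) k

lemma memLp_sqrt_gradSq (hv : ContDiff ℝ 1 v) (h : Integrable (gradSq v)) :
    MemLp (fun y => √(gradSq v y)) 2 := by
  rw [memLp_two_iff_integrable_sq (continuous_gradSq hv).sqrt.aestronglyMeasurable]
  simpa only [Real.sq_sqrt (gradSq_nonneg v _)] using h

lemma memLp_norm (hv : Continuous v) (h : Integrable fun y => ‖v y‖ ^ 2) :
    MemLp (fun y => ‖v y‖) 2 := by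
  rwa [memLp_two_iff_integrable_sq hv.norm.aestronglyMeasurable]

/-- **Ladyzhenskaya's inequality** `‖v‖₄⁴ ≤ C ‖v‖₂² ‖∇v‖₂²`: the Sobolev inequality applied to
`|v|²`. -/
lemma IsDecaying.integral_norm_pow_four_le (h : IsDecaying v m) :
    ∫ y, ‖v y‖ ^ 4 ≤ 4 * sobolevConst * ((∫ y, ‖v y‖ ^ 2) * ∫ y, gradSq v y) := by
  have h2 := h.integrable_norm_pow (k := 2) le_rfl
  have h4 := h.integrable_norm_pow (k := 4) (by norm_num)
  have hf : ContDiff ℝ 1 fun y => ‖v y‖ ^ 2 := h.contDiff.norm_sq ℝ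
  have m1 := memLp_norm h.contDiff.continuous h2
  have m2 := memLp_sqrt_gradSq h.contDiff h.integrable_gradSq
  have i3 : Integrable fun y => ‖v y‖ * √(gradSq v y) := m1.integrable_mul m2
  have i4 : Integrable fun y => ‖fderiv ℝ (fun y => ‖v y‖ ^ 2) y‖ :=
    (i3.const_mul 2).mono' (hf.continuous_fderiv one_ne_zero).norm.aestronglyMeasurable
      (ae_of_all _ fun y => by rw [norm_norm]; exact norm_fderiv_normSq_le h.contDiff y)
  have e4 : ∀ y, ‖v y‖ ^ 4 = (‖v y‖ ^ 2) ^ 2 := fun y => by ring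
  simp_rw [e4] at h4 ⊢
  have hS := integral_sq_le hf h2 h4 i4
  have hle : ∫ y, ‖fderiv ℝ (fun y => ‖v y‖ ^ 2) y‖ ≤ 2 * ∫ y, ‖v y‖ * √(gradSq v y) := by
    rw [← integral_const_mul]
    exact integral_mono i4 (i3.const_mul 2) (norm_fderiv_normSq_le h.contDiff)
  have hcs := integral_mul_sq_le m1 m2
  simp only [Real.sq_sqrt (gradSq_nonneg v _)] at hcs
  calc _ ≤ _ := hS
    _ ≤ sobolevConst * (2 * ∫ y, ‖v y‖ * √(gradSq v y)) ^ 2 := by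
      have := sobolevConst_nonneg
      gcongr
    _ = 4 * sobolevConst * (∫ y, ‖v y‖ * √(gradSq v y)) ^ 2 := by ring
    _ ≤ _ := by
      have := sobolevConst_nonneg
      gcongr

end

/-! ### Gradients and Laplacians of scalar functions -/

lemma one_le_smooth : (1 : WithTop ℕ∞) ≤ ((⊤ : ℕ∞) : WithTop ℕ∞) := by exact_mod_cast le_top

lemma two_le_smooth : (2 : WithTop ℕ∞) ≤ ((⊤ : ℕ∞) : WithTop ℕ∞) :=
  WithTop.coe_le_coe.2 (le_top : (2 : ℕ∞) ≤ ⊤)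

/-- The gradient field of a scalar function. -/
def grad (η : Plane → ℝ) (y : Plane) : Plane := ∑ i, pd i η y • e i

/-- The Laplacian of a scalar function. -/
def lap (η : Plane → ℝ) (y : Plane) : ℝ := ∑ i, pd i (pd i η) y

lemma grad_apply (η : Plane → ℝ) (y : Plane) (i : Fin 2) : grad η y i = pd i η y := by
  fin_cases i <;> simp [grad, e]

lemma inner_grad (η : Plane → ℝ) (y a : Plane) : inner ℝ a (grad η y) = fderiv ℝ η y a := by
  rw [fderiv_apply_eq_sum, grad, inner_sum]
  refine Finset.sum_congr rfl fun i _ => ?_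
  rw [inner_smul_right, inner_e, smul_eq_mul, mul_comm]

/-- Symmetry of the second derivatives. -/
lemma pd_comm {η : Plane → ℝ} (h : ContDiff ℝ 2 η) (i j : Fin 2) (y : Plane) :
    pd i (pd j η) y = pd j (pd i η) y := by
  have hd : DifferentiableAt ℝ (fderiv ℝ η) y :=
    (h.fderiv_right (m := 1) (by norm_num)).differentiable one_ne_zero y
  have key : ∀ i j, pd i (pd j η) y = fderiv ℝ (fderiv ℝ η) y (e i) (e j) := by
    intro i j
    have h1 := (hd.hasFDerivAt.clm_apply (hasFDerivAt_const (e j) y)).fderiv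
    change fderiv ℝ (fun z => fderiv ℝ η z (e j)) y (e i) = _
    rw [h1]
    simp
  rw [key, key]
  have hs : IsSymmSndFDerivAt ℝ η y := h.contDiffAt.isSymmSndFDerivAt (by simp)
  exact hs _ _

lemma contDiff_grad {η : Plane → ℝ} {n m : WithTop ℕ∞} (h : ContDiff ℝ n η) (hm : m + 1 ≤ n) :
    ContDiff ℝ m (grad η) :=
  ContDiff.sum fun i _ => (contDiff_pd h hm i).smul contDiff_const

lemma pd_grad {η : Plane → ℝ} (h : ContDiff ℝ 2 η) (i : Fin 2) (y : Plane) :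
    pd i (grad η) y = ∑ j, pd i (pd j η) y • e j := by
  have hd : ∀ j, DifferentiableAt ℝ (pd j η) y := fun j =>
    (contDiff_pd h (m := 1) (by norm_num) j).differentiable one_ne_zero y
  have : HasFDerivAt (grad η) (∑ j, (fderiv ℝ (pd j η) y).smulRight (e j)) y :=
    HasFDerivAt.fun_sum fun j _ => (hd j).hasFDerivAt.smul_const (e j)
  rw [pd, this.fderiv]
  simp [pd]

lemma pd_grad_eq {η : Plane → ℝ} (h : ContDiff ℝ 2 η) (i : Fin 2) :
    pd i (grad η) = grad (pd i η) := by
  funext y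
  rw [pd_grad h, grad]
  exact Finset.sum_congr rfl fun j _ => by rw [pd_comm h]

lemma divergence_grad {η : Plane → ℝ} (h : ContDiff ℝ 2 η) (y : Plane) :
    divergence (grad η) y = lap η y := by
  refine Finset.sum_congr rfl fun i _ => ?_
  change pd i (grad η) y i = _
  rw [pd_grad_eq h, grad_apply, pd_comm h]

lemma hasCompactSupport_grad {η : Plane → ℝ} (hc : HasCompactSupport η) :
    HasCompactSupport (grad η) :=
  HasCompactSupport.intro hc.isCompact fun y hy => by
    simp [grad, pd, fderiv_eq_zero_of_notMem_tsupport hy]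

lemma hasCompactSupport_lap {η : Plane → ℝ} (hc : HasCompactSupport η) :
    HasCompactSupport (lap η) := by
  have h := hasCompactSupport_pd (hasCompactSupport_pd hc 0) 0
  have h' := hasCompactSupport_pd (hasCompactSupport_pd hc 1) 1
  have : lap η = pd 0 (pd 0 η) + pd 1 (pd 1 η) := by funext y; simp [lap]
  rw [this]
  exact h.add h'

lemma contDiff_lap {η : Plane → ℝ} (h : ContDiff ℝ ∞ η) : ContDiff ℝ ∞ (lap η) :=
  ContDiff.sum fun i _ => contDiff_pd (contDiff_pd h (m := ∞) (by simp) i) (by simp) i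

lemma integral_pd_mul {f g : Plane → ℝ} (hf : ContDiff ℝ 1 f) (hg : ContDiff ℝ 1 g)
    (hc : HasCompactSupport f) (i : Fin 2) :
    ∫ y, pd i f y * g y = - ∫ y, f y * pd i g y := by
  have h := integral_pd_eq_zero (hf.mul hg) (hc.mul_right) i
  have e1 : ∀ y, pd i (fun y => f y * g y) y = pd i f y * g y + f y * pd i g y := by
    intro y
    rw [pd, fderiv_fun_mul (hf.differentiable one_ne_zero y) (hg.differentiable one_ne_zero y)]
    simp [pd]
    ring
  simp_rw [e1] at h
  rw [integral_add] at h
  · linarith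
  · exact ((continuous_pd hf i).mul hg.continuous).integrable_of_hasCompactSupport
      ((hasCompactSupport_pd hc i).mul_right)
  · exact (hf.continuous.mul (continuous_pd hg i)).integrable_of_hasCompactSupport hc.mul_right

lemma gradSq_grad {η : Plane → ℝ} (h : ContDiff ℝ 2 η) (y : Plane) :
    gradSq (grad η) y = ∑ i, ∑ j, pd i (pd j η) y * pd i (pd j η) y := by
  refine Finset.sum_congr rfl fun i _ => ?_
  rw [pd_grad_eq h, EuclideanSpace.real_norm_sq_eq]
  refine Finset.sum_congr rfl fun j _ => ?_
  rw [grad_apply, pd_comm h, sq]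

/-- The Hessian and the Laplacian of a test function have the same `L²` norm. -/
lemma integral_gradSq_grad {η : Plane → ℝ} (h : IsTest η) :
    ∫ y, gradSq (grad η) y = ∫ y, lap η y ^ 2 := by
  have t1 := one_le_smooth
  have t2 := two_le_smooth
  have h1 : ∀ j, ContDiff ℝ ∞ (pd j η) := fun j => contDiff_pd h.1 (by simp) j
  have h2 : ∀ i j, ContDiff ℝ ∞ (pd i (pd j η)) := fun i j => contDiff_pd (h1 j) (by simp) i
  have h3 : ∀ i j k, ContDiff ℝ ∞ (pd i (pd j (pd k η))) := fun i j k =>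
    contDiff_pd (h2 j k) (by simp) i
  have c1 : ∀ j, HasCompactSupport (pd j η) := fun j => hasCompactSupport_pd h.2 j
  have c2 : ∀ i j, HasCompactSupport (pd i (pd j η)) := fun i j => hasCompactSupport_pd (c1 j) i
  have key : ∀ i j, ∫ y, pd i (pd j η) y * pd i (pd j η) y
      = ∫ y, pd j (pd j η) y * pd i (pd i η) y := by
    intro i j
    rw [integral_pd_mul ((h1 j).of_le t1) ((h2 i j).of_le t1) (c1 j) i,
      integral_pd_mul ((h1 j).of_le t1) ((h2 i i).of_le t1) (c1 j) j]
    congr 2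
    funext y
    have : pd i (pd j η) = pd j (pd i η) := funext fun z => pd_comm (h.1.of_le t2) i j z
    rw [this, pd_comm ((h1 i).of_le t2)]
  have i1 : ∀ i j k l, Integrable fun y => pd i (pd j η) y * pd k (pd l η) y := fun i j k l =>
    ((h2 i j).continuous.mul (h2 k l).continuous).integrable_of_hasCompactSupport
      ((c2 i j).mul_right)
  rw [show gradSq (grad η) = _ from funext fun y => gradSq_grad (h.1.of_le t2) y]
  have e2 : ∀ y, lap η y ^ 2 = ∑ i, ∑ j, pd j (pd j η) y * pd i (pd i η) y := by
    intro y
    rw [lap, sq, Finset.sum_mul_sum, Finset.sum_comm]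
  simp_rw [e2]
  rw [integral_finsetSum _ fun i _ => integrable_finsetSum _ fun j _ => i1 i j i j,
    integral_finsetSum _ fun i _ => integrable_finsetSum _ fun j _ => i1 j j i i]
  refine Finset.sum_congr rfl fun i _ => ?_
  rw [integral_finsetSum _ fun j _ => i1 i j i j, integral_finsetSum _ fun j _ => i1 j j i i]
  exact Finset.sum_congr rfl fun j _ => key i j

/-! ### The pressure equation -/

section
variable {v₀ v : Plane → Plane} {q : Plane → ℝ} {c m : ℝ}

lemma fderiv_inner_field {a b : Plane → Plane} (ha : ContDiff ℝ 1 a) (hb : ContDiff ℝ 1 b)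
    (y h : Plane) : fderiv ℝ (fun y => (inner ℝ (a y) (b y) : ℝ)) y h =
      inner ℝ (fderiv ℝ a y h) (b y) + inner ℝ (a y) (fderiv ℝ b y h) := by
  rw [fderiv_inner_apply ℝ (ha.differentiable one_ne_zero y) (hb.differentiable one_ne_zero y),
    add_comm]

/-- The pressure equation `-Δq = ∂ᵢ∂ⱼ(VᵢVⱼ)` for `V = v₀ + v`, tested with `η`. All linear terms
of the system drop out against gradient fields. -/
lemma integral_mul_lap (hs : IsPerturbedLeraySolution v₀ v q) (h₀ : IsProfile v₀ c)
    (h : ContDiff ℝ 1 v) (hd : ∀ y, divergence v y = 0) (hq : MemLp q 2) {η : Plane → ℝ}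
    (hη : IsTest η) :
    ∫ y, q y * lap η y = - ∫ y, inner ℝ (v₀ y + v y) (fderiv ℝ (grad η) y (v₀ y + v y)) := by
  have t1 := one_le_smooth
  have t2 := two_le_smooth
  have hη1 := hη.1.of_le t1
  have hη2 := hη.1.of_le t2
  have k := h₀.contDiff
  have hV : ContDiff ℝ 1 fun y => v₀ y + v y := k.add h
  have hdV := divergence_add k h h₀.div_eq_zero hd
  set φ := grad η with hφ_def
  have hφ' : ContDiff ℝ ∞ φ := contDiff_grad hη.1 (by simp)
  have hφ : ContDiff ℝ 1 φ := hφ'.of_le t1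
  have hφi : ∀ i, ContDiff ℝ 1 (pd i φ) := fun i => contDiff_pd (m := 1) (hφ'.of_le t2) (by norm_num) i
  have hφc : HasCompactSupport φ := hasCompactSupport_grad hη.2
  have hφci := fun i => hasCompactSupport_pd hφc i
  have hL : ContDiff ℝ 1 (lap η) := (contDiff_lap hη.1).of_le t1
  have hLc := hasCompactSupport_lap hη.2
  have hg1 : ∀ i, ContDiff ℝ 1 fun y => (inner ℝ (v y) (pd i φ y) : ℝ) := fun i => h.inner ℝ (hφi i)
  have hg1c : ∀ i, HasCompactSupport fun y => (inner ℝ (v y) (pd i φ y) : ℝ) := fun i =>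
    HasCompactSupport.intro (hφci i).isCompact fun y hy => by
      simp [image_eq_zero_of_notMem_tsupport hy]
  have hg2 : ContDiff ℝ 1 fun y => (inner ℝ (v y) (φ y) : ℝ) := h.inner ℝ hφ
  have hg2c : HasCompactSupport fun y => (inner ℝ (v y) (φ y) : ℝ) :=
    HasCompactSupport.intro hφc.isCompact fun y hy => by
      simp [image_eq_zero_of_notMem_tsupport hy]
  have hg3 : ContDiff ℝ 1 fun y => (inner ℝ (v₀ y + v y) (φ y) : ℝ) := hV.inner ℝ hφ
  have hg3c : HasCompactSupport fun y => (inner ℝ (v₀ y + v y) (φ y) : ℝ) :=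
    HasCompactSupport.intro hφc.isCompact fun y hy => by
      simp [image_eq_zero_of_notMem_tsupport hy]
  have hζ : ContDiff ℝ 1 fun y : Plane => (inner ℝ y (φ y) : ℝ) := contDiff_id.inner ℝ hφ
  have hζc : HasCompactSupport fun y : Plane => (inner ℝ y (φ y) : ℝ) :=
    HasCompactSupport.intro hφc.isCompact fun y hy => by
      simp [image_eq_zero_of_notMem_tsupport hy]
  have int : ∀ {g : Plane → ℝ} {a : Plane → Plane}, ContDiff ℝ 1 g → HasCompactSupport g →
      Continuous a → Integrable fun y => fderiv ℝ g y (a y) := by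
    intro g a hg hgc ha
    refine integrable_of_tsupport ((hg.continuous_fderiv one_ne_zero).clm_apply ha) hgc
      fun y _ h2 => by simp [h2]
  have i0 : Integrable fun y => (∑ i, inner ℝ (pd i v y) (pd i φ y))
      + inner ℝ (leraySource v₀ v y) (φ y) - q y * divergence φ y := by
    have hw := continuous_pd h
    have hb := continuous_leraySource k h
    have hwφ := continuous_pd hφ
    have hφ0 := hφ.continuous
    refine Integrable.sub (integrable_of_tsupport (θ := φ) (by fun_prop) hφc fun y h1 h2 => ?_)
      (integrable_mul_divergence hφ hφc hq)
    simp [pd, h1, h2]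
  -- the system tested with `∇η`, and null integrals that remove the terms linear in `v`, move the
  -- derivative of the quadratic term, and commute `∇` with `Δ`
  have z0 := And.intro i0 (hs.weak_identity k h hq hφ hφc)
  have z1 := fun i => And.intro (int (hg1 i) (hg1c i) (continuous_const (y := e i)))
    (integral_fderiv_eq_zero (a := fun _ => e i) (hg1 i) (hg1c i) contDiff_const
      (divergence_const _))
  have z2 := And.intro (int hL hLc h.continuous) (integral_fderiv_eq_zero hL hLc h hd)
  have z3 := And.intro (int hζ hζc h.continuous) (integral_fderiv_eq_zero hζ hζc h hd)
  have z4 : (Integrable fun y => fderiv ℝ (fun y => (inner ℝ (v y) (φ y) : ℝ)) y y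
      + inner ℝ (v y) (φ y) * 2) ∧ ∫ y, (fderiv ℝ (fun y => (inner ℝ (v y) (φ y) : ℝ)) y y
      + inner ℝ (v y) (φ y) * 2) = 0 := by
    refine ⟨(int hg2 hg2c continuous_id).add
      ((hg2.continuous.integrable_of_hasCompactSupport hg2c).mul_const 2), ?_⟩
    rw [← integral_fderiv_add_mul_divergence hg2 hg2c contDiff_id]
    congr 1
    funext y
    rw [show divergence id y = 2 from divergence_id y]
    rfl
  have z5 := And.intro (int hg3 hg3c hV.continuous) (integral_fderiv_eq_zero hg3 hg3c hV hdV)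
  have iV : Integrable fun y => (inner ℝ (v₀ y + v y) (fderiv ℝ φ y (v₀ y + v y)) : ℝ) := by
    have c1 := hV.continuous
    have c2 := hφ.continuous_fderiv one_ne_zero
    exact integrable_of_tsupport (θ := φ) (by fun_prop) hφc fun y _ h2 => by simp [h2]
  have iq : Integrable fun y => q y * lap η y := by
    refine (integrable_mul_divergence hφ hφc hq).congr (ae_of_all _ fun y => ?_)
    simp only [hφ_def, divergence_grad hη2]
  have key : ∀ y, -(inner ℝ (v₀ y + v y) (fderiv ℝ φ y (v₀ y + v y)) + q y * lap η y) =
      ((∑ i, inner ℝ (pd i v y) (pd i φ y)) + inner ℝ (leraySource v₀ v y) (φ y)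
        - q y * divergence φ y)
      + (-1) * fderiv ℝ (fun y => (inner ℝ (v y) (pd 0 φ y) : ℝ)) y (e 0)
      + (-1) * fderiv ℝ (fun y => (inner ℝ (v y) (pd 1 φ y) : ℝ)) y (e 1)
      + 1 * fderiv ℝ (lap η) y (v y)
      + (-1 / 2) * fderiv ℝ (fun y => (inner ℝ y (φ y) : ℝ)) y (v y)
      + (1 / 2) * (fderiv ℝ (fun y => (inner ℝ (v y) (φ y) : ℝ)) y y + inner ℝ (v y) (φ y) * 2)
      + (-1) * fderiv ℝ (fun y => (inner ℝ (v₀ y + v y) (φ y) : ℝ)) y (v₀ y + v y) := by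
    intro y
    -- symmetry of the Hessian of `η`
    have e1 : (inner ℝ y (fderiv ℝ φ y (v y)) : ℝ) = inner ℝ (v y) (fderiv ℝ φ y y) := by
      rw [fderiv_apply_eq_sum φ y (v y), fderiv_apply_eq_sum φ y y, hφ_def]
      simp only [pd_grad hη2, Fin.sum_univ_two, inner_add_right, inner_smul_right, inner_e,
        pd_comm hη2 1 0]
      ring
    -- commutation of the gradient with the Laplacian
    have e2 : fderiv ℝ (lap η) y (v y) =
        inner ℝ (v y) (fderiv ℝ (pd 0 φ) y (e 0)) + inner ℝ (v y) (fderiv ℝ (pd 1 φ) y (e 1)) := by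
      have e3 : ∀ i, pd i (pd i φ) y = grad (pd i (pd i η)) y := by
        intro i
        rw [hφ_def, pd_grad_eq hη2, pd_grad_eq ((contDiff_pd hη.1 (m := (⊤ : ℕ∞)) (by simp) i).of_le t2)]
      change _ = inner ℝ (v y) (pd 0 (pd 0 φ) y) + inner ℝ (v y) (pd 1 (pd 1 φ) y)
      have h3 : ∀ i, ContDiff ℝ 1 (pd i (pd i η)) := fun i =>
        (contDiff_pd (contDiff_pd hη.1 (m := (⊤ : ℕ∞)) (by simp) i) (m := (⊤ : ℕ∞))
          (by simp) i).of_le t1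
      rw [e3, e3, inner_grad, inner_grad]
      change fderiv ℝ (fun y => ∑ i, pd i (pd i η) y) y (v y) = _
      rw [fderiv_fun_sum fun i _ => (h3 i).differentiable one_ne_zero y]
      simp
    have e4 : ∀ w : Plane, fderiv ℝ (fun y => v₀ y + v y) y w
        = fderiv ℝ v₀ y w + fderiv ℝ v y w := fun w => by
      rw [fderiv_fun_add (k.differentiable one_ne_zero y) (h.differentiable one_ne_zero y)]
      simp
    have e5 : fderiv ℝ (fun y => (inner ℝ y (φ y) : ℝ)) y (v y)
        = inner ℝ (v y) (φ y) + inner ℝ y (fderiv ℝ φ y (v y)) := by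
      have := fderiv_inner_field contDiff_id hφ y (v y)
      simpa using this
    rw [e5, fderiv_inner_field h (hφi 0), fderiv_inner_field h (hφi 1), fderiv_inner_field h hφ,
      fderiv_inner_field hV hφ, e2, e1, e4, hφ_def, divergence_grad hη2]
    simp only [pd, leraySource, Fin.sum_univ_two, inner_add_left, inner_sub_left, inner_smul_left,
      conj_trivial]
    ring
  have hz := (integral_add_mul_eq_zero (integral_add_mul_eq_zero (integral_add_mul_eq_zero
    (integral_add_mul_eq_zero (integral_add_mul_eq_zero (integral_add_mul_eq_zero z0 (z1 0) (-1))
    (z1 1) (-1)) z2 1) z3 (-1 / 2)) z4 (1 / 2)) z5 (-1)).2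
  rw [← integral_congr_ae (ae_of_all _ key), integral_neg, integral_add iV iq] at hz
  linarith

/-- A continuous field in `L⁴` pairs with the Hessian of a test function through the `L²` norm of
its Laplacian. -/
lemma integral_mul_lap_le (hs : IsPerturbedLeraySolution v₀ v q) (h₀ : IsProfile v₀ c)
    (h : ContDiff ℝ 1 v) (hd : ∀ y, divergence v y = 0) (hq : MemLp q 2)
    (h4 : Integrable fun y => ‖v₀ y + v y‖ ^ 4) {η : Plane → ℝ} (hη : IsTest η) :
    ∫ y, q y * lap η y ≤ √(∫ y, ‖v₀ y + v y‖ ^ 4) * √(∫ y, lap η y ^ 2) := by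
  have hcV : Continuous fun y => v₀ y + v y := h₀.contDiff.continuous.add h.continuous
  have hφ : ContDiff ℝ 1 (grad η) := contDiff_grad (hη.1.of_le two_le_smooth) (by norm_num)
  have hφc : HasCompactSupport (grad η) := hasCompactSupport_grad hη.2
  have m1 : MemLp (fun y => ‖v₀ y + v y‖ ^ 2) 2 := by
    rw [memLp_two_iff_integrable_sq (f := fun y => ‖v₀ y + v y‖ ^ 2)
      (hcV.norm.pow 2).aestronglyMeasurable]
    refine h4.congr (ae_of_all _ fun y => ?_)
    simp only
    ring
  have m2 : MemLp (fun y => √(gradSq (grad η) y)) 2 := by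
    refine memLp_sqrt_gradSq hφ (integrable_of_tsupport (continuous_gradSq hφ) hφc ?_)
    intro y _ h2
    simp [gradSq, pd, h2]
  rw [integral_mul_lap hs h₀ h hd hq hη, ← integral_neg, ← integral_gradSq_grad hη]
  have hle : ∀ y, -(inner ℝ (v₀ y + v y) (fderiv ℝ (grad η) y (v₀ y + v y)) : ℝ)
      ≤ ‖v₀ y + v y‖ ^ 2 * √(gradSq (grad η) y) := by
    intro y
    have h1 := Real.sqrt_le_sqrt (norm_fderiv_apply_sq_le (grad η) y (v₀ y + v y))
    rw [Real.sqrt_mul (gradSq_nonneg _ y), Real.sqrt_sq (norm_nonneg _),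
      Real.sqrt_sq (norm_nonneg _)] at h1
    refine (neg_le_abs _).trans ((abs_real_inner_le_norm _ _).trans ?_)
    calc _ ≤ ‖v₀ y + v y‖ * (√(gradSq (grad η) y) * ‖v₀ y + v y‖) := by gcongr
      _ = _ := by ring
  have iV : Integrable fun y => -(inner ℝ (v₀ y + v y)
      (fderiv ℝ (grad η) y (v₀ y + v y)) : ℝ) := by
    have c2 := hφ.continuous_fderiv one_ne_zero
    exact (integrable_of_tsupport (θ := grad η) (by fun_prop) hφc fun y _ h2 => by simp [h2]).neg
  refine (integral_mono iV (m1.integrable_mul m2) hle).trans ?_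
  refine (integral_mul_le_sqrt m1 m2).trans (le_of_eq ?_)
  congr 3
  · funext y; ring
  · funext y; rw [Real.sq_sqrt (gradSq_nonneg _ _)]

end

/-! ### Liouville's theorem in `L²` -/

/-- Fatou's lemma for real integrals. -/
lemma integrable_of_tendsto {f : ℕ → Plane → ℝ} {g : Plane → ℝ} {B : ℕ → ℝ} {b : ℝ}
    (hf : ∀ n, Integrable (f n)) (h0 : ∀ n y, 0 ≤ f n y)
    (hg : ∀ y, Tendsto (fun n => f n y) atTop (𝓝 (g y))) (hB : ∀ n, ∫ y, f n y ≤ B n)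
    (hb : Tendsto B atTop (𝓝 b)) : Integrable g ∧ ∫ y, g y ≤ b := by
  have hg0 : ∀ y, 0 ≤ g y := fun y => ge_of_tendsto' (hg y) fun n => h0 n y
  have hgm : AEStronglyMeasurable g :=
    aestronglyMeasurable_of_tendsto_ae atTop (fun n => (hf n).aestronglyMeasurable)
      (ae_of_all _ hg)
  have hb0 : 0 ≤ b := ge_of_tendsto' hb fun n => (integral_nonneg (h0 n)).trans (hB n)
  have key : ∫⁻ y, ENNReal.ofReal (g y) ≤ ENNReal.ofReal b := by
    have h1 : ∀ y, ENNReal.ofReal (g y) = liminf (fun n => ENNReal.ofReal (f n y)) atTop :=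
      fun y => ((ENNReal.tendsto_ofReal (hg y)).liminf_eq).symm
    simp_rw [h1]
    refine (lintegral_liminf_le' fun n => (hf n).aemeasurable.ennreal_ofReal).trans ?_
    rw [← (ENNReal.tendsto_ofReal hb).liminf_eq]
    refine liminf_le_liminf (Eventually.of_forall fun n => ?_)
    rw [← ofReal_integral_eq_lintegral_ofReal (hf n) (ae_of_all _ (h0 n))]
    exact ENNReal.ofReal_le_ofReal (hB n)
  have hi : Integrable g := by
    refine ⟨hgm, ?_⟩
    rw [hasFiniteIntegral_iff_ofReal (ae_of_all _ hg0)]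
    exact key.trans_lt ENNReal.ofReal_lt_top
  refine ⟨hi, ?_⟩
  rw [← ofReal_integral_eq_lintegral_ofReal hi (ae_of_all _ hg0)] at key
  exact (ENNReal.ofReal_le_ofReal_iff hb0).1 key

lemma norm_grad_sq (η : Plane → ℝ) (y : Plane) : fderiv ℝ η y (grad η y) = ‖grad η y‖ ^ 2 := by
  rw [← inner_grad, real_inner_self_eq_norm_sq]

/-- Liouville's theorem for square integrable harmonic functions, from Caccioppoli's inequality. -/
lemma eq_zero_of_lap_eq_zero {H : Plane → ℝ} (hH : ContDiff ℝ 2 H) (hl : ∀ y, lap H y = 0)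
    (hi : Integrable fun y => H y ^ 2) : H = 0 := by
  obtain ⟨C, hC0, hC⟩ := exists_fderiv_chi_le
  have hH1 : ContDiff ℝ 1 H := hH.of_le (by norm_num)
  have hG : ContDiff ℝ 1 (grad H) := contDiff_grad hH (by norm_num)
  have hχ : ∀ n, ContDiff ℝ 1 (chi n) := fun n => by exact_mod_cast contDiff_chi n (m := 1)
  have hχc := hasCompactSupport_chi
  have hdχ : ∀ n, Continuous (fderiv ℝ (chi n)) := fun n =>
    (hχ n).continuous_fderiv one_ne_zero
  have hsm : ∀ n y, ‖fderiv ℝ (chi n) y‖ ≤ C := fun n y => by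
    nlinarith [hC n y, norm_nonneg y, norm_nonneg (fderiv ℝ (chi n) y)]
  have i1 : ∀ n, Integrable fun y => chi n y ^ 2 * ‖grad H y‖ ^ 2 := fun n => by
    refine integrable_of_tsupport (θ := chi n) ?_ (hχc n) fun y h _ => by simp [h]
    exact ((hχ n).continuous.pow 2).mul (hG.continuous.norm.pow 2)
  have i2 : ∀ n, Integrable fun y => ‖fderiv ℝ (chi n) y‖ ^ 2 * H y ^ 2 := fun n => by
    refine integrable_of_tsupport (θ := chi n) ?_ (hχc n) fun y _ h => by simp [h]
    exact ((hdχ n).norm.pow 2).mul (hH1.continuous.pow 2)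
  -- the divergence theorem for the field `χ² H ∇H`
  have caccioppoli : ∀ n, ∫ y, chi n y ^ 2 * ‖grad H y‖ ^ 2
      ≤ 4 * ∫ y, ‖fderiv ℝ (chi n) y‖ ^ 2 * H y ^ 2 := by
    intro n
    have hg : ContDiff ℝ 1 fun y => chi n y ^ 2 * H y := ((hχ n).pow 2).mul hH1
    have hgc : HasCompactSupport fun y => chi n y ^ 2 * H y := by
      simp_rw [sq, mul_assoc]
      exact (hχc n).mul_right
    have h := integral_fderiv_add_mul_divergence hg hgc hG
    have e1 : ∀ y, fderiv ℝ (fun y => chi n y ^ 2 * H y) y (grad H y)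
        + chi n y ^ 2 * H y * divergence (grad H) y
        = chi n y ^ 2 * ‖grad H y‖ ^ 2 + 2 * chi n y * H y * fderiv ℝ (chi n) y (grad H y) := by
      intro y
      have d1 := ((hχ n).differentiable one_ne_zero y).hasFDerivAt
      have d2 := (hH1.differentiable one_ne_zero y).hasFDerivAt
      have d3 : HasFDerivAt (fun y => chi n y ^ 2 * H y) _ y := (d1.pow 2).mul d2
      rw [divergence_grad hH, hl, d3.fderiv]
      simp [norm_grad_sq]
      ring
    simp_rw [e1] at h
    have i3 : Integrable fun y => 2 * chi n y * H y * fderiv ℝ (chi n) y (grad H y) := by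
      refine integrable_of_tsupport (θ := chi n) ?_ (hχc n) fun y h _ => by simp [h]
      exact ((continuous_const.mul (hχ n).continuous).mul hH1.continuous).mul
        ((hdχ n).clm_apply hG.continuous)
    rw [integral_add (i1 n) i3] at h
    have hle : ∫ y, -(2 * chi n y * H y * fderiv ℝ (chi n) y (grad H y)) ≤
        ∫ y, ((1 / 2) * (chi n y ^ 2 * ‖grad H y‖ ^ 2)
          + 2 * (‖fderiv ℝ (chi n) y‖ ^ 2 * H y ^ 2)) := by
      refine integral_mono i3.neg (((i1 n).const_mul _).add ((i2 n).const_mul _)) fun y => ?_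
      have h1 : |fderiv ℝ (chi n) y (grad H y)| ≤ ‖fderiv ℝ (chi n) y‖ * ‖grad H y‖ :=
        (fderiv ℝ (chi n) y).le_opNorm _
      have h2 : -(2 * chi n y * H y * fderiv ℝ (chi n) y (grad H y))
          ≤ 2 * (|chi n y| * ‖grad H y‖) * (‖fderiv ℝ (chi n) y‖ * |H y|) := by
        refine (neg_le_abs _).trans ?_
        rw [abs_mul, abs_mul, abs_mul, abs_two]
        calc _ ≤ 2 * |chi n y| * |H y| * (‖fderiv ℝ (chi n) y‖ * ‖grad H y‖) := by gcongr
          _ = _ := by ring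
      refine h2.trans ?_
      have := sq_nonneg (|chi n y| * ‖grad H y‖ - 2 * (‖fderiv ℝ (chi n) y‖ * |H y|))
      have e3 := sq_abs (chi n y)
      have e4 := sq_abs (H y)
      rw [← e3, ← e4]
      nlinarith
    rw [integral_add ((i1 n).const_mul _) ((i2 n).const_mul _), integral_const_mul,
      integral_const_mul, integral_neg] at hle
    linarith
  -- `|∇χ|` is bounded, and vanishes at each point from some `n` on
  have hlim : Tendsto (fun n => 4 * ∫ y, ‖fderiv ℝ (chi n) y‖ ^ 2 * H y ^ 2) atTop (𝓝 0) := by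
    rw [← mul_zero (4 : ℝ)]
    refine Tendsto.const_mul _ ?_
    rw [← integral_zero Plane ℝ (μ := volume)]
    refine tendsto_integral_of_dominated_convergence (fun y => C ^ 2 * H y ^ 2)
      (fun n => (i2 n).aestronglyMeasurable) (hi.const_mul _) (fun n => ae_of_all _ fun y => ?_)
      (ae_of_all _ fun y => ?_)
    · rw [Real.norm_of_nonneg (by positivity)]
      have := hsm n y
      gcongr
    · refine tendsto_const_nhds.congr' ((fderiv_chi_eventually y).mono fun n h => ?_)
      simp [h]
  have hF := integrable_of_tendsto i1 (fun n y => by positivity)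
    (g := fun y => ‖grad H y‖ ^ 2) (fun y => by
      simpa using ((tendsto_chi y).pow 2).mul_const (‖grad H y‖ ^ 2)) caccioppoli hlim
  have hzero : (fun y => ‖grad H y‖ ^ 2) =ᵐ[volume] 0 :=
    (integral_eq_zero_iff_of_nonneg (fun y => by positivity) hF.1).1
      (le_antisymm hF.2 (integral_nonneg fun y => by positivity))
  have hgz : (fun y => ‖grad H y‖ ^ 2) = 0 :=
    (Continuous.ae_eq_iff_eq volume (hG.continuous.norm.pow 2) continuous_const).1 hzero
  have hfd : ∀ y, fderiv ℝ H y = 0 := fun y => by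
    ext a
    have : grad H y = 0 := by simpa using congrFun hgz y
    rw [← inner_grad, this]
    simp
  have hconst : ∀ y, H y = H 0 := fun y =>
    is_const_of_fderiv_eq_zero (hH1.differentiable one_ne_zero) hfd y 0
  have h3 : Integrable fun _ : Plane => H 0 ^ 2 := by simpa only [hconst] using hi
  rw [integrable_const_iff] at h3
  have h4 : H 0 = 0 := by
    rcases h3 with h | h
    · simpa using h
    · exact absurd h (by simp [isFiniteMeasure_iff])
  funext y
  rw [hconst, h4]
  rfl

/-! ### Weyl's lemma in `L²` -/

lemma pd_comp_const_sub {f : Plane → ℝ} (h : ContDiff ℝ 1 f) (x : Plane) (i : Fin 2) :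
    pd i (fun z => f (x - z)) = fun z => -pd i f (x - z) := by
  funext z
  have h1 := (h.differentiable one_ne_zero (x - z)).hasFDerivAt.comp z
    ((hasFDerivAt_id z).const_sub x)
  have h2 : HasFDerivAt (fun z => f (x - z)) _ z := h1
  rw [pd, h2.fderiv]
  simp [pd]

lemma pd_neg (f : Plane → ℝ) (i : Fin 2) (y : Plane) : pd i (fun z => -f z) y = -pd i f y := by
  rw [pd, fderiv_fun_neg]
  rfl

lemma lap_comp_const_sub {f : Plane → ℝ} (h : ContDiff ℝ 2 f) (x z : Plane) :
    lap (fun z => f (x - z)) z = lap f (x - z) := by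
  refine Finset.sum_congr rfl fun i _ => ?_
  rw [pd_comp_const_sub (h.of_le (by norm_num)), pd_neg,
    pd_comp_const_sub (contDiff_pd h (by norm_num) i), neg_neg]

lemma pd_convolution {h ρ : Plane → ℝ} (hh : LocallyIntegrable h) (hρ : ContDiff ℝ 1 ρ)
    (hc : HasCompactSupport ρ) (i : Fin 2) :
    pd i (h ⋆[ContinuousLinearMap.lsmul ℝ ℝ, volume] ρ)
      = h ⋆[ContinuousLinearMap.lsmul ℝ ℝ, volume] pd i ρ := by
  funext y
  have h1 := hc.hasFDerivAt_convolution_right (μ := volume) (ContinuousLinearMap.lsmul ℝ ℝ)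
    hh hρ y
  rw [pd, h1.fderiv, convolution_precompR_apply _ hh (hc.fderiv (𝕜 := ℝ))
    (hρ.continuous_fderiv one_ne_zero)]
  rfl

lemma IsTest.comp_const_sub {ρ : Plane → ℝ} (hρ : IsTest ρ) (x : Plane) :
    IsTest fun z => ρ (x - z) := by
  refine ⟨hρ.1.comp (contDiff_const.sub contDiff_id), ?_⟩
  obtain ⟨R, hR⟩ := exists_forall_lt_norm_eq_zero hρ.2
  refine HasCompactSupport.intro (isCompact_closedBall x R) fun z hz => hR _ ?_
  rw [Metric.mem_closedBall, dist_eq_norm, not_le, norm_sub_rev] at hz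
  exact hz

lemma lap_convolution {h ρ : Plane → ℝ} (hh : LocallyIntegrable h) (hρ : IsTest ρ) (x : Plane) :
    lap (h ⋆[ContinuousLinearMap.lsmul ℝ ℝ, volume] ρ) x
      = ∫ z, h z * lap (fun z => ρ (x - z)) z := by
  have t1 := one_le_smooth
  have t2 := two_le_smooth
  have h1 : ∀ i, ContDiff ℝ ∞ (pd i ρ) := fun i => contDiff_pd hρ.1 (by simp) i
  have h2 : ∀ i, ContDiff ℝ ∞ (pd i (pd i ρ)) := fun i => contDiff_pd (h1 i) (by simp) i
  have c1 : ∀ i, HasCompactSupport (pd i ρ) := fun i => hasCompactSupport_pd hρ.2 i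
  have c2 : ∀ i, HasCompactSupport (pd i (pd i ρ)) := fun i => hasCompactSupport_pd (c1 i) i
  have i1 : ∀ i, Integrable fun z => h z * pd i (pd i ρ) (x - z) := fun i =>
    ((c2 i).convolutionExists_right (ContinuousLinearMap.lsmul ℝ ℝ) hh (h2 i).continuous x)
  have e1 : ∀ z, h z * lap (fun z => ρ (x - z)) z = ∑ i, h z * pd i (pd i ρ) (x - z) := by
    intro z
    rw [lap_comp_const_sub (hρ.1.of_le t2), lap, Finset.mul_sum]
  simp_rw [e1]
  rw [integral_finsetSum _ fun i _ => i1 i]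
  refine Finset.sum_congr rfl fun i _ => ?_
  rw [pd_convolution hh (hρ.1.of_le t1) hρ.2, pd_convolution hh ((h1 i).of_le t1) (c1 i)]
  rfl

/-- Young's inequality `L² ⋆ L¹ ⊆ L²`, by the Cauchy–Schwarz inequality with weight `|ρ(x - ·)|`. -/
lemma integrable_convolution_sq {h ρ : Plane → ℝ} (hh : MemLp h 2) (hρ : IsTest ρ) :
    Integrable fun x => (h ⋆[ContinuousLinearMap.lsmul ℝ ℝ, volume] ρ) x ^ 2 := by
  have hρi : Integrable fun z => |ρ z| :=
    (hρ.1.continuous.integrable_of_hasCompactSupport hρ.2).abs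
  have hc := hρ.2.contDiff_convolution_right (n := (⊤ : ℕ∞)) (ContinuousLinearMap.lsmul ℝ ℝ)
    (hh.locallyIntegrable (by norm_num)) hρ.1 (μ := volume)
  have hcv := (hh.integrable_sq.integrable_convolution (ContinuousLinearMap.lsmul ℝ ℝ) hρi)
  refine (hcv.const_mul (∫ z, |ρ z|)).mono' (hc.continuous.pow 2).aestronglyMeasurable
    (ae_of_all _ fun x => ?_)
  rw [Real.norm_of_nonneg (sq_nonneg _)]
  have hx := hρ.comp_const_sub x
  have m1 : MemLp (fun z => √|ρ (x - z)|) 2 := by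
    have hcont : Continuous fun z => √|ρ (x - z)| := hx.1.continuous.abs.sqrt
    refine hcont.memLp_of_hasCompactSupport (hx.2.mono fun z hz => ?_)
    simp only [Function.mem_support] at hz ⊢
    contrapose! hz
    simp [hz]
  obtain ⟨M, hM⟩ := hx.1.continuous.bounded_above_of_compact_support hx.2
  have m2 : MemLp (fun z => √|ρ (x - z)| * |h z|) 2 := by
    refine (hh.abs.const_mul (√M)).mono (hx.1.continuous.abs.sqrt.aestronglyMeasurable.mul
      hh.abs.aestronglyMeasurable) (ae_of_all _ fun z => ?_)
    rw [norm_mul, norm_mul, Real.norm_of_nonneg (Real.sqrt_nonneg _),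
      Real.norm_of_nonneg (Real.sqrt_nonneg _)]
    have := hM z
    rw [Real.norm_eq_abs] at this
    exact mul_le_mul (Real.sqrt_le_sqrt this) (by simp) (norm_nonneg _) (Real.sqrt_nonneg _)
  have key := integral_mul_sq_le m1 m2
  have e1 : ∀ z, √|ρ (x - z)| * (√|ρ (x - z)| * |h z|) = |h z * ρ (x - z)| := fun z => by
    rw [← mul_assoc, Real.mul_self_sqrt (abs_nonneg _), abs_mul, mul_comm]
  have e2 : ∀ z, √|ρ (x - z)| ^ 2 = |ρ (x - z)| := fun z => Real.sq_sqrt (abs_nonneg _)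
  have e3 : ∀ z, (√|ρ (x - z)| * |h z|) ^ 2 = h z ^ 2 * |ρ (x - z)| := fun z => by
    rw [mul_pow, e2, sq_abs, mul_comm]
  simp_rw [e1, e2, e3] at key
  rw [integral_sub_left_eq_self (fun z => |ρ z|) volume x] at key
  refine le_trans ?_ key
  rw [← sq_abs]
  gcongr
  exact norm_integral_le_integral_norm fun z => h z * ρ (x - z)

/-- Weyl's lemma for square integrable functions. -/
lemma ae_eq_zero_of_integral_mul_lap {h : Plane → ℝ} (hh : MemLp h 2)
    (H : ∀ η : Plane → ℝ, IsTest η → ∫ y, h y * lap η y = 0) : h =ᵐ[volume] 0 := by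
  have hloc : LocallyIntegrable h := hh.locallyIntegrable (by norm_num)
  refine ae_eq_zero_of_integral_contDiff_smul_eq_zero hloc fun g hg hgc => ?_
  have hρ : IsTest fun z => g (0 - z) := IsTest.comp_const_sub ⟨hg, hgc⟩ 0
  have hs := hρ.2.contDiff_convolution_right (n := (⊤ : ℕ∞)) (ContinuousLinearMap.lsmul ℝ ℝ)
    hloc hρ.1 (μ := volume)
  have hz := eq_zero_of_lap_eq_zero (hs.of_le two_le_smooth)
    (fun x => by rw [lap_convolution hloc hρ]; exact H _ (hρ.comp_const_sub x))
    (integrable_convolution_sq hh hρ)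
  have := congrFun hz 0
  rw [convolution_def] at this
  simpa [mul_comm] using this

/-! ### The pressure bound -/

lemma lap_add {f g : Plane → ℝ} (hf : IsTest f) (hg : IsTest g) (y : Plane) :
    lap (fun z => f z + g z) y = lap f y + lap g y := by
  have h1 : ∀ {f g : Plane → ℝ}, ContDiff ℝ 1 f → ContDiff ℝ 1 g → ∀ i,
      pd i (fun z => f z + g z) = fun z => pd i f z + pd i g z := by
    intro f g hf hg i
    funext z
    rw [pd, fderiv_fun_add (hf.differentiable one_ne_zero z) (hg.differentiable one_ne_zero z)]
    rfl
  have t1 := one_le_smooth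
  have t2 := two_le_smooth
  rw [lap, lap, lap, ← Finset.sum_add_distrib]
  refine Finset.sum_congr rfl fun i _ => ?_
  rw [h1 (hf.1.of_le t1) (hg.1.of_le t1), h1 (contDiff_pd (hf.1.of_le t2) (by norm_num) i)
    (contDiff_pd (hg.1.of_le t2) (by norm_num) i)]

lemma lap_const_mul {f : Plane → ℝ} (hf : IsTest f) (r : ℝ) (y : Plane) :
    lap (fun z => r * f z) y = r * lap f y := by
  have h1 : ∀ {f : Plane → ℝ}, ContDiff ℝ 1 f → ∀ i,
      pd i (fun z => r * f z) = fun z => r * pd i f z := by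
    intro f hf i
    funext z
    rw [pd, fderiv_const_mul (hf.differentiable one_ne_zero z)]
    rfl
  rw [lap, lap, Finset.mul_sum]
  refine Finset.sum_congr rfl fun i _ => ?_
  rw [h1 (hf.1.of_le one_le_smooth),
    h1 (contDiff_pd (hf.1.of_le two_le_smooth) (by norm_num) i)]

/-- The classes in `L²` of the Laplacians of test functions. -/
def lapTest : Submodule ℝ (Lp ℝ 2 (volume : Measure Plane)) where
  carrier := {f | ∃ η : Plane → ℝ, IsTest η ∧ f =ᵐ[volume] lap η}
  zero_mem' := by
    refine ⟨fun _ => 0, ⟨contDiff_const, HasCompactSupport.zero⟩, ?_⟩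
    refine (Lp.coeFn_zero ℝ 2 volume).trans (ae_of_all _ fun y => ?_)
    have : ∀ i, pd i (fun _ : Plane => (0 : ℝ)) = fun _ => 0 := fun i => by funext z; simp [pd]
    simp [lap, this]
  add_mem' := by
    rintro f g ⟨η, hη, hf⟩ ⟨ζ, hζ, hg⟩
    refine ⟨fun z => η z + ζ z, ⟨hη.1.add hζ.1, hη.2.add hζ.2⟩, ?_⟩
    filter_upwards [Lp.coeFn_add f g, hf, hg] with y h1 h2 h3
    rw [h1, Pi.add_apply, h2, h3, lap_add hη hζ]
  smul_mem' := by
    rintro r f ⟨η, hη, hf⟩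
    refine ⟨fun z => r * η z, ⟨contDiff_const.mul hη.1, hη.2.mul_left⟩, ?_⟩
    filter_upwards [Lp.coeFn_smul r f, hf] with y h1 h2
    rw [h1, Pi.smul_apply, h2, lap_const_mul hη, smul_eq_mul]

lemma memLp_lap {η : Plane → ℝ} (hη : IsTest η) : MemLp (lap η) 2 :=
  (contDiff_lap hη.1).continuous.memLp_of_hasCompactSupport (hasCompactSupport_lap hη.2)

/-- The orthogonal complement of the Laplacians consists of harmonic functions in `L²`. -/
lemma topologicalClosure_lapTest : lapTest.topologicalClosure = ⊤ := by
  rw [Submodule.topologicalClosure_eq_top_iff, Submodule.eq_bot_iff]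
  intro h hh
  rw [Submodule.mem_orthogonal] at hh
  have := ae_eq_zero_of_integral_mul_lap (Lp.memLp h) fun η hη => by
    have h1 := hh ((memLp_lap hη).toLp _) ⟨η, hη, (memLp_lap hη).coeFn_toLp⟩
    rw [L2.inner_def] at h1
    rw [← h1]
    refine integral_congr_ae ?_
    filter_upwards [(memLp_lap hη).coeFn_toLp] with y hy
    rw [hy]
    simp
  rwa [Lp.eq_zero_iff_ae_eq_zero]

lemma Lp_norm_sq_eq (f : Lp ℝ 2 (volume : Measure Plane)) : ‖f‖ ^ 2 = ∫ y, f y ^ 2 := by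
  rw [← real_inner_self_eq_norm_sq, L2.inner_def]
  simp [sq]

/-- A square integrable function is controlled in `L²` by its pairings with Laplacians. -/
lemma integral_sq_le_of_integral_mul_lap_le {q : Plane → ℝ} (hq : MemLp q 2) {W : ℝ}
    (H : ∀ η : Plane → ℝ, IsTest η → ∫ y, q y * lap η y ≤ W * √(∫ y, lap η y ^ 2)) :
    ∫ y, q y ^ 2 ≤ W ^ 2 := by
  set Q := hq.toLp q with hQ
  have hclosed : IsClosed {f : Lp ℝ 2 (volume : Measure Plane) | inner ℝ f Q ≤ W * ‖f‖} :=
    isClosed_le (by fun_prop) (by fun_prop)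
  have hsub : (lapTest : Set (Lp ℝ 2 (volume : Measure Plane)))
      ⊆ {f | inner ℝ f Q ≤ W * ‖f‖} := by
    rintro f ⟨η, hη, hf⟩
    have h1 : ‖f‖ = √(∫ y, lap η y ^ 2) := by
      rw [← Real.sqrt_sq (norm_nonneg f), Lp_norm_sq_eq]
      congr 1
      refine integral_congr_ae ?_
      filter_upwards [hf] with y hy
      rw [hy]
    rw [Set.mem_ofPred_eq, h1, L2.inner_def]
    refine le_of_eq_of_le (integral_congr_ae ?_) (H η hη)
    filter_upwards [hf, hq.coeFn_toLp] with y hy hy'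
    rw [hy, hQ, hy']
    simp
  have hmem : Q ∈ closure (lapTest : Set (Lp ℝ 2 (volume : Measure Plane))) := by
    rw [← Submodule.topologicalClosure_coe, topologicalClosure_lapTest]
    trivial
  have h2 : inner ℝ Q Q ≤ W * ‖Q‖ := closure_minimal hsub hclosed hmem
  rw [real_inner_self_eq_norm_sq] at h2
  have h3 : ‖Q‖ ^ 2 = ∫ y, q y ^ 2 := by
    rw [Lp_norm_sq_eq]
    refine integral_congr_ae ?_
    filter_upwards [hq.coeFn_toLp] with y hy
    rw [hQ, hy]
  rw [← h3]
  nlinarith [norm_nonneg Q, sq_nonneg (W - ‖Q‖)]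

/-- The Calderón–Zygmund bound for the pressure in `L²`. -/
lemma integral_pressure_sq_le {v₀ v : Plane → Plane} {q : Plane → ℝ} {c : ℝ}
    (hs : IsPerturbedLeraySolution v₀ v q) (h₀ : IsProfile v₀ c) (h : ContDiff ℝ 1 v)
    (hd : ∀ y, divergence v y = 0) (hq : MemLp q 2)
    (h4 : Integrable fun y => ‖v₀ y + v y‖ ^ 4) :
    ∫ y, q y ^ 2 ≤ ∫ y, ‖v₀ y + v y‖ ^ 4 := by
  have := integral_sq_le_of_integral_mul_lap_le hq fun η hη =>
    integral_mul_lap_le hs h₀ h hd hq h4 hη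
  rwa [Real.sq_sqrt (integral_nonneg fun y => by positivity)] at this

/-! ### The weighted estimate -/

/-- Weights of growth at least `|y|` and at most `|y|^σ`, where `σ < 2`, with the differential
inequalities satisfied by the powers of `1 + |y|²`. For `σ < 2` the weighted energy of a field in the
class `X` is finite, since such a field and its gradient are `O(|y|⁻²)`. -/
structure IsWeight (ψ : Plane → ℝ) (σ : ℝ) : Prop where
  contDiff : ContDiff ℝ 1 ψ
  lt_two : σ < 2
  le_two_mul : ∀ y, 1 + ‖y‖ ≤ 2 * ψ y
  le_rpow : ∀ y, ψ y ≤ (1 + ‖y‖) ^ σ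
  fderiv_le_rpow : ∀ y, (1 + ‖y‖) * ‖fderiv ℝ ψ y‖ ≤ 2 * (1 + ‖y‖) ^ σ
  fderiv_le_sqrt : ∀ y, ‖fderiv ℝ ψ y‖ ≤ 2 * √(ψ y)
  le_fderiv : ∀ y, ψ y - 1 ≤ fderiv ℝ ψ y y

section
variable {v₀ v : Plane → Plane} {q ψ : Plane → ℝ} {c m σ : ℝ}

lemma IsWeight.pos (hψ : IsWeight ψ σ) (y : Plane) : 0 < ψ y := by
  have := hψ.le_two_mul y
  linarith [norm_nonneg y]

lemma IsWeight.le_sq (hψ : IsWeight ψ σ) (y : Plane) : ψ y ≤ (1 + ‖y‖) ^ 2 := by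
  refine (hψ.le_rpow y).trans ?_
  rw [← Real.rpow_natCast]
  exact Real.rpow_le_rpow_of_exponent_le (by linarith [norm_nonneg y])
    (by push_cast; exact hψ.lt_two.le)

lemma IsWeight.sqrt_le (hψ : IsWeight ψ σ) (y : Plane) : √(ψ y) ≤ 1 + ‖y‖ :=
  Real.sqrt_le_iff.2 ⟨by positivity, hψ.le_sq y⟩

lemma IsWeight.integrable_mul (hψ : IsWeight ψ σ) {f : Plane → ℝ} (hf : Continuous f) {d : ℝ}
    (hd : ∀ y, |f y| ≤ d * ((1 + ‖y‖) ^ 4)⁻¹) : Integrable fun y => ψ y * f y := by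
  refine ((integrable_one_add_norm_rpow (p := 4 - σ) (by linarith [hψ.lt_two])).const_mul d).mono'
    (hψ.contDiff.continuous.mul hf).aestronglyMeasurable (ae_of_all _ fun y => ?_)
  rw [norm_mul, Real.norm_of_nonneg (hψ.pos y).le, Real.norm_eq_abs]
  have e := rpow_mul_inv_pow (J := 1 + ‖y‖) (by positivity) σ 4
  push_cast at e
  rw [← e]
  calc ψ y * |f y| ≤ (1 + ‖y‖) ^ σ * (d * ((1 + ‖y‖) ^ 4)⁻¹) :=
        mul_le_mul (hψ.le_rpow y) (hd y) (abs_nonneg _) (by positivity)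
    _ = _ := by ring

lemma IsDecaying.norm_sq_le (h : IsDecaying v m) (y : Plane) :
    ‖v y‖ ^ 2 ≤ m ^ 2 * ((1 + ‖y‖) ^ 4)⁻¹ := by
  calc ‖v y‖ ^ 2 ≤ (m * ((1 + ‖y‖) ^ 2)⁻¹) ^ 2 :=
        pow_le_pow_left₀ (norm_nonneg _) (h.decay y) 2
    _ = _ := by field_simp

lemma IsDecaying.gradSq_le_inv_pow (h : IsDecaying v m) (y : Plane) :
    gradSq v y ≤ 2 * m ^ 2 * ((1 + ‖y‖) ^ 4)⁻¹ := by
  refine (gradSq_le v y).trans ?_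
  calc 2 * ‖fderiv ℝ v y‖ ^ 2 ≤ 2 * (m * ((1 + ‖y‖) ^ 2)⁻¹) ^ 2 := by
        have := pow_le_pow_left₀ (norm_nonneg _) (h.fderiv_decay y) 2
        linarith
    _ = _ := by field_simp

lemma IsDecaying.integrable_weight_mul_norm_sq (h : IsDecaying v m) (hψ : IsWeight ψ σ) :
    Integrable fun y => ψ y * ‖v y‖ ^ 2 :=
  hψ.integrable_mul (h.contDiff.continuous.norm.pow 2) fun y => by
    rw [abs_of_nonneg (by positivity)]
    exact h.norm_sq_le y

lemma IsDecaying.integrable_weight_mul_gradSq (h : IsDecaying v m) (hψ : IsWeight ψ σ) :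
    Integrable fun y => ψ y * gradSq v y :=
  hψ.integrable_mul (continuous_gradSq h.contDiff) fun y => by
    rw [abs_of_nonneg (gradSq_nonneg v y)]
    exact h.gradSq_le_inv_pow y

lemma norm_sum_inner_pd_smul_le (v : Plane → Plane) (y : Plane) :
    ‖∑ i, (inner ℝ (pd i v y) (v y) : ℝ) • e i‖ ≤ √(gradSq v y) * ‖v y‖ := by
  rw [← Real.sqrt_sq (norm_nonneg (v y)), ← Real.sqrt_mul (gradSq_nonneg v y)]
  refine Real.le_sqrt_of_sq_le ?_
  rw [EuclideanSpace.real_norm_sq_eq, gradSq, Finset.sum_mul]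
  refine Finset.sum_le_sum fun i _ => ?_
  have h1 : (∑ j, (inner ℝ (pd j v y) (v y) : ℝ) • e j) i = inner ℝ (pd i v y) (v y) := by
    fin_cases i <;> simp [e]
  rw [h1, ← mul_pow, ← sq_abs]
  exact pow_le_pow_left₀ (abs_nonneg _) (abs_real_inner_le_norm _ _) 2

/-- The pointwise form of the weighted estimate: the terms that are neither dissipative nor damping
carry at most one factor `√ψ |v|`. -/
lemma weighted_pointwise_le (h₀ : IsProfile v₀ c) (hψ : IsWeight ψ σ) (y : Plane) :
    (1 / 2) * (ψ y * gradSq v y) + (1 / 4) * (ψ y * ‖v y‖ ^ 2) ≤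
      (ψ y * energyDensity v₀ v y + fderiv ℝ ψ y (energyFlux v₀ v q y))
      + (3 + c) * ‖v y‖ ^ 2 + √(ψ y) * ‖v y‖ * ‖v y‖ ^ 2 + c * (√(ψ y) * ‖v y‖ * ‖v y‖)
      + c * (√(ψ y) * ‖v y‖ * √(gradSq v₀ y)) + 2 * (√(ψ y) * ‖v y‖ * |q y|) := by
  have hc := h₀.nonneg
  set N := ‖v y‖ with hN
  have hN0 : 0 ≤ N := norm_nonneg _
  set h := √(ψ y) with hh
  have hh0 : 0 ≤ h := Real.sqrt_nonneg _
  have hsq : ψ y = h ^ 2 := (Real.sq_sqrt (hψ.pos y).le).symm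
  have hdψ : ‖fderiv ℝ ψ y‖ ≤ 2 * h := hψ.fderiv_le_sqrt y
  have hJ0 : 0 < 1 + ‖y‖ := by positivity
  have hv0 : h * ‖v₀ y‖ ≤ c :=
    (mul_le_mul_of_nonneg_right (hψ.sqrt_le y) (norm_nonneg _)).trans (h₀.decay y)
  have hd0 : h * ‖fderiv ℝ v₀ y‖ ≤ c :=
    (mul_le_mul_of_nonneg_right (hψ.sqrt_le y) (norm_nonneg _)).trans (h₀.fderiv_decay y)
  set G := √(gradSq v y) with hG
  have hG0 : 0 ≤ G := Real.sqrt_nonneg _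
  have hGsq : gradSq v y = G ^ 2 := (Real.sq_sqrt (gradSq_nonneg v y)).symm
  have ap : ∀ x : Plane, |fderiv ℝ ψ y x| ≤ 2 * h * ‖x‖ := fun x =>
    ((fderiv ℝ ψ y).le_opNorm x).trans (by gcongr)
  -- the diffusive flux, absorbed by half of the dissipation
  have t1 : -(1 / 2 * (h ^ 2 * G ^ 2) + 2 * N ^ 2) ≤
      fderiv ℝ ψ y (∑ i, (inner ℝ (pd i v y) (v y) : ℝ) • e i) := by
    have b1 := neg_le_of_abs_le (ap (∑ i, (inner ℝ (pd i v y) (v y) : ℝ) • e i))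
    have b2 : 2 * h * ‖∑ i, (inner ℝ (pd i v y) (v y) : ℝ) • e i‖ ≤ 2 * h * (G * N) :=
      mul_le_mul_of_nonneg_left (norm_sum_inner_pd_smul_le v y) (by positivity)
    nlinarith [sq_nonneg (h * G - 2 * N)]
  -- the damping
  have t2 : 1 / 4 * (N ^ 2 * (h ^ 2 - 1)) ≤ N ^ 2 / 4 * fderiv ℝ ψ y y := by
    have := mul_le_mul_of_nonneg_left (hψ.le_fderiv y) (sq_nonneg N)
    rw [hsq] at this
    linarith
  -- transport
  have t3 : N ^ 2 / 2 * fderiv ℝ ψ y (v₀ y + v y) ≤ c * N ^ 2 + h * N * N ^ 2 := by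
    have b1 := (le_abs_self _).trans (ap (v₀ y + v y))
    have b2 : 2 * h * ‖v₀ y + v y‖ ≤ 2 * c + 2 * h * N := by
      have := mul_le_mul_of_nonneg_left (norm_add_le (v₀ y) (v y)) hh0
      linarith
    have := mul_le_mul_of_nonneg_left (b1.trans b2) (sq_nonneg N)
    linarith
  -- pressure
  have t4 : q y * fderiv ℝ ψ y (v y) ≤ 2 * (h * N * |q y|) := by
    refine (le_abs_self _).trans ?_
    rw [abs_mul]
    have := mul_le_mul_of_nonneg_left (ap (v y)) (abs_nonneg (q y))
    linarith
  -- production; `√ψ` is absorbed by the decay of `v₀` and of `∇v₀`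
  have t5 : -(c * (h * N * N) + c * (h * N * √(gradSq v₀ y))) ≤
      h ^ 2 * inner ℝ (fderiv ℝ v₀ y (v₀ y + v y)) (v y) := by
    have b1 : ‖fderiv ℝ v₀ y (v₀ y + v y)‖ ≤ √(gradSq v₀ y) * ‖v₀ y‖ + ‖fderiv ℝ v₀ y‖ * N := by
      rw [map_add]
      refine (norm_add_le _ _).trans (add_le_add ?_ ((fderiv ℝ v₀ y).le_opNorm _))
      have := Real.sqrt_le_sqrt (norm_fderiv_apply_sq_le v₀ y (v₀ y))
      rwa [Real.sqrt_mul (gradSq_nonneg _ y), Real.sqrt_sq (norm_nonneg _),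
        Real.sqrt_sq (norm_nonneg _)] at this
    have b2 := neg_le_of_abs_le ((abs_real_inner_le_norm (fderiv ℝ v₀ y (v₀ y + v y)) (v y)).trans
      (mul_le_mul_of_nonneg_right b1 hN0))
    have b3 := mul_le_mul_of_nonneg_left b2 (sq_nonneg h)
    have b4 := mul_le_mul_of_nonneg_left hv0
      (show 0 ≤ h * N * √(gradSq v₀ y) by positivity)
    have b5 := mul_le_mul_of_nonneg_left hd0 (show 0 ≤ h * N * N by positivity)
    linarith
  have e1 : fderiv ℝ ψ y (energyFlux v₀ v q y) =
      fderiv ℝ ψ y (∑ i, (inner ℝ (pd i v y) (v y) : ℝ) • e i) + N ^ 2 / 4 * fderiv ℝ ψ y y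
        - N ^ 2 / 2 * fderiv ℝ ψ y (v₀ y + v y) - q y * fderiv ℝ ψ y (v y) := by
    rw [energyFlux, map_sub, map_sub, map_add, map_smul, map_smul, map_smul]
    simp only [smul_eq_mul]
    rfl
  rw [e1, energyDensity, hsq, hGsq]
  nlinarith [t1, t2, t3, t4, t5, sq_nonneg N]

lemma IsProfile.integrable_pow_four (h₀ : IsProfile v₀ c) : Integrable (fun y => ‖v₀ y‖ ^ 4) ∧
    ∫ y, ‖v₀ y‖ ^ 4 ≤ c ^ 4 * ∫ y : Plane, ((1 + ‖y‖) ^ 4)⁻¹ := by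
  have i4 := (integrable_inv_one_add_norm_pow (m := 4) (by norm_num)).const_mul (c ^ 4)
  have hle : ∀ y, ‖v₀ y‖ ^ 4 ≤ c ^ 4 * ((1 + ‖y‖) ^ 4)⁻¹ := fun y => by
    rw [← inv_pow, ← mul_pow]
    exact pow_le_pow_left₀ (norm_nonneg _) (h₀.norm_le y) 4
  have hi : Integrable fun y => ‖v₀ y‖ ^ 4 :=
    i4.mono' (h₀.contDiff.continuous.norm.pow 4).aestronglyMeasurable
      (ae_of_all _ fun y => by rw [Real.norm_of_nonneg (by positivity)]; exact hle y)
  refine ⟨hi, ?_⟩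
  rw [← integral_const_mul]
  exact integral_mono hi i4 hle

lemma integrable_norm_add_pow_four (h₀ : IsProfile v₀ c) (h : IsDecaying v m) :
    Integrable (fun y => ‖v₀ y + v y‖ ^ 4) ∧
    ∫ y, ‖v₀ y + v y‖ ^ 4 ≤ 8 * (∫ y, ‖v y‖ ^ 4)
      + 8 * (c ^ 4 * ∫ y : Plane, ((1 + ‖y‖) ^ 4)⁻¹) := by
  obtain ⟨i0, b0⟩ := h₀.integrable_pow_four
  have i1 := h.integrable_norm_pow (k := 4) (by norm_num)
  have hle : ∀ y, ‖v₀ y + v y‖ ^ 4 ≤ 8 * ‖v y‖ ^ 4 + 8 * ‖v₀ y‖ ^ 4 := fun y => by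
    have h1 := pow_le_pow_left₀ (norm_nonneg _) (norm_add_le (v₀ y) (v y)) 4
    have h2 := add_pow_le (norm_nonneg (v₀ y)) (norm_nonneg (v y)) 4
    norm_num at h2
    linarith
  have hi : Integrable fun y => ‖v₀ y + v y‖ ^ 4 := by
    refine ((i1.const_mul 8).add (i0.const_mul 8)).mono'
      ((h₀.contDiff.continuous.add h.contDiff.continuous).norm.pow 4).aestronglyMeasurable
      (ae_of_all _ fun y => ?_)
    rw [Real.norm_of_nonneg (by positivity)]
    exact hle y
  refine ⟨hi, (integral_mono hi ((i1.const_mul 8).add (i0.const_mul 8)) hle).trans ?_⟩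
  rw [integral_add' (i1.const_mul 8) (i0.const_mul 8), integral_const_mul, integral_const_mul]
  linarith

/-- Interpolation between the weighted `L²` norm and the `L⁴` norm. -/
lemma integral_norm_sq_le_interpolate (h : IsDecaying v m) (hψ : IsWeight ψ σ) {ε : ℝ}
    (hε : 0 < ε) : ∫ y, ‖v y‖ ^ 2 ≤ ε * (∫ y, ψ y * ‖v y‖ ^ 2)
      + 4 * (ε ^ 2)⁻¹ * (√(∫ y, ‖v y‖ ^ 4) * √(∫ y : Plane, ((1 + ‖y‖) ^ 4)⁻¹)) := by
  have i2 := h.integrable_norm_pow (k := 2) le_rfl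
  have i4 := h.integrable_norm_pow (k := 4) (by norm_num)
  have iψ := h.integrable_weight_mul_norm_sq hψ
  have m1 : MemLp (fun y => ‖v y‖ ^ 2) 2 := by
    rw [memLp_two_iff_integrable_sq (f := fun y => ‖v y‖ ^ 2)
      (h.contDiff.continuous.norm.pow 2).aestronglyMeasurable]
    exact i4.congr (ae_of_all _ fun y => by ring)
  have hcont : Continuous fun y : Plane => ((1 + ‖y‖) ^ 2)⁻¹ :=
    Continuous.inv₀ (by fun_prop) fun y => by positivity
  have m2 : MemLp (fun y : Plane => ((1 + ‖y‖) ^ 2)⁻¹) 2 := by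
    rw [memLp_two_iff_integrable_sq hcont.aestronglyMeasurable]
    refine (integrable_inv_one_add_norm_pow (m := 4) (by norm_num)).congr (ae_of_all _ fun y => ?_)
    simp only
    rw [← inv_pow, ← inv_pow, ← pow_mul]
  have i12 : Integrable fun y => ‖v y‖ ^ 2 * ((1 + ‖y‖) ^ 2)⁻¹ := m1.integrable_mul m2
  have hle : ∀ y, ‖v y‖ ^ 2 ≤ ε * (ψ y * ‖v y‖ ^ 2)
      + 4 * (ε ^ 2)⁻¹ * (‖v y‖ ^ 2 * ((1 + ‖y‖) ^ 2)⁻¹) := by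
    intro y
    have hp := hψ.pos y
    -- `1 ≤ εψ + (εψ)⁻²`, and `ψ⁻¹ ≤ 2 (1 + |y|)⁻¹`
    have h1 : 1 ≤ ε * ψ y + 4 * (ε ^ 2)⁻¹ * ((1 + ‖y‖) ^ 2)⁻¹ := by
      rcases le_total 1 (ε * ψ y) with h1 | h1
      · have : 0 ≤ 4 * (ε ^ 2)⁻¹ * ((1 + ‖y‖) ^ 2)⁻¹ := by positivity
        linarith
      · have h2 : ε * (1 + ‖y‖) ≤ 2 := by
          have := mul_le_mul_of_nonneg_left (hψ.le_two_mul y) hε.le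
          linarith
        have h3 : (ε * (1 + ‖y‖)) ^ 2 ≤ 2 ^ 2 := pow_le_pow_left₀ (by positivity) h2 2
        have h4 : 1 ≤ 4 * (ε ^ 2)⁻¹ * ((1 + ‖y‖) ^ 2)⁻¹ := by
          rw [mul_assoc, ← mul_inv, ← mul_pow, ← div_eq_mul_inv, le_div_iff₀ (by positivity)]
          linarith
        have : 0 ≤ ε * ψ y := by positivity
        linarith
    have := mul_le_mul_of_nonneg_right h1 (sq_nonneg ‖v y‖)
    linarith
  have := integral_mono i2 ((iψ.const_mul ε).add (i12.const_mul (4 * (ε ^ 2)⁻¹))) hle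
  rw [integral_add' (iψ.const_mul ε) (i12.const_mul _), integral_const_mul,
    integral_const_mul] at this
  refine this.trans ?_
  have h5 := integral_mul_le_sqrt m1 m2
  have e1 : ∀ y, (‖v y‖ ^ 2) ^ 2 = ‖v y‖ ^ 4 := fun y => by ring
  have e2 : ∀ y : Plane, (((1 + ‖y‖) ^ 2)⁻¹) ^ 2 = ((1 + ‖y‖) ^ 4)⁻¹ := fun y => by
    rw [inv_pow, ← pow_mul]
  simp_rw [e1, e2] at h5
  gcongr

/-- The weighted estimate, with the norms of the lower order terms still on the right. -/
lemma weighted_integral_le (hs : IsPerturbedLeraySolution v₀ v q) (h₀ : IsProfile v₀ c)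
    (h : IsDecaying v m) (hq : MemLp q 2) (hψ : IsWeight ψ σ) :
    (1 / 2) * (∫ y, ψ y * gradSq v y) + (1 / 4) * (∫ y, ψ y * ‖v y‖ ^ 2) ≤
      (3 + c) * (∫ y, ‖v y‖ ^ 2) + √(∫ y, ψ y * ‖v y‖ ^ 2) * (√(∫ y, ‖v y‖ ^ 4)
        + c * √(∫ y, ‖v y‖ ^ 2) + c * √(∫ y, gradSq v₀ y) + 2 * √(∫ y, q y ^ 2)) := by
  have i2 := h.integrable_norm_pow (k := 2) le_rfl
  have i4 := h.integrable_norm_pow (k := 4) (by norm_num)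
  have iψ := h.integrable_weight_mul_norm_sq hψ
  have iG := h.integrable_weight_mul_gradSq hψ
  obtain ⟨iE, hE⟩ := weighted_energy_identity hs h₀ h hq hψ.contDiff hψ.lt_two
    (fun y => by rw [abs_of_pos (hψ.pos y)]; exact hψ.le_rpow y) hψ.fderiv_le_rpow
  have hsqrt : ∀ y, (√(ψ y) * ‖v y‖) ^ 2 = ψ y * ‖v y‖ ^ 2 := fun y => by
    rw [mul_pow, Real.sq_sqrt (hψ.pos y).le]
  have mh : MemLp (fun y => √(ψ y) * ‖v y‖) 2 := by
    rw [memLp_two_iff_integrable_sq (f := fun y => √(ψ y) * ‖v y‖)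
      (hψ.contDiff.continuous.sqrt.mul h.contDiff.continuous.norm).aestronglyMeasurable]
    exact iψ.congr (ae_of_all _ fun y => (hsqrt y).symm)
  have m4 : MemLp (fun y => ‖v y‖ ^ 2) 2 := by
    rw [memLp_two_iff_integrable_sq (f := fun y => ‖v y‖ ^ 2)
      (h.contDiff.continuous.norm.pow 2).aestronglyMeasurable]
    exact i4.congr (ae_of_all _ fun y => by ring)
  have m2 := memLp_norm h.contDiff.continuous i2
  have mG := memLp_sqrt_gradSq h₀.contDiff h₀.integrable_gradSq
  have mq : MemLp (fun y => |q y|) 2 := hq.abs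
  have j1 : Integrable fun y => √(ψ y) * ‖v y‖ * ‖v y‖ ^ 2 := mh.integrable_mul m4
  have j2 : Integrable fun y => √(ψ y) * ‖v y‖ * ‖v y‖ := mh.integrable_mul m2
  have j3 : Integrable fun y => √(ψ y) * ‖v y‖ * √(gradSq v₀ y) := mh.integrable_mul mG
  have j4 : Integrable fun y => √(ψ y) * ‖v y‖ * |q y| := mh.integrable_mul mq
  have b1 := integral_mul_le_sqrt mh m4
  have b2 := integral_mul_le_sqrt mh m2
  have b3 := integral_mul_le_sqrt mh mG
  have b4 := integral_mul_le_sqrt mh mq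
  have e1 : ∀ y, (‖v y‖ ^ 2) ^ 2 = ‖v y‖ ^ 4 := fun y => by ring
  simp only [hsqrt, e1, sq_abs, Real.sq_sqrt (gradSq_nonneg v₀ _)] at b1 b2 b3 b4
  have r1 := iE.add (i2.const_mul (3 + c))
  have r2 := r1.add j1
  have r3 := r2.add (j2.const_mul c)
  have r4 := r3.add (j3.const_mul c)
  have r5 := r4.add (j4.const_mul 2)
  have hint := integral_mono ((iG.const_mul (1 / 2)).add (iψ.const_mul (1 / 4))) r5
    fun y => weighted_pointwise_le (q := q) (v := v) h₀ hψ y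
  rw [integral_add' (iG.const_mul _) (iψ.const_mul _), integral_const_mul,
    integral_const_mul] at hint
  refine hint.trans ?_
  rw [integral_add' r4 (j4.const_mul 2), integral_add' r3 (j3.const_mul c),
    integral_add' r2 (j2.const_mul c), integral_add' r1 j1,
    integral_add' iE (i2.const_mul (3 + c)), hE, integral_const_mul, integral_const_mul,
    integral_const_mul, integral_const_mul]
  have hc := h₀.nonneg
  have := mul_le_mul_of_nonneg_left b2 hc
  have := mul_le_mul_of_nonneg_left b3 hc
  linarith

end

/-- The constant resulting from the absorption of the lower order terms, in terms of the constant of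
the profile, the constant in `‖v‖₄² ≤ τ ‖v‖₂`, and the `L²` norm of `(1 + |y|)⁻²`. -/
def absorbConst (c τ I : ℝ) : ℝ :=
  16 * ((3 + c + 4 * (7 * τ + c) ^ 2)
      * (4 * ((1 / (32 * (3 + c + 4 * (7 * τ + c) ^ 2))) ^ 2)⁻¹ * (τ * I)) ^ 2
    + 4 * (c * √c + 6 * c ^ 2 * I) ^ 2)

/-- The weighted inequality closes: `K` is absorbed on the left, and `J` by interpolation with small
parameter `ε`. -/
lemma le_absorbConst {P K J X Q D c τ I : ℝ} (hP : 0 ≤ P) (hK : 0 ≤ K) (hc : 0 ≤ c) (hI : 0 ≤ I)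
    (h1 : (1 / 2) * P + (1 / 4) * K ^ 2 ≤ (3 + c) * J ^ 2 + K * (X + c * J + c * D + 2 * Q))
    (h2 : X ≤ τ * J) (h3 : Q ≤ 3 * X + 3 * c ^ 2 * I) (h4 : D ≤ √c)
    (h5 : ∀ ε : ℝ, 0 < ε → J ^ 2 ≤ ε * K ^ 2 + 4 * (ε ^ 2)⁻¹ * (X * I)) :
    P + K ^ 2 ≤ absorbConst c τ I := by
  unfold absorbConst
  set a := 3 + c + 4 * (7 * τ + c) ^ 2 with ha
  have ha0 : 0 < a := by positivity
  set d := c * √c + 6 * c ^ 2 * I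
  set b := 7 * τ + c with hb
  have s1 : X + c * J + c * D + 2 * Q ≤ b * J + d := by
    have := mul_le_mul_of_nonneg_left h4 hc
    linarith
  have s2 := mul_le_mul_of_nonneg_left s1 hK
  have s3 : (1 / 2) * P + (1 / 8) * K ^ 2 ≤ a * J ^ 2 + 4 * d ^ 2 := by
    nlinarith [sq_nonneg (K - 8 * (b * J)), sq_nonneg (K - 8 * d)]
  -- `ε` is so small that `2 a ε K²` is half of the remaining `K² / 8`
  set ε := 1 / (32 * a) with hε
  have hε0 : 0 < ε := by positivity
  have hεa : a * ε = 1 / 32 := by rw [hε]; field_simp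
  set T := 4 * (ε ^ 2)⁻¹ * (τ * I) with hT
  have s4 : J ^ 2 ≤ 2 * (ε * K ^ 2) + T ^ 2 := by
    have h6 := h5 ε hε0
    have h7 : 4 * (ε ^ 2)⁻¹ * (X * I) ≤ T * J := by
      have : X * I ≤ τ * J * I := mul_le_mul_of_nonneg_right h2 hI
      have := mul_le_mul_of_nonneg_left this (show 0 ≤ 4 * (ε ^ 2)⁻¹ by positivity)
      rw [hT]; linarith
    nlinarith [sq_nonneg (J - T)]
  have s5 := mul_le_mul_of_nonneg_left s4 ha0.le
  have s6 : a * (2 * (ε * K ^ 2) + T ^ 2) = 1 / 16 * K ^ 2 + a * T ^ 2 := by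
    calc _ = 2 * (a * ε) * K ^ 2 + a * T ^ 2 := by ring
      _ = _ := by rw [hεa]; ring
  linarith

/-- The weighted bound is uniform over the weights and over the solutions with a given profile
constant. -/
lemma exists_weighted_bound (c : ℝ) : ∃ B : ℝ, ∀ {v₀ v : Plane → Plane} {q ψ : Plane → ℝ}
    {m σ : ℝ}, IsPerturbedLeraySolution v₀ v q → IsProfile v₀ c → IsDecaying v m → MemLp q 2 →
    IsWeight ψ σ → (∫ y, ψ y * gradSq v y) + ∫ y, ψ y * ‖v y‖ ^ 2 ≤ B := by
  refine ⟨absorbConst c √(16 * sobolevConst * c) √(∫ y : Plane, ((1 + ‖y‖) ^ 4)⁻¹),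
    fun {v₀ v q ψ m σ} hs h₀ h hq hψ => ?_⟩
  have hc := h₀.nonneg
  have hK0 : 0 ≤ ∫ y, ψ y * ‖v y‖ ^ 2 :=
    integral_nonneg fun y => mul_nonneg (hψ.pos y).le (sq_nonneg _)
  have hJ0 : 0 ≤ ∫ y, ‖v y‖ ^ 2 := integral_nonneg fun y => sq_nonneg _
  have h40 : 0 ≤ ∫ y, ‖v y‖ ^ 4 := integral_nonneg fun y => by positivity
  have hI0 : 0 ≤ ∫ y : Plane, ((1 + ‖y‖) ^ 4)⁻¹ := integral_nonneg fun y => by positivity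
  have hS := sobolevConst_nonneg
  have key := weighted_integral_le hs h₀ h hq hψ
  have hX : √(∫ y, ‖v y‖ ^ 4) ≤ √(16 * sobolevConst * c) * √(∫ y, ‖v y‖ ^ 2) := by
    rw [← Real.sqrt_mul (by positivity)]
    refine Real.sqrt_le_sqrt (h.integral_norm_pow_four_le.trans ?_)
    have h1 := integral_gradSq_le hs h₀ h hq
    calc _ ≤ 4 * sobolevConst * ((∫ y, ‖v y‖ ^ 2) * (4 * c)) := by gcongr
      _ = _ := by ring
  have hQ : √(∫ y, q y ^ 2) ≤ 3 * √(∫ y, ‖v y‖ ^ 4)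
      + 3 * c ^ 2 * √(∫ y : Plane, ((1 + ‖y‖) ^ 4)⁻¹) := by
    obtain ⟨iV, bV⟩ := integrable_norm_add_pow_four h₀ h
    refine Real.sqrt_le_iff.2 ⟨by positivity, ?_⟩
    refine ((integral_pressure_sq_le hs h₀ h.contDiff h.div_eq_zero hq iV).trans bV).trans ?_
    have r1 := Real.sq_sqrt h40
    have r2 := Real.sq_sqrt hI0
    have r3 : 0 ≤ √(∫ y, ‖v y‖ ^ 4) * (c ^ 2 * √(∫ y : Plane, ((1 + ‖y‖) ^ 4)⁻¹)) := by
      positivity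
    have r4 : 0 ≤ c ^ 4 * ∫ y : Plane, ((1 + ‖y‖) ^ 4)⁻¹ := by positivity
    have r5 : (3 * √(∫ y, ‖v y‖ ^ 4) + 3 * c ^ 2 * √(∫ y : Plane, ((1 + ‖y‖) ^ 4)⁻¹)) ^ 2
        = 9 * √(∫ y, ‖v y‖ ^ 4) ^ 2 + 18 * (√(∫ y, ‖v y‖ ^ 4)
          * (c ^ 2 * √(∫ y : Plane, ((1 + ‖y‖) ^ 4)⁻¹)))
          + 9 * (c ^ 4 * √(∫ y : Plane, ((1 + ‖y‖) ^ 4)⁻¹) ^ 2) := by ring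
    rw [r5, r1, r2]
    linarith
  have hD : √(∫ y, gradSq v₀ y) ≤ √c := Real.sqrt_le_sqrt h₀.integral_gradSq_le
  have := le_absorbConst (P := ∫ y, ψ y * gradSq v y) (K := √(∫ y, ψ y * ‖v y‖ ^ 2))
    (J := √(∫ y, ‖v y‖ ^ 2)) (I := √(∫ y : Plane, ((1 + ‖y‖) ^ 4)⁻¹))
    (integral_nonneg fun y => mul_nonneg (hψ.pos y).le (gradSq_nonneg v y))
    (Real.sqrt_nonneg _) hc (Real.sqrt_nonneg _)
    (by rw [Real.sq_sqrt hK0, Real.sq_sqrt hJ0]; exact key) hX hQ hD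
    fun ε hε => by
      rw [Real.sq_sqrt hK0, Real.sq_sqrt hJ0]
      exact integral_norm_sq_le_interpolate h hψ hε
  rwa [Real.sq_sqrt hK0] at this

/-! ### The critical weight -/

/-- The weights `(1 + |y|²)^s`. -/
def powWeight (s : ℝ) (y : Plane) : ℝ := (1 + ‖y‖ ^ 2) ^ s

lemma hasFDerivAt_powWeight (s : ℝ) (y : Plane) : HasFDerivAt (powWeight s)
    ((s * (1 + ‖y‖ ^ 2) ^ (s - 1)) • ((2 : ℝ) • innerSL ℝ y)) y := by
  have h1 : HasFDerivAt (fun y : Plane => 1 + ‖y‖ ^ 2) ((2 : ℝ) • innerSL ℝ y) y := by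
    have := ((hasStrictFDerivAt_norm_sq y).hasFDerivAt).const_add (1 : ℝ)
    simpa [two_smul] using this
  exact h1.rpow_const (Or.inl (by positivity))

lemma fderiv_powWeight (s : ℝ) (y h : Plane) :
    fderiv ℝ (powWeight s) y h = 2 * s * (1 + ‖y‖ ^ 2) ^ (s - 1) * inner ℝ y h := by
  rw [(hasFDerivAt_powWeight s y).fderiv]
  simp
  ring

lemma contDiff_powWeight (s : ℝ) : ContDiff ℝ 1 (powWeight s) := by
  have h : ContDiff ℝ 1 fun y : Plane => 1 + ‖y‖ ^ 2 := contDiff_const.add (contDiff_norm_sq ℝ)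
  exact h.rpow_const_of_ne fun y => by positivity

lemma norm_le_rpow_half (y : Plane) : ‖y‖ ≤ (1 + ‖y‖ ^ 2) ^ (1 / 2 : ℝ) := by
  rw [← Real.sqrt_eq_rpow]
  exact Real.le_sqrt_of_sq_le (by linarith)

lemma norm_fderiv_powWeight_le {s : ℝ} (h0 : 0 ≤ s) (h1 : s ≤ 1) (y : Plane) :
    ‖fderiv ℝ (powWeight s) y‖ ≤ 2 * (1 + ‖y‖ ^ 2) ^ (s - 1 / 2) := by
  have hw : 0 < 1 + ‖y‖ ^ 2 := by positivity
  refine ContinuousLinearMap.opNorm_le_bound _ (by positivity) fun h => ?_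
  rw [fderiv_powWeight, norm_mul, Real.norm_of_nonneg (by positivity)]
  have e : (1 + ‖y‖ ^ 2) ^ (s - 1 / 2) = (1 + ‖y‖ ^ 2) ^ (s - 1) * (1 + ‖y‖ ^ 2) ^ (1 / 2 : ℝ) := by
    rw [← Real.rpow_add hw]; congr 1; ring
  rw [e]
  calc 2 * s * (1 + ‖y‖ ^ 2) ^ (s - 1) * ‖(inner ℝ y h : ℝ)‖
      ≤ 2 * 1 * (1 + ‖y‖ ^ 2) ^ (s - 1) * ((1 + ‖y‖ ^ 2) ^ (1 / 2 : ℝ) * ‖h‖) := by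
        gcongr
        exact (norm_inner_le_norm _ _).trans (by gcongr; exact norm_le_rpow_half y)
    _ = _ := by ring

lemma rpow_one_add_sq_le {t : ℝ} (ht : 0 ≤ t) (y : Plane) :
    (1 + ‖y‖ ^ 2) ^ t ≤ (1 + ‖y‖) ^ (2 * t) := by
  rw [Real.rpow_mul (by positivity)]
  refine Real.rpow_le_rpow (by positivity) ?_ ht
  rw [Real.rpow_two]
  nlinarith [norm_nonneg y]

/-- The restriction `s ≥ 1/2` gives full damping, and `s ≤ 1` the bound `|∇ψ| ≤ 2 √ψ`. -/
lemma isWeight_powWeight {s : ℝ} (h0 : 1 / 2 ≤ s) (h1 : s < 1) :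
    IsWeight (powWeight s) (2 * s) where
  contDiff := contDiff_powWeight s
  lt_two := by linarith
  le_two_mul y := by
    have hw : 1 ≤ 1 + ‖y‖ ^ 2 := by linarith [sq_nonneg ‖y‖]
    have a1 : (1 + ‖y‖ ^ 2) ^ (1 / 2 : ℝ) ≤ powWeight s y :=
      Real.rpow_le_rpow_of_exponent_le hw h0
    have a2 : 1 ≤ (1 + ‖y‖ ^ 2) ^ (1 / 2 : ℝ) := Real.one_le_rpow hw (by norm_num)
    linarith [norm_le_rpow_half y]
  le_rpow y := rpow_one_add_sq_le (by linarith) y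
  fderiv_le_rpow y := by
    have hJ : 0 < 1 + ‖y‖ := by positivity
    have a1 := norm_fderiv_powWeight_le (by linarith) h1.le y
    have a2 := rpow_one_add_sq_le (t := s - 1 / 2) (by linarith) y
    have e : (1 + ‖y‖) ^ (2 * s) = (1 + ‖y‖) * (1 + ‖y‖) ^ (2 * (s - 1 / 2)) := by
      nth_rewrite 2 [← Real.rpow_one (1 + ‖y‖)]
      rw [← Real.rpow_add hJ]
      congr 1
      ring
    rw [e]
    calc _ ≤ (1 + ‖y‖) * (2 * (1 + ‖y‖) ^ (2 * (s - 1 / 2))) := by gcongr; linarith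
      _ = _ := by ring
  fderiv_le_sqrt y := by
    refine (norm_fderiv_powWeight_le (by linarith) h1.le y).trans ?_
    rw [Real.sqrt_eq_rpow, powWeight, ← Real.rpow_mul (by positivity)]
    have hw : 1 ≤ 1 + ‖y‖ ^ 2 := by linarith [sq_nonneg ‖y‖]
    exact mul_le_mul_of_nonneg_left (Real.rpow_le_rpow_of_exponent_le hw (by linarith))
      (by norm_num)
  le_fderiv y := by
    have hw0 : 0 < 1 + ‖y‖ ^ 2 := by positivity
    have hw : 1 ≤ 1 + ‖y‖ ^ 2 := by linarith [sq_nonneg ‖y‖]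
    rw [fderiv_powWeight, real_inner_self_eq_norm_sq]
    have a1 : (1 + ‖y‖ ^ 2) ^ (s - 1) ≤ 1 := Real.rpow_le_one_of_one_le_of_nonpos hw (by linarith)
    have a2 : powWeight s y = (1 + ‖y‖ ^ 2) ^ (s - 1) * (1 + ‖y‖ ^ 2) := by
      rw [powWeight, Real.rpow_sub_one hw0.ne', div_mul_cancel₀ _ hw0.ne']
    have a3 : 0 ≤ (1 + ‖y‖ ^ 2) ^ (s - 1) * ‖y‖ ^ 2 := by positivity
    rw [a2]
    nlinarith

/-- The limit `s → 1` in the weighted bound. -/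
lemma exists_critical_bound (c : ℝ) : ∃ B : ℝ, ∀ {v₀ v : Plane → Plane} {q : Plane → ℝ}
    {m : ℝ}, IsPerturbedLeraySolution v₀ v q → IsProfile v₀ c → IsDecaying v m → MemLp q 2 →
    Integrable (fun y => (1 + ‖y‖ ^ 2) * (gradSq v y + ‖v y‖ ^ 2)) ∧
      ∫ y, (1 + ‖y‖ ^ 2) * (gradSq v y + ‖v y‖ ^ 2) ≤ B := by
  obtain ⟨B, hB⟩ := exists_weighted_bound c
  refine ⟨B, fun {v₀ v q m} hs h₀ h hq => ?_⟩
  set s : ℕ → ℝ := fun n => 1 - 1 / 2 * (1 / ((n : ℝ) + 1)) with hs_def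
  have hlim : Tendsto s atTop (𝓝 1) := by
    have := (tendsto_one_div_add_atTop_nhds_zero_nat (𝕜 := ℝ)).const_mul (1 / 2)
    simpa [hs_def] using this.const_sub 1
  have hψ : ∀ n, IsWeight (powWeight (s n)) (2 * s n) := fun n => by
    have h1 : (0 : ℝ) < 1 / ((n : ℝ) + 1) := by positivity
    have h2 : 1 / ((n : ℝ) + 1) ≤ 1 := by
      rw [div_le_one (by positivity)]
      linarith [n.cast_nonneg (α := ℝ)]
    exact isWeight_powWeight (by simp only [hs_def]; linarith) (by simp only [hs_def]; linarith)
  have i1 := fun n => h.integrable_weight_mul_gradSq (hψ n)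
  have i2 := fun n => h.integrable_weight_mul_norm_sq (hψ n)
  refine integrable_of_tendsto
    (f := fun n y => powWeight (s n) y * gradSq v y + powWeight (s n) y * ‖v y‖ ^ 2)
    (B := fun _ => B) (fun n => (i1 n).add (i2 n)) (fun n y => ?_) (fun y => ?_) (fun n => ?_)
    tendsto_const_nhds
  · have := ((hψ n).pos y).le
    have := gradSq_nonneg v y
    positivity
  · have hw : Tendsto (fun n => powWeight (s n) y) atTop (𝓝 (1 + ‖y‖ ^ 2)) := by
      have := (Real.continuousAt_const_rpow (a := 1 + ‖y‖ ^ 2) (b := 1)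
        (by positivity)).tendsto.comp hlim
      rwa [Real.rpow_one] at this
    rw [mul_add]
    exact (hw.mul_const _).add (hw.mul_const _)
  · rw [integral_add (i1 n) (i2 n)]
    exact hB hs h₀ h hq (hψ n)

/-! ### The weighted field in `H¹` -/

lemma isWeakGradient_pd {f : Plane → Plane} (hf : ContDiff ℝ 1 f) :
    IsWeakGradient f fun i => pd i f := by
  refine ⟨hf.continuous.locallyIntegrable, fun i =>
    ⟨(continuous_pd hf i).locallyIntegrable, fun φ hφ => ?_⟩⟩
  have hφ1 := hφ.1.of_le one_le_smooth
  have hdφ := hφ1.continuous_fderiv one_ne_zero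
  have hd := hf.continuous_fderiv one_ne_zero
  have hcf := hf.continuous
  have hcφ := hφ1.continuous
  have i1 : Integrable fun y => fderiv ℝ φ y (e i) • f y :=
    integrable_of_tsupport (θ := φ) (by fun_prop) hφ.2 fun y _ h => by simp [h]
  have i2 : Integrable fun y => φ y • fderiv ℝ f y (e i) :=
    integrable_of_tsupport (θ := φ) (hcφ.smul (continuous_pd hf i)) hφ.2 fun y h _ => by simp [h]
  have i3 : Integrable fun y => φ y • f y :=
    integrable_of_tsupport (θ := φ) (by fun_prop) hφ.2 fun y h _ => by simp [h]
  have := integral_smul_fderiv_eq_neg_fderiv_smul_of_integrable i1 i2 i3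
    (fun y _ => hφ1.differentiable one_ne_zero y) fun y _ => hf.differentiable one_ne_zero y
  change _ = -∫ y, φ y • fderiv ℝ f y (e i)
  rw [this, neg_neg]

lemma eLpNorm_two_sq_eq {f : Plane → Plane} (hf : MemLp f 2) :
    eLpNorm f 2 volume ^ 2 = ENNReal.ofReal (∫ y, ‖f y‖ ^ 2) := by
  rw [hf.eLpNorm_eq_integral_rpow_norm (by norm_num) (by norm_num)]
  have h0 : 0 ≤ ∫ y, ‖f y‖ ^ 2 := integral_nonneg fun y => sq_nonneg _
  simp only [ENNReal.toReal_ofNat, Real.rpow_two]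
  rw [← ENNReal.ofReal_pow (Real.rpow_nonneg h0 _), ← Real.rpow_natCast, ← Real.rpow_mul h0]
  norm_num

/-- The `H¹` norm of a continuously differentiable field. -/
lemma memH1_of_contDiff {f : Plane → Plane} (hf : ContDiff ℝ 1 f) {b : ℝ}
    (hi : Integrable fun y => ‖f y‖ ^ 2 + gradSq f y)
    (hb : ∫ y, (‖f y‖ ^ 2 + gradSq f y) ≤ b) :
    MemH1 f ∧ eH1Norm f ≤ (Real.toNNReal (√b) : ℝ≥0∞) := by
  have cG := continuous_gradSq hf
  have bound : ∀ {g : Plane → Plane}, Continuous g → (∀ y, ‖g y‖ ^ 2 ≤ ‖f y‖ ^ 2 + gradSq f y) →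
      MemLp g 2 ∧ Integrable fun y => ‖g y‖ ^ 2 := by
    intro g hg hle
    have : Integrable fun y => ‖g y‖ ^ 2 :=
      hi.mono' (hg.norm.pow 2).aestronglyMeasurable (ae_of_all _ fun y => by
        rw [Real.norm_of_nonneg (sq_nonneg _)]; exact hle y)
    exact ⟨(memLp_two_iff_integrable_sq_norm hg.aestronglyMeasurable).2 this, this⟩
  obtain ⟨mf, jf⟩ := bound hf.continuous fun y => by linarith [gradSq_nonneg f y]
  have hp := fun i => bound (continuous_pd hf i) fun y => by
    have := Finset.single_le_sum (f := fun i => ‖pd i f y‖ ^ 2) (fun i _ => sq_nonneg _)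
      (Finset.mem_univ i)
    have : ‖pd i f y‖ ^ 2 ≤ gradSq f y := this
    linarith [sq_nonneg ‖f y‖]
  refine ⟨⟨mf, _, isWeakGradient_pd hf, fun i => (hp i).1⟩, ?_⟩
  refine (iInf₂_le (fun i => pd i f) (isWeakGradient_pd hf)).trans ?_
  have e1 : eLpNorm f 2 volume ^ 2 + ∑ i, eLpNorm (pd i f) 2 volume ^ 2
      = ENNReal.ofReal (∫ y, (‖f y‖ ^ 2 + gradSq f y)) := by
    simp_rw [eLpNorm_two_sq_eq mf, fun i => eLpNorm_two_sq_eq (hp i).1]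
    rw [← ENNReal.ofReal_sum_of_nonneg fun i _ => integral_nonneg fun y => sq_nonneg _,
      ← ENNReal.ofReal_add (integral_nonneg fun y => sq_nonneg _)
        (Finset.sum_nonneg fun i _ => integral_nonneg fun y => sq_nonneg _),
      ← integral_finsetSum _ fun i _ => (hp i).2,
      ← integral_add jf (integrable_finsetSum _ fun i _ => (hp i).2)]
    rfl
  rw [e1, ENNReal.ofReal_rpow_of_nonneg (integral_nonneg fun y =>
    add_nonneg (sq_nonneg _) (gradSq_nonneg f y)) (by norm_num), ← Real.sqrt_eq_rpow]
  exact ENNReal.ofReal_le_ofReal (Real.sqrt_le_sqrt hb)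

lemma contDiff_sqrt_weight : ContDiff ℝ 1 fun y : Plane => √(1 + ‖y‖ ^ 2) :=
  (contDiff_const.add (contDiff_norm_sq ℝ)).sqrt fun y => by positivity

lemma norm_fderiv_sqrt_weight_le (y : Plane) :
    ‖fderiv ℝ (fun y : Plane => √(1 + ‖y‖ ^ 2)) y‖ ≤ 2 := by
  have e1 : (fun y : Plane => √(1 + ‖y‖ ^ 2)) = powWeight (1 / 2) := by
    funext z; rw [Real.sqrt_eq_rpow]; rfl
  rw [e1]
  simpa using norm_fderiv_powWeight_le (s := 1 / 2) (by norm_num) (by norm_num) y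

lemma gradSq_weightedField_le {v : Plane → Plane} (hv : ContDiff ℝ 1 v) (y : Plane) :
    gradSq (weightedField v) y ≤ 2 * ((1 + ‖y‖ ^ 2) * gradSq v y) + 16 * ‖v y‖ ^ 2 := by
  have h1 : ∀ i, ‖pd i (weightedField v) y‖ ^ 2
      ≤ 2 * ((1 + ‖y‖ ^ 2) * ‖pd i v y‖ ^ 2) + 8 * ‖v y‖ ^ 2 := by
    intro i
    have e1 : pd i (weightedField v) y = √(1 + ‖y‖ ^ 2) • pd i v y
        + fderiv ℝ (fun y : Plane => √(1 + ‖y‖ ^ 2)) y (e i) • v y :=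
      fderiv_smul_field contDiff_sqrt_weight hv y (e i)
    have a1 : ‖fderiv ℝ (fun y : Plane => √(1 + ‖y‖ ^ 2)) y (e i) • v y‖ ≤ 2 * ‖v y‖ := by
      rw [norm_smul]
      gcongr
      have := (fderiv ℝ (fun y : Plane => √(1 + ‖y‖ ^ 2)) y).le_opNorm (e i)
      rw [norm_e, mul_one] at this
      exact this.trans (norm_fderiv_sqrt_weight_le y)
    have a2 : ‖√(1 + ‖y‖ ^ 2) • pd i v y‖ ^ 2 = (1 + ‖y‖ ^ 2) * ‖pd i v y‖ ^ 2 := by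
      rw [norm_smul, mul_pow, Real.norm_of_nonneg (Real.sqrt_nonneg _),
        Real.sq_sqrt (by positivity)]
    rw [e1, ← a2]
    have a3 := (norm_add_le (√(1 + ‖y‖ ^ 2) • pd i v y)
      (fderiv ℝ (fun y : Plane => √(1 + ‖y‖ ^ 2)) y (e i) • v y)).trans
      (add_le_add_right a1 _)
    have a4 := pow_le_pow_left₀ (norm_nonneg _) a3 2
    nlinarith [sq_nonneg (‖√(1 + ‖y‖ ^ 2) • pd i v y‖ - 2 * ‖v y‖)]
  have := h1 0
  have := h1 1
  unfold gradSq
  rw [Fin.sum_univ_two, Fin.sum_univ_two]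
  linarith

/-- The weighted field is bounded in `H¹` by its weighted energy. -/
lemma memH1_weightedField {v : Plane → Plane} (hv : ContDiff ℝ 1 v) {B : ℝ}
    (hi : Integrable fun y => (1 + ‖y‖ ^ 2) * (gradSq v y + ‖v y‖ ^ 2))
    (hB : ∫ y, (1 + ‖y‖ ^ 2) * (gradSq v y + ‖v y‖ ^ 2) ≤ B) :
    MemH1 (weightedField v) ∧
      eH1Norm (weightedField v) ≤ (Real.toNNReal (√(17 * B)) : ℝ≥0∞) := by
  have hf : ContDiff ℝ 1 (weightedField v) := contDiff_sqrt_weight.smul hv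
  have hle : ∀ y, ‖weightedField v y‖ ^ 2 + gradSq (weightedField v) y
      ≤ 17 * ((1 + ‖y‖ ^ 2) * (gradSq v y + ‖v y‖ ^ 2)) := by
    intro y
    have a1 : ‖weightedField v y‖ ^ 2 = (1 + ‖y‖ ^ 2) * ‖v y‖ ^ 2 := by
      rw [weightedField, norm_smul, mul_pow, Real.norm_of_nonneg (Real.sqrt_nonneg _),
        Real.sq_sqrt (by positivity)]
    have a2 := gradSq_weightedField_le hv y
    have a3 : 0 ≤ (1 + ‖y‖ ^ 2) * gradSq v y := mul_nonneg (by positivity) (gradSq_nonneg v y)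
    have a4 : 0 ≤ ‖y‖ ^ 2 * ‖v y‖ ^ 2 := by positivity
    linarith
  have hint : Integrable fun y => ‖weightedField v y‖ ^ 2 + gradSq (weightedField v) y := by
    refine (hi.const_mul 17).mono' ((hf.continuous.norm.pow 2).add
      (continuous_gradSq hf)).aestronglyMeasurable (ae_of_all _ fun y => ?_)
    rw [Real.norm_of_nonneg (add_nonneg (sq_nonneg _) (gradSq_nonneg _ y))]
    exact hle y
  refine memH1_of_contDiff hf hint ((integral_mono hint (hi.const_mul 17) hle).trans ?_)
  rw [integral_const_mul]
  linarith

end SelfSimilarNS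

end

theorem proposition3p1 (β : ℝ≥0) (hβ0 : 0 < β) (hβ1 : β ≤ 1) (A : ℝ≥0) :
    ∃ C : ℝ≥0, ∀ (u₀ v : SelfSimilarNS.Plane → SelfSimilarNS.Plane) (q : SelfSimilarNS.Plane → ℝ),
      SelfSimilarNS.IsSelfSimilar u₀ →
      SelfSimilarNS.IsWeaklyDivFree u₀ →
      SelfSimilarNS.circleHolderNorm β u₀ = A →
      SelfSimilarNS.MemX v →
      MemLp q 2 →
      SelfSimilarNS.IsPerturbedLeraySolution (SelfSimilarNS.heatEvolution 1 u₀) v q →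
      SelfSimilarNS.MemH1 (SelfSimilarNS.weightedField v) ∧
        SelfSimilarNS.eH1Norm (SelfSimilarNS.weightedField v) ≤ C := by
  obtain ⟨c, -, hc⟩ := SelfSimilarNS.exists_isProfile hβ0 hβ1 A
  obtain ⟨B, hB⟩ := SelfSimilarNS.exists_critical_bound c
  refine ⟨Real.toNNReal √(17 * B), fun u₀ v q hself hdiv hA hX hq hs => ?_⟩
  have h₀ := hc u₀ hself hdiv (SelfSimilarNS.circleHolderBound_of_norm_eq hA)
  obtain ⟨m, h⟩ := hX.exists_isDecaying
  obtain ⟨hi, hle⟩ := hB hs h₀ h hq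
  exact SelfSimilarNS.memH1_weightedField h.contDiff hi hle
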